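/- Let $p=(p(n))_{n\in\mathbb N}$ be a probability distribution on $\mathbb N=\{0,1,2,\dots\}$ with mean $\sum_n n\,p(n)=1$ (critical) and with $0<p(0)<1$, $p(0)+p(1)<1$ (call a distribution with the latter two properties non-degenerate). Let $\mathcal A\subset\mathbb N$ satisfy $p(\mathcal A)=\sum_{n\in\mathcal A}p(n)>0$. Trees are rooted ordered trees, coded as sets of finite sequences of positive integers, in which every vertex $u$ has a finite number $k_u(\mathbf t)$ of children; they form the set $\mathbb T$, endowed with the local distance $d(\mathbf t,\mathbf t')=2^{-\sup\{h\in\mathbb N:\ r_h(\mathbf t)=r_h(\mathbf t')\}}$, where $r_h(\mathbf t)$ is the set of vertices of $\mathbf t$ of height at most $h$, and with its Borel $\sigma$-field. Write $|\mathbf t|$ for the number of vertices of $\mathbf t$, and $L_{\mathcal A}(\mathbf t)=\mathrm{Card}\{u\in\mathbf t:\ k_u(\mathbf t)\in\mathcal A\}$. A Galton–Watson (GW) tree with offspring distribution $q$ is a $\mathbb T$-valued random variable $\sigma$ such that the number of children of the root has law $q$ and, for $n\ge 1$, conditionally on this number being $n$, the $n$ sub-trees above the children of the root are independent and distributed as $\sigma$.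 The Kesten's tree $\tau^*$ associated to $p$ is the random tree whose individuals are normal or special and reproduce independently as follows: the root is special; a normal individual has only normal children, their number having law $p$; the number of children of a special individual has the size-biased law $p^*(n)=n\,p(n)/\sum_k k\,p(k)$, and one of these children, chosen uniformly at random, is special, the others being normal. Let $\tau$ be a GW tree with offspring distribution $p$ and $\tau^*$ a Kesten's tree associated to $p$. Then: 1. There is a critical non-degenerate distribution $p_{\mathcal A}$ on $\mathbb N$ such that, conditionally on $\{L_{\mathcal A}(\tau)>0\}$, $L_{\mathcal A}(\tau)$ is distributed as $|\tau_{\mathcal A}|$, where $\tau_{\mathcal A}$ is a GW tree with offspring distribution $p_{\mathcal A}$. 2. For every such $p_{\mathcal A}$, let $d_{\mathcal A}=\max\{k:\ p_{\mathcal A}(k\mathbb N)=1\}$ be its period. Then $\mathbb P(L_{\mathcal A}(\tau)\in[n,n+d_{\mathcal A}))>0$ for all $n$ large enough, and if $\tau_n$ is a random tree distributed as $\tau$ conditionally on $\{L_{\mathcal A}(\tau)\in[n,n+d_{\mathcal A})\}$ (for all $n$ for which this event has positive probability), then $\tau_n$ converges in distribution to $\tau^*$ as $n\to\infty$, with respect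 to the distance $d$. 3. For every $n$, $\mathbb P(L_{\mathcal A}(\tau)\ge n)>0$, and if $\tau_n$ is a random tree distributed as $\tau$ conditionally on $\{L_{\mathcal A}(\tau)\ge n\}$, then $\tau_n$ converges in distribution to $\tau^*$ as $n\to\infty$, with respect to the distance $d$. -/

import Mathlib

open MeasureTheory ProbabilityTheory Filter Topology
open scoped ENNReal

noncomputable section

/-! ### Ordered rooted trees in Neveu's formalism -/

/-- Finite sequences of positive integers; `[]` is the root and `u ++ [i]` is the `i`-th child
of `u`. -/
abbrev Node : Type := List ℕ+

/-- Ordered rooted trees all of whose vertices have finitely many children. The tree itself may be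
infinite. -/
@[ext] structure PlaneTree where
  /-- the set of vertices -/
  nodes : Set Node
  root_mem : [] ∈ nodes
  ancestor_mem : ∀ u v : Node, u ++ v ∈ nodes → u ∈ nodes
  exists_degree : ∀ u ∈ nodes, ∃ k : ℕ, ∀ i : ℕ+, u ++ [i] ∈ nodes ↔ (i : ℕ) ≤ k

namespace PlaneTree

/-- `k_u(t)`, the number of children of `u` in `t` (used for `u ∈ t` only). -/
def outDegree (t : PlaneTree) (u : Node) : ℕ := {i : ℕ+ | u ++ [i] ∈ t.nodes}.ncard

/-- `|t|`, the number of vertices of `t`, possibly infinite. -/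
def size (t : PlaneTree) : ℕ∞ := t.nodes.encard

/-- `L_A(t)`, the number of vertices of `t` whose out-degree belongs to `A`, possibly infinite. -/
def numDegreeIn (A : Set ℕ) (t : PlaneTree) : ℕ∞ := {u ∈ t.nodes | t.outDegree u ∈ A}.encard

/-- The sub-tree of `t` above a vertex `u` of `t`, re-rooted at `u`. -/
def subtreeAt (t : PlaneTree) (u : Node) (hu : u ∈ t.nodes) : PlaneTree where
  nodes := {v | u ++ v ∈ t.nodes}
  root_mem := by simpa using hu
  ancestor_mem v w h := t.ancestor_mem (u ++ v) w (by simpa using h)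
  exists_degree v hv := by simpa using t.exists_degree (u ++ v) hv

open Classical in
/-- The sub-tree of `t` above the `i`-th child of the root. The value `t` when the root has fewer
than `i` children is never used. -/
def childSubtree (i : ℕ+) (t : PlaneTree) : PlaneTree :=
  if h : [i] ∈ t.nodes then t.subtreeAt [i] h else t

/-- `r_h(t)`: the vertices of `t` at height at most `h`. -/
def restrict (h : ℕ) (t : PlaneTree) : Set Node := {u ∈ t.nodes | u.length ≤ h}

theorem restrict_mono {s t : PlaneTree} {g h : ℕ} (hgh : g ≤ h)
    (e : s.restrict h = t.restrict h) : s.restrict g = t.restrict g := by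
  ext u
  have := Set.ext_iff.1 e u
  simp only [restrict, Set.mem_ofPred_eq] at this ⊢
  constructor
  · exact fun ⟨a, b⟩ => ⟨(this.1 ⟨a, b.trans hgh⟩).1, b⟩
  · exact fun ⟨a, b⟩ => ⟨(this.2 ⟨a, b.trans hgh⟩).1, b⟩

theorem eq_of_restrict {s t : PlaneTree} (e : ∀ h, s.restrict h = t.restrict h) : s = t := by
  ext u
  have := Set.ext_iff.1 (e u.length) u
  simpa [restrict] using this

open Classical in
/-- The local distance `d(s, t) = 2 ^ (- sup {h : r_h(s) = r_h(t)})`, equal to `0` when `s = t`. -/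
def localDist (s t : PlaneTree) : ℝ :=
  if s = t then 0 else (1 / 2 : ℝ) ^ sSup {h : ℕ | s.restrict h = t.restrict h}

theorem localDist_le_iff (s t : PlaneTree) (h : ℕ) :
    localDist s t ≤ (1 / 2 : ℝ) ^ h ↔ s.restrict h = t.restrict h := by
  unfold localDist
  split_ifs with e
  · subst e; simp
  · obtain ⟨b, hb⟩ : ∃ b, s.restrict b ≠ t.restrict b := by
      by_contra! hc
      exact e (eq_of_restrict hc)
    have hbdd : BddAbove {h : ℕ | s.restrict h = t.restrict h} :=
      ⟨b, fun g hg => le_of_not_ge fun hbg => hb (restrict_mono hbg hg)⟩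
    have hne : {h : ℕ | s.restrict h = t.restrict h}.Nonempty := by
      refine ⟨0, ?_⟩
      ext u
      constructor <;> rintro ⟨-, hu⟩ <;>
        · rw [Nat.le_zero, List.length_eq_zero_iff] at hu
          subst hu
          exact ⟨root_mem _, by simp⟩
    rw [pow_le_pow_iff_right_of_lt_one₀ (by norm_num) (by norm_num)]
    constructor
    · exact fun hle => restrict_mono hle (Nat.sSup_mem hne hbdd)
    · exact fun hh => le_csSup hbdd hh

theorem localDist_cases (s t : PlaneTree) :
    localDist s t = 0 ∨ ∃ h : ℕ, localDist s t = (1 / 2 : ℝ) ^ h := by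
  unfold localDist
  split_ifs
  · exact Or.inl rfl
  · exact Or.inr ⟨_, rfl⟩

theorem localDist_nonneg (s t : PlaneTree) : 0 ≤ localDist s t := by
  unfold localDist
  split_ifs <;> positivity

theorem localDist_comm (s t : PlaneTree) : localDist s t = localDist t s := by
  have h2 : {h | s.restrict h = t.restrict h} = {h | t.restrict h = s.restrict h} :=
    Set.ext fun _ => eq_comm
  by_cases e : s = t
  · rw [e]
  · rw [localDist, localDist, if_neg e, if_neg (Ne.symm e), h2]

theorem eq_of_localDist_eq_zero {s t : PlaneTree} (h : localDist s t = 0) : s = t :=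
  eq_of_restrict fun g => (localDist_le_iff s t g).1 (by rw [h]; positivity)

theorem localDist_self (t : PlaneTree) : localDist t t = 0 := by simp [localDist]

theorem localDist_triangle (s t u : PlaneTree) :
    localDist s u ≤ localDist s t + localDist t u := by
  have hst := localDist_nonneg s t
  have htu := localDist_nonneg t u
  rcases localDist_cases s t with h1 | ⟨a, h1⟩
  · rw [eq_of_localDist_eq_zero h1, localDist_self]; linarith
  rcases localDist_cases t u with h2 | ⟨b, h2⟩
  · rw [← eq_of_localDist_eq_zero h2, localDist_self]; linarith
  have e1 := (localDist_le_iff s t a).1 h1.le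
  have e2 := (localDist_le_iff t u b).1 h2.le
  have e3 : localDist s u ≤ (1 / 2 : ℝ) ^ min a b :=
    (localDist_le_iff s u _).2
      ((restrict_mono (min_le_left a b) e1).trans (restrict_mono (min_le_right a b) e2))
  rcases min_choice a b with h | h <;> rw [h] at e3 <;> linarith

/-- The topology on trees is the topology of local convergence. -/
instance : MetricSpace PlaneTree where
  dist := localDist
  dist_self := localDist_self
  dist_comm := localDist_comm
  dist_triangle := localDist_triangle
  eq_of_dist_eq_zero := eq_of_localDist_eq_zero

instance : MeasurableSpace PlaneTree := borel PlaneTree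

instance : BorelSpace PlaneTree := ⟨rfl⟩

/-- The tree in which every vertex `u` has `k u` children. -/
def ofDegrees (k : Node → ℕ) : PlaneTree where
  nodes := {u | ∀ (v : Node) (i : ℕ+), v ++ [i] <+: u → (i : ℕ) ≤ k v}
  root_mem v i h := by simp at h
  ancestor_mem u w h v i hv := h v i (hv.trans (List.prefix_append u w))
  exists_degree u hu := by
    refine ⟨k u, fun i => ⟨fun h => h u i List.prefix_rfl, fun hi v j hv => ?_⟩⟩
    rcases List.prefix_concat_iff.1 hv with h | h
    · obtain ⟨rfl, hj⟩ := List.append_inj' h rfl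
      obtain rfl : j = i := by simpa using hj
      exact hi
    · exact hu v j h

end PlaneTree

/-! ### Offspring distributions and Galton-Watson trees -/

/-- The mean `∑ n p(n)` of a probability distribution on `ℕ`, possibly infinite. -/
def offspringMean (p : PMF ℕ) : ℝ≥0∞ := ∑' n : ℕ, (n : ℝ≥0∞) * p n

/-- `0 < p(0) < 1` and `p(0) + p(1) < 1`. -/
def IsNondegenerate (p : PMF ℕ) : Prop := 0 < p 0 ∧ p 0 < 1 ∧ p 0 + p 1 < 1

/-- The period: the largest `k` such that `p` is carried by the multiples of `k`. -/
def offspringPeriod (p : PMF ℕ) : ℕ := sSup {k : ℕ | p.toMeasure {n : ℕ | k ∣ n} = 1}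

/-- `τ` is a Galton-Watson tree with offspring distribution `p`: the number of children of the root
has law `p` and, conditionally on this number being `n ≥ 1`, the `n` sub-trees above the children of
the root are independent and distributed as `τ`. -/
structure IsGWTree (p : PMF ℕ) {Ω : Type*} [MeasurableSpace Ω] (τ : Ω → PlaneTree)
    (P : Measure Ω) : Prop where
  measurable : Measurable τ
  root_law : ∀ n : ℕ, P {ω | (τ ω).outDegree [] = n} = p n
  branching : ∀ n : ℕ, 1 ≤ n → P {ω | (τ ω).outDegree [] = n} ≠ 0 →
    iIndepFun (fun (i : Fin n) ω => (τ ω).childSubtree i.val.succPNat)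
      P[|{ω | (τ ω).outDegree [] = n}] ∧
    ∀ i : Fin n, IdentDistrib (fun ω => (τ ω).childSubtree i.val.succPNat) τ
      P[|{ω | (τ ω).outDegree [] = n}] P

/-! ### Kesten's tree -/

/-- The size-biased distribution `n p(n) / m`, where `m` is the mean of `p`. -/
def sizeBiased (p : PMF ℕ) (h0 : offspringMean p ≠ 0) (h1 : offspringMean p ≠ ∞) : PMF ℕ :=
  PMF.normalize (fun n : ℕ => (n : ℝ≥0∞) * p n)
    (show ∑' n : ℕ, (n : ℝ≥0∞) * p n ≠ 0 from h0) (show ∑' n : ℕ, (n : ℝ≥0∞) * p n ≠ ∞ from h1)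

/-- The offspring of a special individual: its number `n` of children, which is size-biased,
together with the rank of its special child, which is uniform on `{1, …, n}` given `n`. (The case
`n = 0` has probability zero.) -/
def specialOffspring (p : PMF ℕ) (h0 : offspringMean p ≠ 0) (h1 : offspringMean p ≠ ∞) :
    PMF (ℕ × ℕ) :=
  (sizeBiased p h0 h1).bind fun n =>
    if hn : 1 ≤ n then
      (PMF.uniformOfFinset (Finset.Icc 1 n) (Finset.nonempty_Icc.2 hn)).map fun i => (n, i)
    else PMF.pure (0, 0)

/-- The special individuals, when `I u` is the rank of the special child of `u` in case `u` is
special. All other individuals are normal. -/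
inductive IsSpecial (I : Node → ℕ) : Node → Prop
  | root : IsSpecial I []
  | child (u : Node) (i : ℕ+) : IsSpecial I u → (i : ℕ) = I u → IsSpecial I (u ++ [i])

open Classical in
/-- The tree in which an individual `u` has `(x u).1` children if it is normal, and has
`(x u).2.1` children, of which the one of rank `(x u).2.2` is special, if it is special. -/
def kestenTree (x : Node → ℕ × (ℕ × ℕ)) : PlaneTree :=
  PlaneTree.ofDegrees fun u =>
    if IsSpecial (fun v => (x v).2.2) u then (x u).2.1 else (x u).1

/-- The law of Kesten's tree: all the individuals reproduce independently, the normal ones according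
to `p` and the special ones according to `specialOffspring p`. -/
def kestenLaw (p : PMF ℕ) (h0 : offspringMean p ≠ 0) (h1 : offspringMean p ≠ ∞) :
    Measure PlaneTree :=
  (Measure.infinitePi fun _ : Node =>
    p.toMeasure.prod (specialOffspring p h0 h1).toMeasure).map kestenTree

/-- `τ` is a Kesten's tree associated to `p`. -/
structure IsKestenTree (p : PMF ℕ) (h0 : offspringMean p ≠ 0) (h1 : offspringMean p ≠ ∞)
    {Ω : Type*} [MeasurableSpace Ω] (τ : Ω → PlaneTree) (P : Measure Ω) : Prop where
  measurable : Measurable τ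
  law : P.map τ = kestenLaw p h0 h1

/-! ### Conditioning on the number of vertices with out-degree in `A` -/

/-- `q` is an offspring distribution `p_A` attached to the random tree `τ` and to `A`: it is
critical and non-degenerate and, conditionally on `L_A(τ) > 0`, the variable `L_A(τ)` has the law of
the total size of a Galton-Watson tree with offspring distribution `q`. -/
def IsReducedOffspring (A : Set ℕ) {Ω : Type*} [MeasurableSpace Ω] (τ : Ω → PlaneTree)
    (P : Measure Ω) (q : PMF ℕ) : Prop :=
  offspringMean q = 1 ∧ IsNondegenerate q ∧
    ∃ (Ω₁ : Type) (_ : MeasurableSpace Ω₁) (P₁ : Measure Ω₁) (σ : Ω₁ → PlaneTree),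
      IsProbabilityMeasure P₁ ∧ IsGWTree q σ P₁ ∧
      ∀ n : ℕ∞, P[|{ω | 0 < (τ ω).numDegreeIn A}] {ω | (τ ω).numDegreeIn A = n} =
        P₁ {ω | (σ ω).size = n}

/-- For every `n` such that the event `E n` has positive probability, `τₙ n` is distributed as `τ`
conditionally on `E n`. -/
def IsConditionedOn {Ω : Type*} [MeasurableSpace Ω] (τ : Ω → PlaneTree) (P : Measure Ω)
    (E : ℕ → Set Ω) {Ωₙ : ℕ → Type*} [∀ n, MeasurableSpace (Ωₙ n)]
    (τₙ : ∀ n, Ωₙ n → PlaneTree) (Pₙ : ∀ n, Measure (Ωₙ n)) : Prop :=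
  ∀ n, P (E n) ≠ 0 → IdentDistrib (τₙ n) τ (Pₙ n) P[|E n]

end

/-!
The law of `L_A(τ)`, restricted to an event `τ ∈ S`, is encoded by its generating function
`treeSeries A τ P S`.

The generating function `B` of the size `|σ|` of a critical Galton-Watson tree solves
`B = X * q(B)`, and the Otter-Dwass formula `n [Xⁿ] Bᵐ = m [Xⁿ⁻ᵐ] qⁿ` turns the law of `|σ|` into
the coefficients of the powers of `q`. By a Chernoff bound, a fixed proportion of the `n` factors of
`qⁿ` contributes `Xᵏ`; moving `n` and the order by bounded amounts thus hardly changes these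
coefficients, up to an exponentially small error, which criticality makes negligible since `|σ|`
then has infinite mean. So consecutive windows of the law of `|σ|`, of length the period of `q`, are
asymptotically equivalent.

The generating function `F + G` of the offspring distribution, with `F` carried by `A` and `G` by
its complement, gives `L = X * F(L) + G(L)` for that of `L_A(τ)`. Conditionally on `L_A(τ) > 0`,
this becomes `B = X * q(B)` with `q` critical, and this `q` is the distribution `p_A`.

Given that `τ` coincides with `t` up to height `h`, any one of its `k` subtrees at height `h` may
carry almost all of the vertices with out-degree in `A`. Windows that vary slowly then show that the
windows of `L_A(τ)` on this event are at least about `k` times its probability, and `k` times this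
probability dominates the probability that Kesten's tree coincides with `t`. Lower bounds on all the
balls suffice for convergence in distribution, the limit having total mass one, and they pass from
windows to tails, which are disjoint unions of windows.
-/

section MassSeries

open PowerSeries

variable {f g w F : PowerSeries ℝ} {a b s t μ ν : ℝ}

/-- The power series is the generating function of a finite measure on `ℕ`. -/
def IsMass (f : PowerSeries ℝ) : Prop :=
  (∀ n, 0 ≤ coeff n f) ∧ Summable fun n => coeff n f

/-- The sum of a power series at a real point, with the junk value `0` where it diverges. -/
noncomputable def genFun (f : PowerSeries ℝ) (s : ℝ) : ℝ := ∑' n, coeff n f * s ^ n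

theorem genFun_one_right (f : PowerSeries ℝ) : genFun f 1 = ∑' n, coeff n f := by
  simp only [genFun, one_pow, mul_one]

theorem genFun_zero_right (f : PowerSeries ℝ) : genFun f 0 = coeff 0 f := by
  rw [genFun, tsum_eq_single 0 fun n hn => by rw [zero_pow hn, mul_zero], pow_zero, mul_one]

theorem genFun_C_mul (f : PowerSeries ℝ) (a s : ℝ) : genFun (C a * f) s = a * genFun f s := by
  simp only [genFun, coeff_C_mul, mul_assoc, tsum_mul_left]

theorem genFun_X_pow (k : ℕ) (s : ℝ) : genFun (X ^ k) s = s ^ k := by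
  rw [genFun, tsum_eq_single k fun n hn => by rw [coeff_X_pow, if_neg hn, zero_mul],
    coeff_X_pow_self, one_mul]

theorem genFun_one (s : ℝ) : genFun 1 s = 1 := by simpa using genFun_X_pow 0 s

theorem genFun_C (a s : ℝ) : genFun (C a) s = a := by simpa [genFun_one] using genFun_C_mul 1 a s

theorem genFun_X (s : ℝ) : genFun X s = s := by simpa using genFun_X_pow 1 s

theorem coeff_mul_nonneg (hf : ∀ n, 0 ≤ coeff n f) (hg : ∀ n, 0 ≤ coeff n g) (n : ℕ) :
    0 ≤ coeff n (f * g) := by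
  rw [coeff_mul]
  exact Finset.sum_nonneg fun kl _ => mul_nonneg (hf _) (hg _)

theorem isMass_X_pow (k : ℕ) : IsMass (X ^ k) :=
  ⟨fun n => by rw [coeff_X_pow]; split_ifs <;> norm_num,
    summable_of_ne_finset_zero (s := {k}) fun n hn => by
      rw [coeff_X_pow, if_neg (by simpa using hn)]⟩

theorem isMass_one : IsMass 1 := by simpa using isMass_X_pow 0

theorem isMass_X : IsMass X := by simpa using isMass_X_pow 1

namespace IsMass

theorem C_mul (hf : IsMass f) (ha : 0 ≤ a) : IsMass (C a * f) :=
  ⟨fun n => by rw [coeff_C_mul]; exact mul_nonneg ha (hf.1 n), by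
    simpa only [coeff_C_mul] using hf.2.mul_left a⟩

theorem add (hf : IsMass f) (hg : IsMass g) : IsMass (f + g) :=
  ⟨fun n => by rw [map_add]; exact add_nonneg (hf.1 n) (hg.1 n), by
    simpa only [map_add] using hf.2.add hg.2⟩

theorem mul (hf : IsMass f) (hg : IsMass g) : IsMass (f * g) := by
  refine ⟨coeff_mul_nonneg hf.1 hg.1, ?_⟩
  have := (summable_norm_sum_mul_antidiagonal_of_summable_norm hf.2.norm hg.2.norm).of_norm
  simpa only [coeff_mul] using this

theorem pow (hf : IsMass f) (n : ℕ) : IsMass (f ^ n) := by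
  induction n with
  | zero => simpa only [pow_zero] using isMass_one
  | succ n ih => rw [pow_succ]; exact ih.mul hf

theorem prod {ι : Type*} (t : Finset ι) {f : ι → PowerSeries ℝ} (hf : ∀ i, IsMass (f i)) :
    IsMass (∏ i ∈ t, f i) :=
  Finset.prod_induction f IsMass (fun _ _ => mul) isMass_one fun i _ => hf i

theorem summable_mul_pow (hf : IsMass f) (h0 : 0 ≤ s) (h1 : s ≤ 1) :
    Summable fun n => coeff n f * s ^ n :=
  hf.2.of_nonneg_of_le (fun n => mul_nonneg (hf.1 n) (pow_nonneg h0 n))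
    fun n => mul_le_of_le_one_right (hf.1 n) (pow_le_one₀ h0 h1)

theorem genFun_add (hf : IsMass f) (hg : IsMass g) (h0 : 0 ≤ s) (h1 : s ≤ 1) :
    genFun (f + g) s = genFun f s + genFun g s := by
  simp only [genFun, map_add, add_mul]
  exact (hf.summable_mul_pow h0 h1).tsum_add (hg.summable_mul_pow h0 h1)

theorem genFun_mul (hf : IsMass f) (hg : IsMass g) (h0 : 0 ≤ s) (h1 : s ≤ 1) :
    genFun (f * g) s = genFun f s * genFun g s := by
  unfold genFun
  rw [tsum_mul_tsum_eq_tsum_sum_antidiagonal_of_summable_norm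
    (hf.summable_mul_pow h0 h1).norm (hg.summable_mul_pow h0 h1).norm]
  refine tsum_congr fun n => ?_
  rw [coeff_mul, Finset.sum_mul]
  refine Finset.sum_congr rfl fun kl hkl => ?_
  rw [← Finset.HasAntidiagonal.mem_antidiagonal.1 hkl, pow_add]
  ring

theorem genFun_pow (hf : IsMass f) (h0 : 0 ≤ s) (h1 : s ≤ 1) (n : ℕ) :
    genFun (f ^ n) s = genFun f s ^ n := by
  induction n with
  | zero => simpa only [pow_zero] using genFun_one s
  | succ n ih => rw [pow_succ, (hf.pow n).genFun_mul hf h0 h1, ih, pow_succ]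

theorem genFun_nonneg (hf : IsMass f) (h0 : 0 ≤ s) : 0 ≤ genFun f s :=
  tsum_nonneg fun n => mul_nonneg (hf.1 n) (pow_nonneg h0 n)

theorem genFun_mono (hf : IsMass f) (h0 : 0 ≤ s) (h : s ≤ t) (h1 : t ≤ 1) :
    genFun f s ≤ genFun f t :=
  (hf.summable_mul_pow h0 (h.trans h1)).tsum_le_tsum
    (fun n => mul_le_mul_of_nonneg_left (pow_le_pow_left₀ h0 h n) (hf.1 n))
    (hf.summable_mul_pow (h0.trans h) h1)

theorem C_add_C_mul (hf : IsMass f) (ha : 0 ≤ a) (hb : 0 ≤ b) : IsMass (C a + C b * f) := by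
  simpa only [mul_one] using (isMass_one.C_mul ha).add (hf.C_mul hb)

theorem genFun_C_add_C_mul (hf : IsMass f) (ha : 0 ≤ a) (hb : 0 ≤ b) (h0 : 0 ≤ s) (h1 : s ≤ 1) :
    genFun (C a + C b * f) s = a + b * genFun f s := by
  have h := (isMass_one.C_mul ha).genFun_add (hf.C_mul hb) h0 h1
  rwa [mul_one, genFun_C_mul, genFun_C] at h

theorem coeff_le_genFun_one (hf : IsMass f) (n : ℕ) : coeff n f ≤ genFun f 1 := by
  rw [genFun_one_right]
  exact hf.2.le_tsum n fun m _ => hf.1 m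

theorem hasFPowerSeriesAt_genFun (hf : IsMass f) :
    HasFPowerSeriesAt (genFun f) (.ofScalars ℝ fun n => coeff n f) 0 := by
  have hr : 0 < (FormalMultilinearSeries.ofScalars ℝ fun n => coeff n f).radius := by
    refine one_pos.trans_le (FormalMultilinearSeries.le_radius_of_summable _ (r := 1) ?_)
    simpa [FormalMultilinearSeries.ofScalars_norm] using hf.2.abs
  have hsum : genFun f = (FormalMultilinearSeries.ofScalars ℝ fun n => coeff n f).sum := by
    ext s
    exact (FormalMultilinearSeries.ofScalars_sum_eq (𝕜 := ℝ) (fun n => coeff n f) s).symm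
  rw [hsum]
  exact (FormalMultilinearSeries.hasFPowerSeriesOnBall _ hr).hasFPowerSeriesAt

theorem eq_of_genFun_eq (hf : IsMass f) (hg : IsMass g)
    (h : ∀ s, 0 < s → s < 1 → genFun f s = genFun g s) : f = g := by
  have hright : ∀ᶠ s in 𝓝[>] (0 : ℝ), genFun f s = genFun g s :=
    (eventually_mem_nhdsWithin.and (Ioo_mem_nhdsGT one_pos)).mono fun s hs => h s hs.1 hs.2.2
  have hnear : ∀ᶠ s in 𝓝 (0 : ℝ), genFun f s = genFun g s :=
    (hf.hasFPowerSeriesAt_genFun.analyticAt.frequently_eq_iff_eventually_eq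
      hg.hasFPowerSeriesAt_genFun.analyticAt).1
      (hright.frequently.filter_mono (nhdsWithin_mono _ fun _ hs => (Set.mem_Ioi.1 hs).ne'))
  have hcoeff := FormalMultilinearSeries.ofScalars_series_injective ℝ ℝ
    (hf.hasFPowerSeriesAt_genFun.eq_formalMultilinearSeries_of_eventually
      hg.hasFPowerSeriesAt_genFun hnear)
  exact PowerSeries.ext (congrFun hcoeff)

end IsMass

theorem hasSum_genFun {f : ℕ → PowerSeries ℝ} (hF : IsMass F) (hf : ∀ n m, 0 ≤ coeff m (f n))
    (h : ∀ m, HasSum (fun n => coeff m (f n)) (coeff m F)) (h0 : 0 ≤ s) (h1 : s ≤ 1) :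
    HasSum (fun n => genFun (f n) s) (genFun F s) := by
  have hcol : ∀ m, HasSum (fun n => coeff m (f n) * s ^ m) (coeff m F * s ^ m) :=
    fun m => (h m).mul_right (s ^ m)
  have hprod : Summable fun mn : ℕ × ℕ => coeff mn.1 (f mn.2) * s ^ mn.1 :=
    (summable_prod_of_nonneg fun mn => mul_nonneg (hf _ _) (pow_nonneg h0 _)).2
      ⟨fun m => (hcol m).summable,
        (hF.summable_mul_pow h0 h1).congr fun m => (hcol m).tsum_eq.symm⟩
  have hswap : Summable fun nm : ℕ × ℕ => coeff nm.2 (f nm.1) * s ^ nm.2 := hprod.prod_symm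
  have hvalue : ∑' n, genFun (f n) s = genFun F s := calc
    _ = ∑' nm : ℕ × ℕ, coeff nm.2 (f nm.1) * s ^ nm.2 := hswap.tsum_prod.symm
    _ = ∑' mn : ℕ × ℕ, coeff mn.1 (f mn.2) * s ^ mn.1 :=
      (Equiv.prodComm ℕ ℕ).tsum_eq fun mn : ℕ × ℕ => coeff mn.1 (f mn.2) * s ^ mn.1
    _ = genFun F s := hprod.tsum_prod.trans (tsum_congr fun m => (hcol m).tsum_eq)
  exact hvalue ▸ hswap.prod.hasSum

/-- The measure on `ℕ` with generating function `f` has first moment `μ`. -/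
def HasMean (f : PowerSeries ℝ) (μ : ℝ) : Prop := HasSum (fun n : ℕ => (n : ℝ) * coeff n f) μ

theorem hasMean_one : HasMean 1 0 := by
  refine hasSum_zero.congr_fun fun n => ?_
  rcases n with _ | n <;> simp [coeff_one]

theorem hasMean_X : HasMean X 1 := by
  refine (hasSum_ite_eq 1 1).congr_fun fun n => ?_
  rw [coeff_X]
  split_ifs with hn <;> simp [hn]

theorem coeff_X_mul_derivative {R : Type*} [CommSemiring R] (f : PowerSeries R) (n : ℕ) :
    coeff n (X * derivative R f) = n * coeff n f := by
  cases n with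
  | zero => simp
  | succ n => rw [coeff_succ_X_mul, coeff_derivative, Nat.cast_succ, mul_comm]

theorem hasMean_of_isMass_X_mul_derivative (h : IsMass (X * derivative ℝ f)) :
    HasMean f (genFun (X * derivative ℝ f) 1) := by
  have := h.2.hasSum
  rw [← genFun_one_right] at this
  exact this.congr_fun fun n => (coeff_X_mul_derivative f n).symm

namespace HasMean

theorem isMass_X_mul_derivative (hμ : HasMean f μ) (hf : IsMass f) :
    IsMass (X * derivative ℝ f) :=
  ⟨fun n => by rw [coeff_X_mul_derivative]; exact mul_nonneg n.cast_nonneg (hf.1 n), by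
    simpa only [coeff_X_mul_derivative] using hμ.summable⟩

theorem genFun_X_mul_derivative (hμ : HasMean f μ) : genFun (X * derivative ℝ f) 1 = μ := by
  simp only [genFun_one_right, coeff_X_mul_derivative]
  exact hμ.tsum_eq

theorem add (hμ : HasMean f μ) (hν : HasMean g ν) : HasMean (f + g) (μ + ν) :=
  (HasSum.add hμ hν).congr_fun fun n => by rw [map_add, mul_add]

theorem C_mul (hμ : HasMean f μ) (a : ℝ) : HasMean (C a * f) (a * μ) :=
  (HasSum.mul_left a hμ).congr_fun fun n => by rw [coeff_C_mul]; ring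

theorem mul (hμ : HasMean f μ) (hν : HasMean g ν) (hf : IsMass f) (hg : IsMass g) :
    HasMean (f * g) (μ * genFun g 1 + genFun f 1 * ν) := by
  have hleft := (hμ.isMass_X_mul_derivative hf).mul hg
  have hright := hf.mul (hν.isMass_X_mul_derivative hg)
  have hleibniz :
      X * derivative ℝ (f * g) = X * derivative ℝ f * g + f * (X * derivative ℝ g) := by
    rw [Derivation.leibniz]
    simp only [smul_eq_mul]
    ring
  have hmean := hasMean_of_isMass_X_mul_derivative (f := f * g) (hleibniz ▸ hleft.add hright)
  rwa [hleibniz, hleft.genFun_add hright zero_le_one le_rfl,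
    (hμ.isMass_X_mul_derivative hf).genFun_mul hg zero_le_one le_rfl,
    hf.genFun_mul (hν.isMass_X_mul_derivative hg) zero_le_one le_rfl,
    hμ.genFun_X_mul_derivative, hν.genFun_X_mul_derivative] at hmean

theorem pow (hμ : HasMean f μ) (hf : IsMass f) (n : ℕ) :
    HasMean (f ^ n) (n * genFun f 1 ^ (n - 1) * μ) := by
  induction n with
  | zero => simpa using hasMean_one
  | succ n ih =>
    have h := ih.mul hμ (hf.pow n) hf
    rw [hf.genFun_pow zero_le_one le_rfl, ← pow_succ] at h
    convert h using 1
    rcases n with _ | n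
    · simp
    · rw [Nat.add_sub_cancel, Nat.add_sub_cancel]
      push_cast
      ring

theorem of_hasSum_coeff {f : ℕ → PowerSeries ℝ} {μ : ℕ → ℝ} (hμ : ∀ n, HasMean (f n) (μ n))
    (hf : ∀ n m, 0 ≤ coeff m (f n)) (hF : ∀ m, HasSum (fun n => coeff m (f n)) (coeff m F))
    (hν : HasSum μ ν) : HasMean F ν := by
  have hprod : Summable fun nm : ℕ × ℕ => (nm.2 : ℝ) * coeff nm.2 (f nm.1) :=
    (summable_prod_of_nonneg fun nm => mul_nonneg nm.2.cast_nonneg (hf _ _)).2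
      ⟨fun n => (hμ n).summable, hν.summable.congr fun n => (hμ n).tsum_eq.symm⟩
  have htotal : HasSum (fun nm : ℕ × ℕ => (nm.2 : ℝ) * coeff nm.2 (f nm.1)) ν := by
    rw [← hν.tsum_eq, ← tsum_congr fun n => (hμ n).tsum_eq, ← hprod.tsum_prod]
    exact hprod.hasSum
  have hswap : HasSum (fun mn : ℕ × ℕ => (mn.1 : ℝ) * coeff mn.1 (f mn.2)) ν :=
    (Equiv.prodComm ℕ ℕ).hasSum_iff.2 htotal
  exact hswap.prod_fiberwise fun m => (hF m).mul_left (m : ℝ)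

end HasMean

/-- The composition `∑ₙ wₙ fⁿ`, computed coefficientwise as a convergent sum of real numbers. Unlike
`PowerSeries.subst`, it does not require the constant coefficient of `f` to vanish. -/
noncomputable def compSeries (w f : PowerSeries ℝ) : PowerSeries ℝ :=
  .mk fun m => ∑' n, coeff n w * coeff m (f ^ n)

section compSeries

variable (hw : ∀ n, 0 ≤ coeff n w) (hf : IsMass f)
  (hs : Summable fun n => coeff n w * genFun f 1 ^ n)
include hw hf hs

theorem summable_coeff_mul_coeff_pow :
    Summable fun mn : ℕ × ℕ => coeff mn.2 w * coeff mn.1 (f ^ mn.2) := by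
  have hrows : Summable fun nm : ℕ × ℕ => coeff nm.1 w * coeff nm.2 (f ^ nm.1) := by
    have hrow : ∀ n, ∑' m, coeff n w * coeff m (f ^ n) = coeff n w * genFun f 1 ^ n := fun n => by
      rw [tsum_mul_left, ← genFun_one_right, hf.genFun_pow zero_le_one le_rfl]
    refine (summable_prod_of_nonneg fun nm => ?_).2 ⟨?_, ?_⟩
    · exact mul_nonneg (hw nm.1) ((hf.pow nm.1).1 nm.2)
    · exact fun n => (hf.pow n).2.mul_left (coeff n w)
    · exact hs.congr fun n => (hrow n).symm
  exact hrows.prod_symm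

theorem hasSum_coeff_compSeries (m : ℕ) :
    HasSum (fun n => coeff m (C (coeff n w) * f ^ n)) (coeff m (compSeries w f)) := by
  have h := ((summable_coeff_mul_coeff_pow hw hf hs).prod_factor m).hasSum
  simpa only [compSeries, coeff_mk, coeff_C_mul] using h

theorem isMass_compSeries : IsMass (compSeries w f) := by
  refine ⟨fun m => ?_, ?_⟩
  · rw [compSeries, coeff_mk]
    exact tsum_nonneg fun n => mul_nonneg (hw n) ((hf.pow n).1 m)
  · have h := (summable_coeff_mul_coeff_pow hw hf hs).prod
    simpa only [compSeries, coeff_mk] using h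

theorem genFun_compSeries (h0 : 0 ≤ s) (h1 : s ≤ 1) :
    genFun (compSeries w f) s = genFun w (genFun f s) := by
  refine (hasSum_genFun (isMass_compSeries hw hf hs) (fun n => ((hf.pow n).C_mul (hw n)).1)
    (hasSum_coeff_compSeries hw hf hs) h0 h1).tsum_eq.symm.trans (tsum_congr fun n => ?_)
  rw [genFun_C_mul, hf.genFun_pow h0 h1]

theorem HasMean.compSeries (hμ : HasMean f μ)
    (hν : HasSum (fun n : ℕ => coeff n w * (n * genFun f 1 ^ (n - 1))) ν) :
    HasMean (compSeries w f) (ν * μ) :=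
  .of_hasSum_coeff (fun n => (hμ.pow hf n).C_mul (coeff n w))
    (fun n => ((hf.pow n).C_mul (hw n)).1) (hasSum_coeff_compSeries hw hf hs)
    ((hν.mul_right μ).congr_fun fun n => by ring)

end compSeries

/-- The generating function `a + (1 - a) X` of the law giving mass `a` to `0` and `1 - a` to `1`. -/
noncomputable def bernoulliSeries (a : ℝ) : PowerSeries ℝ := C a + C (1 - a) * X

/-- The generating function of a binomial thinning: each of the points counted by `f` is kept with
probability `1 - a`. -/
noncomputable def thinSeries (a : ℝ) (f : PowerSeries ℝ) : PowerSeries ℝ :=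
  compSeries f (bernoulliSeries a)

section thinSeries

theorem hasMean_bernoulliSeries (a : ℝ) : HasMean (bernoulliSeries a) (1 - a) := by
  have := (hasMean_one.C_mul a).add (hasMean_X.C_mul (1 - a))
  rwa [mul_zero, mul_one, mul_one, zero_add] at this

variable (ha0 : 0 ≤ a) (ha1 : a ≤ 1)
include ha0 ha1

theorem isMass_bernoulliSeries : IsMass (bernoulliSeries a) :=
  isMass_X.C_add_C_mul ha0 (sub_nonneg.2 ha1)

theorem genFun_bernoulliSeries (h0 : 0 ≤ s) (h1 : s ≤ 1) :
    genFun (bernoulliSeries a) s = a + (1 - a) * s := by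
  rw [bernoulliSeries, isMass_X.genFun_C_add_C_mul ha0 (sub_nonneg.2 ha1) h0 h1, genFun_X]

theorem genFun_bernoulliSeries_one : genFun (bernoulliSeries a) 1 = 1 := by
  rw [genFun_bernoulliSeries ha0 ha1 zero_le_one le_rfl]
  ring

variable (hf : IsMass f)
include hf

theorem summable_coeff_mul_genFun_bernoulliSeries_pow :
    Summable fun n => coeff n f * genFun (bernoulliSeries a) 1 ^ n := by
  simpa only [genFun_bernoulliSeries_one ha0 ha1, one_pow, mul_one] using hf.2

theorem isMass_thinSeries : IsMass (thinSeries a f) :=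
  isMass_compSeries hf.1 (isMass_bernoulliSeries ha0 ha1)
    (summable_coeff_mul_genFun_bernoulliSeries_pow ha0 ha1 hf)

theorem genFun_thinSeries (h0 : 0 ≤ s) (h1 : s ≤ 1) :
    genFun (thinSeries a f) s = genFun f (a + (1 - a) * s) := by
  rw [thinSeries, genFun_compSeries hf.1 (isMass_bernoulliSeries ha0 ha1)
    (summable_coeff_mul_genFun_bernoulliSeries_pow ha0 ha1 hf) h0 h1,
    genFun_bernoulliSeries ha0 ha1 h0 h1]

theorem HasMean.thinSeries (hμ : HasMean f μ) : HasMean (thinSeries a f) ((1 - a) * μ) := by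
  rw [mul_comm]
  refine (hasMean_bernoulliSeries a).compSeries hf.1 (isMass_bernoulliSeries ha0 ha1)
    (summable_coeff_mul_genFun_bernoulliSeries_pow ha0 ha1 hf) (HasSum.congr_fun hμ fun n => ?_)
  rw [genFun_bernoulliSeries_one ha0 ha1, one_pow, mul_one, mul_comm]

end thinSeries

/-- The sum `∑ₙ fⁿ` of the powers of a series of mass less than one. -/
noncomputable def geomSeries (f : PowerSeries ℝ) : PowerSeries ℝ :=
  compSeries (.mk 1) f

section geomSeries

variable (hf : IsMass f) (hlt : genFun f 1 < 1)
include hf hlt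

theorem summable_coeff_mk_one_mul_pow :
    Summable fun n => coeff n (.mk 1 : PowerSeries ℝ) * genFun f 1 ^ n := by
  simpa using summable_geometric_of_lt_one (hf.genFun_nonneg zero_le_one) hlt

theorem isMass_geomSeries : IsMass (geomSeries f) :=
  isMass_compSeries (by simp) hf (summable_coeff_mk_one_mul_pow hf hlt)

theorem genFun_geomSeries (h0 : 0 ≤ s) (h1 : s ≤ 1) :
    genFun (geomSeries f) s = (1 - genFun f s)⁻¹ := by
  rw [geomSeries, genFun_compSeries (by simp) hf (summable_coeff_mk_one_mul_pow hf hlt) h0 h1]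
  simpa [genFun] using tsum_geometric_of_lt_one (hf.genFun_nonneg h0)
    ((hf.genFun_mono h0 h1 le_rfl).trans_lt hlt)

theorem HasMean.geomSeries (hμ : HasMean f μ) :
    HasMean (geomSeries f) ((1 - genFun f 1)⁻¹ ^ 2 * μ) := by
  refine hμ.compSeries (by simp) hf (summable_coeff_mk_one_mul_pow hf hlt) ?_
  have h := hasSum_choose_mul_geometric_of_norm_lt_one 1
    (show ‖genFun f 1‖ < 1 by rwa [Real.norm_of_nonneg (hf.genFun_nonneg zero_le_one)])
  rw [← hasSum_nat_add_iff' 1]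
  simpa using h

end geomSeries

/-- The series `(f - f(0)) / X`. -/
noncomputable def shiftSeries (f : PowerSeries ℝ) : PowerSeries ℝ := .mk fun n => coeff (n + 1) f

theorem IsMass.shiftSeries (hf : IsMass f) : IsMass (shiftSeries f) := by
  refine ⟨fun n => ?_, ?_⟩ <;> simp only [_root_.shiftSeries, coeff_mk]
  · exact hf.1 _
  · exact (summable_nat_add_iff (f := fun n => coeff n f) 1).2 hf.2

theorem IsMass.genFun_eq_add_shiftSeries (hf : IsMass f) (h0 : 0 ≤ s) (h1 : s ≤ 1) :
    genFun f s = coeff 0 f + s * genFun (_root_.shiftSeries f) s := by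
  simp only [genFun, _root_.shiftSeries, coeff_mk]
  rw [(hf.summable_mul_pow h0 h1).tsum_eq_zero_add, ← tsum_mul_left, pow_zero, mul_one]
  exact congrArg _ (tsum_congr fun n => by rw [pow_succ]; ring)

theorem HasMean.shiftSeries (hμ : HasMean f μ) (hf : IsMass f) :
    HasMean (shiftSeries f) (μ - genFun (shiftSeries f) 1) := by
  have hsucc : HasSum (fun n : ℕ => ((n + 1 : ℕ) : ℝ) * coeff (n + 1) f) μ := by
    simpa using (hasSum_nat_add_iff' (f := fun n : ℕ => (n : ℝ) * coeff n f) 1).2 hμ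
  have hmass := hf.shiftSeries.2.hasSum
  rw [← genFun_one_right] at hmass
  refine (hsucc.sub hmass).congr_fun fun n => ?_
  simp only [_root_.shiftSeries, coeff_mk]
  push_cast
  ring

end MassSeries

section ReducedSeries

open PowerSeries

variable {f g : PowerSeries ℝ} {a s x μ ν : ℝ}

/-- The generating function `x ↦ (g(a + (1 - a) x) - g(a)) / ((1 - a) x)`. -/
noncomputable def thinShiftSeries (a : ℝ) (g : PowerSeries ℝ) : PowerSeries ℝ :=
  shiftSeries (C (1 - a)⁻¹ * thinSeries a g)

section thinShiftSeries

variable (ha0 : 0 ≤ a) (ha1 : a < 1) (hg : IsMass g)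
include ha0 ha1 hg

theorem isMass_thinShiftSeries : IsMass (thinShiftSeries a g) :=
  ((isMass_thinSeries ha0 ha1.le hg).C_mul (inv_nonneg.2 (sub_nonneg.2 ha1.le))).shiftSeries

theorem genFun_eq_add_thinShiftSeries (hx0 : 0 ≤ x) (hx1 : x ≤ 1) :
    genFun g (a + (1 - a) * x) = genFun g a + (1 - a) * (x * genFun (thinShiftSeries a g) x) := by
  have ha : 1 - a ≠ 0 := (sub_pos.2 ha1).ne'
  have hM := isMass_thinSeries ha0 ha1.le hg
  have h := (hM.C_mul (inv_nonneg.2 (sub_nonneg.2 ha1.le))).genFun_eq_add_shiftSeries hx0 hx1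
  rw [coeff_C_mul, ← genFun_zero_right, genFun_C_mul, genFun_thinSeries ha0 ha1.le hg hx0 hx1,
    genFun_thinSeries ha0 ha1.le hg le_rfl zero_le_one, mul_zero, add_zero] at h
  have h' := congrArg ((1 - a) * ·) h
  simp only [mul_add, mul_inv_cancel_left₀ ha] at h'
  exact h'

theorem HasMean.thinShiftSeries (hν : HasMean g ν) :
    HasMean (_root_.thinShiftSeries a g) (ν - genFun (_root_.thinShiftSeries a g) 1) := by
  have h := ((HasMean.thinSeries ha0 ha1.le hg hν).C_mul (1 - a)⁻¹).shiftSeries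
    ((isMass_thinSeries ha0 ha1.le hg).C_mul (inv_nonneg.2 (sub_nonneg.2 ha1.le)))
  rwa [inv_mul_cancel_left₀ (sub_pos.2 ha1).ne'] at h

end thinShiftSeries

/-- The generating function `q` obtained by bringing the equation
`a + (1 - a) x = s f(a + (1 - a) x) + g(a + (1 - a) x)`, where `g(a) = a`, to the form
`x = s q(x)`. When `f` and `g` are the restrictions of an offspring law to `A` and `Aᶜ` and `a` is
the probability that a tree has no vertex with out-degree in `A`, it is the offspring law of the
tree reduced to those vertices. -/
noncomputable def reducedSeries (a : ℝ) (f g : PowerSeries ℝ) : PowerSeries ℝ :=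
  C (1 - a)⁻¹ * (thinSeries a f * geomSeries (thinShiftSeries a g))

variable (ha0 : 0 ≤ a) (ha1 : a < 1) (hf : IsMass f) (hg : IsMass g) (hfix : genFun g a = a)
  (htotal : genFun f 1 + genFun g 1 = 1) (hpos : 0 < genFun f a)

include ha0 ha1 hg hfix htotal in
theorem mul_one_sub_genFun_thinShiftSeries_one :
    (1 - a) * (1 - genFun (thinShiftSeries a g) 1) = genFun f 1 := by
  have h := genFun_eq_add_thinShiftSeries ha0 ha1 hg zero_le_one le_rfl
  rw [hfix, one_mul, mul_one, add_sub_cancel] at h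
  linarith

include ha0 ha1 hf hg hfix htotal hpos

theorem genFun_thinShiftSeries_one_lt_one : genFun (thinShiftSeries a g) 1 < 1 := by
  have h := mul_one_sub_genFun_thinShiftSeries_one ha0 ha1 hg hfix htotal
  have hf1 : 0 < genFun f 1 := hpos.trans_le (hf.genFun_mono ha0 ha1.le le_rfl)
  exact sub_pos.1 (pos_of_mul_pos_right (h ▸ hf1) (sub_nonneg.2 ha1.le))

theorem isMass_reducedSeries : IsMass (reducedSeries a f g) :=
  ((isMass_thinSeries ha0 ha1.le hf).mul (isMass_geomSeries (isMass_thinShiftSeries ha0 ha1 hg)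
    (genFun_thinShiftSeries_one_lt_one ha0 ha1 hf hg hfix htotal hpos))).C_mul
    (inv_nonneg.2 (sub_nonneg.2 ha1.le))

theorem genFun_reducedSeries (hx0 : 0 ≤ x) (hx1 : x ≤ 1) :
    genFun (reducedSeries a f g) x =
      (1 - a)⁻¹ * (genFun f (a + (1 - a) * x) * (1 - genFun (thinShiftSeries a g) x)⁻¹) := by
  have hlt := genFun_thinShiftSeries_one_lt_one ha0 ha1 hf hg hfix htotal hpos
  have hψ := isMass_thinShiftSeries ha0 ha1 hg
  rw [reducedSeries, genFun_C_mul, (isMass_thinSeries ha0 ha1.le hf).genFun_mul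
    (isMass_geomSeries hψ hlt) hx0 hx1, genFun_thinSeries ha0 ha1.le hf hx0 hx1,
    genFun_geomSeries hψ hlt hx0 hx1]

theorem genFun_reducedSeries_one : genFun (reducedSeries a f g) 1 = 1 := by
  have h := mul_one_sub_genFun_thinShiftSeries_one ha0 ha1 hg hfix htotal
  have ha : 1 - a ≠ 0 := (sub_pos.2 ha1).ne'
  have hψ : 1 - genFun (thinShiftSeries a g) 1 ≠ 0 :=
    (sub_pos.2 (genFun_thinShiftSeries_one_lt_one ha0 ha1 hf hg hfix htotal hpos)).ne'
  rw [genFun_reducedSeries ha0 ha1 hf hg hfix htotal hpos zero_le_one le_rfl, mul_one,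
    add_sub_cancel, ← h]
  field_simp

theorem coeff_zero_reducedSeries_pos : 0 < coeff 0 (reducedSeries a f g) := by
  have hlt := (isMass_thinShiftSeries ha0 ha1 hg).genFun_mono le_rfl zero_le_one le_rfl |>.trans_lt
    (genFun_thinShiftSeries_one_lt_one ha0 ha1 hf hg hfix htotal hpos)
  rw [← genFun_zero_right,
    genFun_reducedSeries ha0 ha1 hf hg hfix htotal hpos le_rfl zero_le_one, mul_zero, add_zero]
  exact mul_pos (inv_pos.2 (sub_pos.2 ha1)) (mul_pos hpos (inv_pos.2 (sub_pos.2 hlt)))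

theorem eq_mul_genFun_reducedSeries (hx0 : 0 ≤ x) (hx1 : x ≤ 1)
    (hx : a + (1 - a) * x = s * genFun f (a + (1 - a) * x) + genFun g (a + (1 - a) * x)) :
    x = s * genFun (reducedSeries a f g) x := by
  have ha : 1 - a ≠ 0 := (sub_pos.2 ha1).ne'
  have hψ : 1 - genFun (thinShiftSeries a g) x ≠ 0 := by
    have := (isMass_thinShiftSeries ha0 ha1 hg).genFun_mono hx0 hx1 le_rfl
    exact (sub_pos.2 (this.trans_lt
      (genFun_thinShiftSeries_one_lt_one ha0 ha1 hf hg hfix htotal hpos))).ne'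
  rw [genFun_eq_add_thinShiftSeries ha0 ha1 hg hx0 hx1, hfix] at hx
  rw [genFun_reducedSeries ha0 ha1 hf hg hfix htotal hpos hx0 hx1]
  generalize genFun f (a + (1 - a) * x) = y at hx ⊢
  field_simp
  linarith

theorem HasMean.reducedSeries (hμ : HasMean f μ) (hν : HasMean g ν) (hcrit : μ + ν = 1) :
    HasMean (_root_.reducedSeries a f g) 1 := by
  have hlt := genFun_thinShiftSeries_one_lt_one ha0 ha1 hf hg hfix htotal hpos
  have hψ := isMass_thinShiftSeries ha0 ha1 hg
  have ha : 1 - a ≠ 0 := (sub_pos.2 ha1).ne'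
  have hψ1 : 1 - genFun (_root_.thinShiftSeries a g) 1 ≠ 0 := (sub_pos.2 hlt).ne'
  have h := ((HasMean.thinSeries ha0 ha1.le hf hμ).mul
    ((HasMean.thinShiftSeries ha0 ha1 hg hν).geomSeries hψ hlt) (isMass_thinSeries ha0 ha1.le hf)
    (isMass_geomSeries hψ hlt)).C_mul (1 - a)⁻¹
  rw [genFun_geomSeries hψ hlt zero_le_one le_rfl,
    genFun_thinSeries ha0 ha1.le hf zero_le_one le_rfl, mul_one, add_sub_cancel,
    ← mul_one_sub_genFun_thinShiftSeries_one ha0 ha1 hg hfix htotal] at h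
  refine (congrArg (HasMean _) ?_).mpr h
  rw [eq_sub_of_add_eq hcrit]
  field_simp
  ring

end ReducedSeries

section Dwass

open PowerSeries

variable {R : Type*} [CommRing R] {q B : PowerSeries R}

theorem constantCoeff_of_eq_X_mul_subst (hB : B = X * q.subst B) : constantCoeff B = 0 := by
  rw [hB, ← coeff_zero_eq_constantCoeff_apply, coeff_zero_X_mul]

theorem coeff_pow_eq_zero_of_lt (hB : constantCoeff B = 0) {n m : ℕ} (h : n < m) :
    coeff n (B ^ m) = 0 :=
  X_pow_dvd_iff.1 (pow_dvd_pow_of_dvd (X_dvd_iff.2 hB) m) n h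

theorem coeff_subst_eq_sum (hB : constantCoeff B = 0) (f : PowerSeries R) (n : ℕ) :
    coeff n (f.subst B) = ∑ d ∈ Finset.range (n + 1), coeff d f * coeff n (B ^ d) := by
  simp only [coeff_subst' (HasSubst.of_constantCoeff_zero' hB), smul_eq_mul]
  refine finsum_eq_sum_of_support_subset _ (Function.support_subset_iff'.2 fun d hd => ?_)
  rw [coeff_pow_eq_zero_of_lt hB (by simpa using hd), mul_zero]

theorem coeff_pow_of_eq_X_mul_subst (hB : B = X * q.subst B) (m k : ℕ) :
    coeff (m + k) (B ^ m) =
      ∑ d ∈ Finset.range (k + 1), coeff d (q ^ m) * coeff k (B ^ d) := by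
  have hB0 := constantCoeff_of_eq_X_mul_subst hB
  conv_lhs => rw [hB]
  rw [mul_pow, ← subst_pow (HasSubst.of_constantCoeff_zero' hB0), coeff_X_pow_mul',
    if_pos (Nat.le_add_right m k), Nat.add_sub_cancel_left, coeff_subst_eq_sum hB0]

theorem sum_antidiagonal_coeff_pow (q : PowerSeries R) (m n k : ℕ) :
    ((m + n : ℕ) : R) * ∑ ij ∈ Finset.HasAntidiagonal.antidiagonal k,
      (ij.1 * coeff ij.1 (q ^ m)) * coeff ij.2 (q ^ n) = m * (k * coeff k (q ^ (m + n))) := by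
  have hderiv : ((m + n : ℕ) : PowerSeries R) * ((X * derivative R (q ^ m)) * q ^ n) =
      (m : PowerSeries R) * (X * derivative R (q ^ (m + n))) := by
    rw [derivative_pow, derivative_pow]
    rcases m with _ | m
    · simp
    · rw [show m + 1 + n - 1 = m + n by omega, Nat.add_sub_cancel, pow_add]
      ring
  have hcoeff := congrArg (coeff k) hderiv
  rw [← map_natCast (C (R := R)), ← map_natCast (C (R := R)), coeff_C_mul, coeff_C_mul,
    coeff_X_mul_derivative, coeff_mul] at hcoeff
  simpa only [coeff_X_mul_derivative] using hcoeff

/-- The Otter–Dwass formula, a form of Lagrange inversion. -/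
theorem mul_coeff_pow_eq [IsDomain R] [CharZero R] (hB : B = X * q.subst B) (n m : ℕ)
    (hm : m ≤ n) : (n : R) * coeff n (B ^ m) = m * coeff (n - m) (q ^ n) := by
  induction n using Nat.strong_induction_on generalizing m with
  | _ n ih =>
  rcases Nat.eq_zero_or_pos m with rfl | hm0
  · rcases Nat.eq_zero_or_pos n with rfl | hn
    · simp
    · simp [coeff_one, hn.ne']
  obtain ⟨k, rfl⟩ := Nat.exists_eq_add_of_le hm
  rw [Nat.add_sub_cancel_left]
  rcases Nat.eq_zero_or_pos k with rfl | hk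
  · have h := coeff_pow_of_eq_X_mul_subst hB m 0
    simp only [add_zero, zero_add, Finset.sum_range_one, pow_zero, coeff_one, if_true, mul_one] at h
    rw [add_zero, h]
  have hsum : (k : R) * coeff (m + k) (B ^ m) =
      ∑ ij ∈ Finset.HasAntidiagonal.antidiagonal k,
        (ij.1 * coeff ij.1 (q ^ m)) * coeff ij.2 (q ^ k) := by
    rw [coeff_pow_of_eq_X_mul_subst hB, Finset.mul_sum,
      Finset.Nat.sum_antidiagonal_eq_sum_range_succ
        (fun i j => ((i : R) * coeff i (q ^ m)) * coeff j (q ^ k))]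
    refine Finset.sum_congr rfl fun d hd => ?_
    rw [mul_left_comm, ih k (by omega) d (Finset.mem_range_succ_iff.1 hd)]
    ring
  refine mul_left_cancel₀ (Nat.cast_ne_zero.2 hk.ne' : (k : R) ≠ 0) ?_
  rw [mul_left_comm, hsum, sum_antidiagonal_coeff_pow, mul_left_comm]

theorem succ_mul_coeff_succ [IsDomain R] [CharZero R] (hB : B = X * q.subst B) (n : ℕ) :
    ((n + 1 : ℕ) : R) * coeff (n + 1) B = coeff n (q ^ (n + 1)) := by
  simpa using mul_coeff_pow_eq hB (n + 1) 1 (by omega)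

end Dwass

section Concentration

open PowerSeries

section Weights

variable {p : ℝ}

theorem mul_exp_add_one_sub_le_exp (hp0 : 0 ≤ p) (hp1 : p ≤ 1) {θ : ℝ} (hθ : |θ| ≤ 1) :
    p * Real.exp θ + (1 - p) ≤ Real.exp (p * θ + θ ^ 2) := by
  have hquad : Real.exp θ - 1 - θ ≤ θ ^ 2 := (abs_le.1 (Real.abs_exp_sub_one_sub_id_le hθ)).2
  have hscaled : p * (Real.exp θ - 1 - θ) ≤ θ ^ 2 :=
    (mul_le_mul_of_nonneg_left hquad hp0).trans (mul_le_of_le_one_left (sq_nonneg θ) hp1)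
  linarith [Real.add_one_le_exp (p * θ + θ ^ 2)]

theorem abs_le_mul_add_exp_add_exp {x N ε : ℝ} (hε : 0 ≤ ε) (hx : |x| ≤ N) :
    |x| ≤ N * (ε + Real.exp (ε / 2 * (x - ε * N)) + Real.exp (ε / 2 * (-x - ε * N))) := by
  have hN : 0 ≤ N := (abs_nonneg x).trans hx
  have hpos₁ := Real.exp_pos (ε / 2 * (x - ε * N))
  have hpos₂ := Real.exp_pos (ε / 2 * (-x - ε * N))
  rcases le_or_gt |x| (ε * N) with h | h
  · rw [mul_comm ε] at h
    exact h.trans (mul_le_mul_of_nonneg_left (by linarith) hN)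
  · refine hx.trans (le_mul_of_one_le_right hN ?_)
    rcases lt_abs.1 h with h | h
    · linarith [Real.one_le_exp (x := ε / 2 * (x - ε * N))
        (mul_nonneg (by linarith) (by linarith))]
    · linarith [Real.one_le_exp (x := ε / 2 * (-x - ε * N))
        (mul_nonneg (by linarith) (by linarith))]

variable {N : ℕ} {c : ℕ → ℝ}
  (hmoment : ∀ y, 0 ≤ y → ∑ j ∈ Finset.range (N + 1), y ^ j * c j ≤ (p * y + (1 - p)) ^ N)
include hmoment

theorem sum_exp_mul_sub_mul_le (hp0 : 0 ≤ p) (hp1 : p ≤ 1) {θ : ℝ} (hθ : |θ| ≤ 1) :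
    ∑ j ∈ Finset.range (N + 1), Real.exp (θ * (j - N * p)) * c j ≤ Real.exp (N * θ ^ 2) := by
  calc ∑ j ∈ Finset.range (N + 1), Real.exp (θ * (j - N * p)) * c j
      = Real.exp (-(N * (p * θ))) * ∑ j ∈ Finset.range (N + 1), Real.exp θ ^ j * c j := by
        rw [Finset.mul_sum]
        refine Finset.sum_congr rfl fun j _ => ?_
        rw [← Real.exp_nat_mul, ← mul_assoc, ← Real.exp_add]
        ring_nf
    _ ≤ Real.exp (-(N * (p * θ))) * Real.exp (p * θ + θ ^ 2) ^ N := by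
        refine mul_le_mul_of_nonneg_left ((hmoment _ (Real.exp_nonneg θ)).trans ?_)
          (Real.exp_nonneg _)
        exact pow_le_pow_left₀ (add_nonneg (mul_nonneg hp0 (Real.exp_nonneg θ)) (sub_nonneg.2 hp1))
          (mul_exp_add_one_sub_le_exp hp0 hp1 hθ) N
    _ = Real.exp (N * θ ^ 2) := by
        rw [← Real.exp_nat_mul, ← Real.exp_add]
        ring_nf

/-- A Chernoff bound, for weights whose moments are dominated by those of a binomial law. -/
theorem abs_sum_mul_sub_mul_sum_le (hp0 : 0 ≤ p) (hp1 : p ≤ 1) (hc : ∀ j, 0 ≤ c j) {ε : ℝ}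
    (hε0 : 0 ≤ ε) (hε1 : ε ≤ 1) :
    |∑ j ∈ Finset.range (N + 1), j * c j - N * p * ∑ j ∈ Finset.range (N + 1), c j| ≤
      N * (ε * ∑ j ∈ Finset.range (N + 1), c j + 2 * Real.exp (-(ε ^ 2 / 4)) ^ N) := by
  have htail : ∀ θ : ℝ, |θ| = ε / 2 → ∑ j ∈ Finset.range (N + 1),
      Real.exp (θ * (j - N * p) - ε / 2 * (ε * N)) * c j ≤ Real.exp (-(ε ^ 2 / 4)) ^ N := by
    intro θ hθ
    have hθsq : θ ^ 2 = ε ^ 2 / 4 := by rw [← sq_abs, hθ]; ring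
    have h := mul_le_mul_of_nonneg_left (sum_exp_mul_sub_mul_le hmoment hp0 hp1
      (hθ.trans_le (by linarith))) (Real.exp_nonneg (-(ε / 2 * (ε * N))))
    rw [Finset.mul_sum, ← Real.exp_add, hθsq] at h
    simp only [← mul_assoc, ← Real.exp_add] at h
    rw [← Real.exp_nat_mul]
    calc _ = _ := Finset.sum_congr rfl fun j _ => by rw [neg_add_eq_sub, mul_assoc]
      _ ≤ _ := h
      _ = _ := by ring_nf
  have habs : |ε / 2| = ε / 2 := abs_of_nonneg (by linarith)
  have hpoint : ∀ j ∈ Finset.range (N + 1), |(j - N * p) * c j| ≤ N * (ε * c j +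
      Real.exp (ε / 2 * (j - N * p) - ε / 2 * (ε * N)) * c j +
      Real.exp (-(ε / 2) * (j - N * p) - ε / 2 * (ε * N)) * c j) := by
    intro j hj
    have hjN : (j : ℝ) ≤ N := by exact_mod_cast Finset.mem_range_succ_iff.1 hj
    have hNp : N * p ≤ N := mul_le_of_le_one_right (Nat.cast_nonneg N) hp1
    have hx : |(j : ℝ) - N * p| ≤ N := abs_le.2
      ⟨by linarith [Nat.cast_nonneg (α := ℝ) j], by linarith [mul_nonneg (Nat.cast_nonneg N) hp0]⟩
    rw [abs_mul, abs_of_nonneg (hc j)]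
    refine (mul_le_mul_of_nonneg_right (abs_le_mul_add_exp_add_exp hε0 hx) (hc j)).trans_eq ?_
    ring_nf
  calc |∑ j ∈ Finset.range (N + 1), j * c j - N * p * ∑ j ∈ Finset.range (N + 1), c j|
      = |∑ j ∈ Finset.range (N + 1), (j - N * p) * c j| := by
        simp only [Finset.mul_sum, ← Finset.sum_sub_distrib, sub_mul]
    _ ≤ _ := (Finset.abs_sum_le_sum_abs _ _).trans (Finset.sum_le_sum hpoint)
    _ ≤ _ := by
        rw [← Finset.mul_sum, Finset.sum_add_distrib, Finset.sum_add_distrib, ← Finset.mul_sum]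
        refine mul_le_mul_of_nonneg_left ?_ (Nat.cast_nonneg N)
        linarith [htail (ε / 2) habs, htail (-(ε / 2)) ((abs_neg _).trans habs)]

end Weights

theorem coeff_C_mul_add_pow {R : Type*} [CommSemiring R] (e r : PowerSeries R) (y : R)
    (N m : ℕ) : coeff m ((C y * e + r) ^ N) =
      ∑ j ∈ Finset.range (N + 1), y ^ j * (N.choose j * coeff m (e ^ j * r ^ (N - j))) := by
  rw [add_pow, map_sum]
  refine Finset.sum_congr rfl fun j _ => ?_
  rw [mul_pow, ← map_pow, ← map_natCast (C (R := R)), mul_comm _ (C _), coeff_C_mul, mul_assoc,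
    coeff_C_mul]
  ring

theorem succ_mul_mul_add_pow {R : Type*} [CommSemiring R] (e r : R) (n : ℕ) :
    ((n + 1 : ℕ) : R) * (e * (e + r) ^ n) = ∑ j ∈ Finset.range (n + 2),
      ((j * (n + 1).choose j : ℕ) : R) * (e ^ j * r ^ (n + 1 - j)) := by
  rw [Finset.sum_range_succ', add_pow, Finset.mul_sum, Finset.mul_sum]
  simp only [zero_mul, Nat.cast_zero, add_zero]
  refine Finset.sum_congr rfl fun j _ => ?_
  rw [mul_comm (j + 1), ← Nat.add_one_mul_choose_eq n j, Nat.add_sub_add_right]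
  push_cast
  ring

variable {q : PowerSeries ℝ}

theorem IsMass.sub_C_coeff_mul_X_pow (hq : IsMass q) (k : ℕ) :
    IsMass (q - C (coeff k q) * X ^ k) := by
  refine ⟨fun i => ?_, ?_⟩
  swap
  · simpa only [map_sub] using hq.2.sub ((isMass_X_pow k).C_mul (hq.1 k)).2
  rw [map_sub, coeff_C_mul, coeff_X_pow]
  split_ifs with h
  · rw [h, mul_one, sub_self]
  · simpa using hq.1 i

/-- Under `n + 1` independent draws from `q` conditioned on their sum, the expected frequency of
the value `k` is close to `coeff k q`: split `q` as `e + r` with `e = C (coeff k q) * X ^ k`, and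
weigh the terms of the binomial expansion of `(e + r) ^ (n + 1)`. -/
theorem abs_coeff_pow_sub_le (hq : IsMass q) (h1 : genFun q 1 = 1) (k : ℕ) {ε : ℝ} (hε0 : 0 ≤ ε)
    (hε1 : ε ≤ 1) (n l : ℕ) :
    |coeff k q * coeff l (q ^ n) - coeff k q * coeff (l + k) (q ^ (n + 1))| ≤
      ε * coeff (l + k) (q ^ (n + 1)) + 2 * Real.exp (-(ε ^ 2 / 4)) ^ (n + 1) := by
  set p := coeff k q
  set e : PowerSeries ℝ := C p * X ^ k with he
  set r := q - e
  set c : ℕ → ℝ := fun j => (n + 1).choose j * coeff (l + k) (e ^ j * r ^ (n + 1 - j)) with hc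
  have hp0 : 0 ≤ p := hq.1 k
  have heM : IsMass e := (isMass_X_pow k).C_mul hp0
  have hrM : IsMass r := hq.sub_C_coeff_mul_X_pow k
  have her : e + r = q := add_sub_cancel e q
  have hge : genFun e 1 = p := by rw [genFun_C_mul, genFun_X_pow, one_pow, mul_one]
  have hgr : genFun r 1 = 1 - p := by
    have h := heM.genFun_add hrM zero_le_one le_rfl
    rw [her, h1, hge] at h
    linarith
  have hc0 : ∀ j, 0 ≤ c j := fun j =>
    mul_nonneg (Nat.cast_nonneg _) (((heM.pow j).mul (hrM.pow _)).1 _)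
  have hmoment : ∀ y, 0 ≤ y →
      ∑ j ∈ Finset.range (n + 1 + 1), y ^ j * c j ≤ (p * y + (1 - p)) ^ (n + 1) := by
    intro y hy
    have hM : IsMass (C y * e + r) := (heM.C_mul hy).add hrM
    rw [← coeff_C_mul_add_pow]
    refine ((hM.pow _).coeff_le_genFun_one _).trans_eq ?_
    rw [hM.genFun_pow zero_le_one le_rfl, (heM.C_mul hy).genFun_add hrM zero_le_one le_rfl,
      genFun_C_mul, hge, hgr, mul_comm p]
  have hsum : ∑ j ∈ Finset.range (n + 1 + 1), c j = coeff (l + k) (q ^ (n + 1)) := by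
    simpa [her, hc] using (coeff_C_mul_add_pow e r 1 (n + 1) (l + k)).symm
  have hmean : ∑ j ∈ Finset.range (n + 1 + 1), j * c j =
      (n + 1 : ℕ) * (p * coeff l (q ^ n)) := by
    have h := congrArg (coeff (l + k)) (succ_mul_mul_add_pow e r n)
    simp only [her, map_sum, ← map_natCast (C (R := ℝ)), coeff_C_mul] at h
    have hq : coeff (l + k) (e * q ^ n) = p * coeff l (q ^ n) := by
      rw [he, mul_assoc, coeff_C_mul, coeff_X_pow_mul]
    rw [← hq, h]
    simp only [hc, Nat.cast_mul, mul_assoc]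
  have h := abs_sum_mul_sub_mul_sum_le hmoment hp0 (h1 ▸ hq.coeff_le_genFun_one k) hc0 hε0 hε1
  rw [hsum, hmean, mul_assoc, ← mul_sub, abs_mul, Nat.abs_cast] at h
  exact le_of_mul_le_mul_left h (Nat.cast_pos.2 n.succ_pos)

end Concentration

section RatioLimit

open PowerSeries Asymptotics

theorem isEquivalent_of_abs_sub_le {α : Type*} {l : Filter α} {u v w : α → ℝ} (hu : u ~[l] w)
    (huv : ∀ ε : ℝ, 0 < ε → ∀ᶠ x in l, |u x - v x| ≤ ε * v x + ε * |w x|) : v ~[l] w := by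
  have hvu : (v - u) =o[l] w := by
    refine isLittleO_iff.2 fun c hc => ?_
    have hε : 0 < min (1 / 2) (c / 6) := by positivity
    filter_upwards [huv _ hε, hu.bound one_pos] with x hx hux
    simp only [Pi.sub_apply, Real.norm_eq_abs, one_mul, ← abs_sub_comm (u x)] at hux ⊢
    have hw : |u x| ≤ 2 * |w x| := by linarith [abs_sub_abs_le_abs_sub (u x) (w x)]
    have hv : v x ≤ 5 * |w x| := by
      rcases le_or_gt (v x) 0 with hv0 | hv0
      · exact hv0.trans (by positivity)
      · have := mul_le_mul_of_nonneg_right (min_le_left (1 / 2) (c / 6)) hv0.le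
        have := mul_le_mul_of_nonneg_right (min_le_left (1 / 2) (c / 6)) (abs_nonneg (w x))
        linarith [neg_abs_le (u x - v x), le_abs_self (u x)]
    calc |u x - v x| ≤ min (1 / 2) (c / 6) * (6 * |w x|) := by
          linarith [mul_le_mul_of_nonneg_left hv hε.le]
      _ ≤ c / 6 * (6 * |w x|) := mul_le_mul_of_nonneg_right (min_le_right _ _) (by positivity)
      _ = c * |w x| := by ring
  simpa only [IsEquivalent, Pi.sub_def, sub_add_sub_cancel] using hvu.add hu

theorem isEquivalent_comp_of_eq_or_eq_succ {b : ℕ → ℝ}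
    (hb : (fun m => b (m + 1)) ~[atTop] b) {k : ℕ → ℕ} (hk : Tendsto k atTop atTop)
    (hsucc : ∀ n, k (n + 1) = k n ∨ k (n + 1) = k n + 1) :
    (fun n => b (k (n + 1))) ~[atTop] fun n => b (k n) := by
  refine isLittleO_iff.2 fun c hc => ?_
  filter_upwards [hk.eventually (hb.bound hc)] with n hn
  rcases hsucc n with h | h
  · simpa [h] using mul_nonneg hc.le (abs_nonneg _)
  · simpa [h] using hn

theorem coeff_zero_pow {R : Type*} [CommSemiring R] (q : PowerSeries R) (n : ℕ) :
    coeff 0 (q ^ n) = coeff 0 q ^ n := by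
  simp only [coeff_zero_eq_constantCoeff_apply, map_pow]

variable {f g q B : PowerSeries ℝ}

namespace IsMass

theorem coeff_mul_coeff_le (hf : IsMass f) (hg : IsMass g) (i j : ℕ) :
    coeff i f * coeff j g ≤ coeff (i + j) (f * g) := by
  rw [coeff_mul]
  exact Finset.single_le_sum (f := fun ij : ℕ × ℕ => coeff ij.1 f * coeff ij.2 g)
    (fun ij _ => mul_nonneg (hf.1 _) (hg.1 _))
    (Finset.HasAntidiagonal.mem_antidiagonal.2 (rfl : (i, j).1 + (i, j).2 = i + j))

theorem coeff_pow_mul_coeff_pow_le (hq : IsMass q) (n m i j : ℕ) :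
    coeff i (q ^ n) * coeff j (q ^ m) ≤ coeff (i + j) (q ^ (n + m)) := by
  rw [pow_add]
  exact (hq.pow n).coeff_mul_coeff_le (hq.pow m) i j

theorem coeff_pow_le_coeff_mul (hf : IsMass f) (i j : ℕ) :
    coeff i f ^ j ≤ coeff (j * i) (f ^ j) := by
  induction j with
  | zero => simp
  | succ j ih =>
    rw [pow_succ, pow_succ, Nat.succ_mul]
    exact (mul_le_mul_of_nonneg_right ih (hf.1 i)).trans ((hf.pow j).coeff_mul_coeff_le hf _ _)

end IsMass

/-- The set of indices of the non-zero coefficients of a power series. -/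
def coeffSupport (q : PowerSeries ℝ) : Set ℕ := {k | coeff k q ≠ 0}

/-- The period of a power series: the greatest common divisor of its support. -/
noncomputable def coeffPeriod (q : PowerSeries ℝ) : ℕ := Nat.setGcd (coeffSupport q)

theorem exists_forall_mem_closure_coeffSupport (q : PowerSeries ℝ) :
    ∃ L, ∀ l, L ≤ l → coeffPeriod q ∣ l → l ∈ AddSubmonoid.closure (coeffSupport q) :=
  Nat.exists_mem_closure_of_ge (coeffSupport q)

theorem coeffPeriod_dvd_of_coeff_pow_ne_zero (n : ℕ) {l : ℕ} (h : coeff l (q ^ n) ≠ 0) :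
    coeffPeriod q ∣ l := by
  induction n generalizing l with
  | zero =>
    obtain rfl : l = 0 := by
      by_contra hl
      simp [coeff_one, hl] at h
    exact dvd_zero _
  | succ n ih =>
    rw [pow_succ, coeff_mul] at h
    obtain ⟨ij, hij, hne⟩ := Finset.exists_ne_zero_of_sum_ne_zero h
    rw [← Finset.HasAntidiagonal.mem_antidiagonal.1 hij]
    exact dvd_add (ih (left_ne_zero_of_mul hne))
      (Nat.setGcd_dvd_of_mem (s := coeffSupport q) (right_ne_zero_of_mul hne))

theorem IsMass.coeff_pow_pos (hq : IsMass q) (h0 : 0 < coeff 0 q) {l : ℕ}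
    (hl : l ∈ AddSubmonoid.closure (coeffSupport q)) : ∀ n, l ≤ n → 0 < coeff l (q ^ n) := by
  induction hl using AddSubmonoid.closure_induction with
  | zero =>
    intro n _
    rw [coeff_zero_pow]
    exact pow_pos h0 n
  | mem k hk =>
    intro n hn
    rcases n with _ | n
    · obtain rfl : k = 0 := by omega
      simp
    · have h := hq.coeff_pow_mul_coeff_pow_le 1 n k 0
      rw [pow_one, coeff_zero_pow, add_zero, add_comm 1 n] at h
      exact (mul_pos ((hq.1 k).lt_of_ne' hk) (pow_pos h0 n)).trans_le h
  | add x y _ _ hx hy =>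
    intro n hn
    have h := hq.coeff_pow_mul_coeff_pow_le x (n - x) x y
    rw [Nat.add_sub_cancel' (by omega)] at h
    exact (mul_pos (hx x le_rfl) (hy (n - x) (by omega))).trans_le h

/-- `q` is the generating function of an offspring law charging `0` and `[2, ∞)`, and `B` that of
the total size of the corresponding tree, which has infinite mean: this is how criticality of `q`
enters. -/
structure IsCriticalPair (q B : PowerSeries ℝ) : Prop where
  mass : IsMass q
  genFun_one : genFun q 1 = 1
  zero_pos : 0 < coeff 0 q
  exists_two_le : ∃ k, 2 ≤ k ∧ coeff k q ≠ 0
  eq_subst : B = X * q.subst B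
  not_summable : ¬ Summable fun n : ℕ => (n : ℝ) * coeff n B

/-- The subsequence of the coefficients of `qⁿ⁺¹` of order `n` along the multiples `n` of the
period of `q`; by the Otter–Dwass formula this is `(n + 1) * coeff (n + 1) B`. -/
noncomputable def diagCoeff (q : PowerSeries ℝ) (m : ℕ) : ℝ :=
  coeff (coeffPeriod q * m) (q ^ (coeffPeriod q * m + 1))

/-- Moving the order by `e` and the exponent by `i` does not affect the asymptotics of
`diagCoeff q`. -/
def IsDiagEquivalent (q : PowerSeries ℝ) (e i : ℕ) : Prop :=
  (fun m => coeff (coeffPeriod q * m + e) (q ^ (coeffPeriod q * m + 1 + i))) ~[atTop] diagCoeff q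

/-- The sum of the `d` consecutive coefficients of orders in `[n, n + d)`. -/
noncomputable def windowSum (d : ℕ) (f : PowerSeries ℝ) (n : ℕ) : ℝ :=
  ∑ j ∈ Finset.range d, coeff (n + j) f

theorem IsMass.windowSum_nonneg (hf : IsMass f) (d n : ℕ) : 0 ≤ windowSum d f n :=
  Finset.sum_nonneg fun _ _ => hf.1 _

namespace IsCriticalPair

variable (h : IsCriticalPair q B)
include h

theorem coeffPeriod_pos : 0 < coeffPeriod q := by
  obtain ⟨k, hk, hqk⟩ := h.exists_two_le
  exact Nat.pos_of_dvd_of_pos (Nat.setGcd_dvd_of_mem (s := coeffSupport q) hqk) (by omega)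

theorem tendsto_coeffPeriod_mul : Tendsto (fun m : ℕ => coeffPeriod q * m) atTop atTop :=
  tendsto_id.const_mul_atTop' h.coeffPeriod_pos

/-- Otherwise `(n + 1) * coeff (n + 1) B = coeff n (q ^ (n + 1))` would decay geometrically. -/
theorem exists_pow_le_coeff_pow {r : ℝ} (hr0 : 0 < r) (hr1 : r < 1) :
    ∃ M : ℕ, 1 ≤ M ∧ r ^ M ≤ coeff M (q ^ M) := by
  by_contra! hcon
  obtain ⟨k, hk, hqk⟩ := h.exists_two_le
  refine h.not_summable ((summable_nat_add_iff (f := fun n : ℕ => (n : ℝ) * coeff n B) 1).1 ?_)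
  set c := coeff k q * coeff 0 q ^ (k - 2) with hc
  have hc0 : 0 < c := mul_pos ((h.mass.1 k).lt_of_ne' hqk) (pow_pos h.zero_pos _)
  refine ((summable_geometric_of_lt_one hr0.le hr1).mul_left (c⁻¹ * r ^ k)).of_nonneg_of_le
    (fun n => ?_) fun n => ?_ <;> rw [succ_mul_coeff_succ h.eq_subst]
  · exact (h.mass.pow _).1 _
  · have hck := h.mass.coeff_pow_mul_coeff_pow_le 1 (k - 2) k 0
    rw [pow_one, coeff_zero_pow, add_zero, ← hc] at hck
    have hprod := h.mass.coeff_pow_mul_coeff_pow_le (n + 1) (1 + (k - 2)) n k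
    rw [show n + 1 + (1 + (k - 2)) = n + k by omega] at hprod
    have hle : coeff n (q ^ (n + 1)) * c ≤ r ^ (n + k) :=
      (mul_le_mul_of_nonneg_left hck ((h.mass.pow _).1 _)).trans
        (hprod.trans (hcon (n + k) (by omega)).le)
    rw [mul_assoc, ← pow_add, add_comm k n, ← div_eq_inv_mul]
    exact (le_div_iff₀ hc0).2 hle

theorem eventually_diagCoeff_pos : ∀ᶠ m in atTop, 0 < diagCoeff q m := by
  obtain ⟨L, hL⟩ := exists_forall_mem_closure_coeffSupport q
  filter_upwards [h.tendsto_coeffPeriod_mul.eventually_ge_atTop L] with m hm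
  exact h.mass.coeff_pow_pos h.zero_pos (hL _ hm (dvd_mul_right _ _)) _ (Nat.le_succ _)

theorem exists_mul_pow_le_coeff_pow {r : ℝ} (hr0 : 0 < r) (hr1 : r < 1) :
    ∃ δ : ℝ, 0 < δ ∧ ∃ L : ℕ, ∀ n, L ≤ n → coeffPeriod q ∣ n →
      δ * r ^ n ≤ coeff n (q ^ (n + 1)) := by
  obtain ⟨M, hM0, hM⟩ := h.exists_pow_le_coeff_pow hr0 hr1
  have hdM : coeffPeriod q ∣ M :=
    coeffPeriod_dvd_of_coeff_pow_ne_zero M ((pow_pos hr0 M).trans_le hM).ne'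
  obtain ⟨L, hL⟩ := exists_forall_mem_closure_coeffSupport q
  obtain ⟨δ, hδ, hδ0⟩ : ∃ δ : ℝ, (∀ i ∈ Finset.range (L + M),
      0 < coeff i (q ^ (i + 1)) → δ ≤ coeff i (q ^ (i + 1))) ∧ 0 < δ := by
    refine (((Finset.eventually_all _).2 fun i _ => ?_).and
      (self_mem_nhdsWithin : ∀ᶠ δ : ℝ in 𝓝[>] 0, 0 < δ)).exists
    by_cases hi : 0 < coeff i (q ^ (i + 1))
    · exact (eventually_nhdsWithin_of_eventually_nhds (eventually_le_nhds hi)).mono fun _ hδ _ => hδ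
    · exact .of_forall fun _ hi' => absurd hi' hi
  refine ⟨δ, hδ0, L, fun n hn hdn => ?_⟩
  obtain ⟨j, i, hij, hLi, hiM⟩ : ∃ j i, j * M + i = n ∧ L ≤ i ∧ i < L + M :=
    ⟨(n - L) / M, L + (n - L) % M, by have := Nat.div_add_mod' (n - L) M; omega,
      Nat.le_add_right _ _, Nat.add_lt_add_left (Nat.mod_lt _ hM0) L⟩
  have hdi : coeffPeriod q ∣ i := (Nat.dvd_add_right (hdM.mul_left j)).1 (hij ▸ hdn)
  have hδi : δ ≤ coeff i (q ^ (i + 1)) := hδ i (Finset.mem_range.2 hiM)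
    (h.mass.coeff_pow_pos h.zero_pos (hL i hLi hdi) _ (Nat.le_succ i))
  have hrj : r ^ (j * M) ≤ coeff (j * M) (q ^ (j * M)) := by
    rw [mul_comm j M, pow_mul, pow_mul, mul_comm M j]
    exact (pow_le_pow_left₀ (pow_nonneg hr0.le M) hM j).trans
      ((h.mass.pow M).coeff_pow_le_coeff_mul M j)
  have hprod := h.mass.coeff_pow_mul_coeff_pow_le (j * M) (i + 1) (j * M) i
  rw [← add_assoc, hij] at hprod
  refine le_trans ?_ hprod
  rw [mul_comm δ]
  exact mul_le_mul ((pow_le_pow_of_le_one hr0.le hr1.le (by omega)).trans hrj) hδi hδ0.le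
    ((h.mass.pow _).1 _)

theorem pow_isLittleO_diagCoeff {r : ℝ} (hr0 : 0 ≤ r) (hr1 : r < 1) :
    (fun m => r ^ (coeffPeriod q * m)) =o[atTop] diagCoeff q := by
  obtain ⟨s, hrs, hs1⟩ := exists_between hr1
  have hs0 : 0 < s := hr0.trans_lt hrs
  obtain ⟨δ, hδ0, L, hδ⟩ := h.exists_mul_pow_le_coeff_pow hs0 hs1
  refine ((isLittleO_pow_pow_of_lt_left hr0 hrs).comp_tendsto
    h.tendsto_coeffPeriod_mul).trans_isBigO (IsBigO.of_bound δ⁻¹ ?_)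
  filter_upwards [h.tendsto_coeffPeriod_mul.eventually_ge_atTop L] with m hm
  rw [Function.comp_apply, Real.norm_of_nonneg (pow_nonneg hs0.le _), ← div_eq_inv_mul,
    le_div_iff₀' hδ0]
  exact (hδ _ hm (dvd_mul_right _ _)).trans (le_abs_self _)

theorem isDiagEquivalent_step {k e i : ℕ} (hk : coeff k q ≠ 0) (hei : IsDiagEquivalent q e i) :
    IsDiagEquivalent q (e + k) (i + 1) := by
  refine isEquivalent_of_abs_sub_le hei fun ε hε => ?_
  have hk0 : 0 < coeff k q := (h.mass.1 k).lt_of_ne' hk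
  set η := min 1 (ε * coeff k q)
  have hη0 : 0 < η := lt_min one_pos (mul_pos hε hk0)
  set E := Real.exp (-(η ^ 2 / 4))
  have hE0 : 0 < E := Real.exp_pos _
  have hE1 : E < 1 := Real.exp_lt_one_iff.2 (neg_lt_zero.2 (by positivity))
  filter_upwards [(h.pow_isLittleO_diagCoeff hE0.le hE1).bound
    (show 0 < ε * coeff k q / 2 by positivity)] with m hm
  set n := coeffPeriod q * m
  rw [Real.norm_of_nonneg (pow_nonneg hE0.le _), Real.norm_eq_abs] at hm
  have key := abs_coeff_pow_sub_le h.mass h.genFun_one k hη0.le (min_le_left _ _) (n + 1 + i)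
    (n + e)
  rw [add_assoc n e k, add_assoc (n + 1) i 1, ← mul_sub, abs_mul, abs_of_pos hk0] at key
  refine le_of_mul_le_mul_left ?_ hk0
  linarith [pow_le_pow_of_le_one hE0.le hE1.le (show n ≤ n + 1 + (i + 1) by omega),
    mul_le_mul_of_nonneg_right (min_le_right 1 (ε * coeff k q))
      ((h.mass.pow (n + 1 + (i + 1))).1 (n + (e + k)))]

theorem isDiagEquivalent_add_exponent {e i : ℕ} (hei : IsDiagEquivalent q e i) (n : ℕ) :
    IsDiagEquivalent q e (i + n) := by
  induction n with
  | zero => rwa [add_zero]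
  | succ n ih =>
    rw [← add_assoc, ← add_zero e]
    exact h.isDiagEquivalent_step h.zero_pos.ne' ih

theorem isDiagEquivalent_add {l : ℕ} (hl : l ∈ AddSubmonoid.closure (coeffSupport q)) :
    ∀ {e i : ℕ}, IsDiagEquivalent q e i → ∀ n, l ≤ n → IsDiagEquivalent q (e + l) (i + n) := by
  induction hl using AddSubmonoid.closure_induction with
  | zero =>
    intro e i hei n _
    rw [add_zero]
    exact h.isDiagEquivalent_add_exponent hei n
  | mem k hk =>
    intro e i hei n hn
    rcases n with _ | n
    · obtain rfl : k = 0 := by omega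
      rwa [add_zero, add_zero]
    · rw [← add_assoc]
      exact h.isDiagEquivalent_step hk (h.isDiagEquivalent_add_exponent hei n)
  | add x y _ _ hx hy =>
    intro e i hei n hn
    have hxy := hy (hx hei x le_rfl) (n - x) (by omega)
    rwa [add_assoc e, add_assoc i, Nat.add_sub_cancel' (by omega : x ≤ n)] at hxy

theorem isEquivalent_diagCoeff_succ : (fun m => diagCoeff q (m + 1)) ~[atTop] diagCoeff q := by
  obtain ⟨L, hL⟩ := exists_forall_mem_closure_coeffSupport q
  have hshift : ∀ K, L ≤ K → (fun m => diagCoeff q (m + K)) ~[atTop] diagCoeff q := by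
    intro K hK
    have hmem := hL (coeffPeriod q * K) (hK.trans (Nat.le_mul_of_pos_left K h.coeffPeriod_pos))
      (dvd_mul_right _ _)
    have hK := h.isDiagEquivalent_add hmem (e := 0) (i := 0) IsEquivalent.refl _ le_rfl
    simpa only [IsDiagEquivalent, diagCoeff, mul_add, zero_add, add_right_comm] using hK
  refine ((hshift L le_rfl).comp_tendsto (tendsto_add_atTop_nat 1)).symm.trans ?_
  refine (hshift (L + 1) L.le_succ).congr_left (.of_forall fun m => ?_)
  simp only [Function.comp_apply, add_assoc, add_comm L 1]

theorem mul_coeff_eq_diagCoeff (m : ℕ) :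
    ((coeffPeriod q * m + 1 : ℕ) : ℝ) * coeff (coeffPeriod q * m + 1) B = diagCoeff q m :=
  succ_mul_coeff_succ h.eq_subst _

theorem eventually_coeff_pos : ∀ᶠ m in atTop, 0 < coeff (coeffPeriod q * m + 1) B := by
  filter_upwards [h.eventually_diagCoeff_pos] with m hm
  rw [← h.mul_coeff_eq_diagCoeff] at hm
  exact pos_of_mul_pos_right hm (Nat.cast_nonneg _)

theorem isEquivalent_coeff_succ : (fun m => coeff (coeffPeriod q * (m + 1) + 1) B) ~[atTop]
    fun m => coeff (coeffPeriod q * m + 1) B := by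
  have heq : (fun m => coeff (coeffPeriod q * m + 1) B) =
      diagCoeff q / fun m => ((coeffPeriod q * m + 1 : ℕ) : ℝ) := by
    ext m
    rw [Pi.div_apply, ← h.mul_coeff_eq_diagCoeff, mul_div_cancel_left₀ _ (by positivity)]
  have hlin : (fun m => ((coeffPeriod q * (m + 1) + 1 : ℕ) : ℝ)) ~[atTop]
      fun m => ((coeffPeriod q * m + 1 : ℕ) : ℝ) := by
    have hdiff : ((fun m => ((coeffPeriod q * (m + 1) + 1 : ℕ) : ℝ)) -
        fun m => ((coeffPeriod q * m + 1 : ℕ) : ℝ)) = fun _ => (coeffPeriod q : ℝ) := by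
      ext m
      simp only [Pi.sub_apply]
      push_cast
      ring
    rw [IsEquivalent, hdiff]
    exact (isLittleO_const_left.2 <| .inr <| tendsto_norm_atTop_atTop.comp <|
      tendsto_natCast_atTop_atTop.comp <|
        (tendsto_add_atTop_nat 1).comp h.tendsto_coeffPeriod_mul)
  have hsucc := congrArg (· ∘ (· + 1)) heq
  simp only [Function.comp_def] at hsucc
  rw [hsucc, heq]
  exact h.isEquivalent_diagCoeff_succ.div hlin

theorem coeffPeriod_dvd_of_coeff_succ_ne_zero {l : ℕ} (hl : coeff (l + 1) B ≠ 0) :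
    coeffPeriod q ∣ l :=
  coeffPeriod_dvd_of_coeff_pow_ne_zero (l + 1) <| succ_mul_coeff_succ h.eq_subst l ▸
    mul_ne_zero (Nat.cast_ne_zero.2 l.succ_ne_zero) hl

/-- Among `d` consecutive coefficients of `B` the only one which may be non-zero has order
`d * ⌈n / d⌉ + 1`. -/
theorem windowSum_succ_eq (n : ℕ) : windowSum (coeffPeriod q) B (n + 1) =
    coeff (coeffPeriod q * ((n + (coeffPeriod q - 1)) / coeffPeriod q) + 1) B := by
  have hd0 := h.coeffPeriod_pos
  have hdvd := fun l => h.coeffPeriod_dvd_of_coeff_succ_ne_zero (l := l)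
  generalize coeffPeriod q = d at hd0 hdvd ⊢
  have hdiv := Nat.div_add_mod (n + (d - 1)) d
  have hmod := Nat.mod_lt (n + (d - 1)) hd0
  generalize (n + (d - 1)) / d = m at hdiv ⊢
  rw [windowSum, Finset.sum_eq_single (d * m - n)]
  · rw [show n + 1 + (d * m - n) = d * m + 1 by omega]
  · intro j hj hne
    rw [add_right_comm]
    refine of_not_not fun hcoeff => hne ?_
    obtain ⟨c, hc⟩ := hdvd _ hcoeff
    have hj := Finset.mem_range.1 hj
    have hlt₁ : d * m < d * (c + 1) := by rw [Nat.mul_succ]; omega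
    have hlt₂ : d * c < d * (m + 1) := by rw [Nat.mul_succ]; omega
    have hcm : m = c :=
      le_antisymm (Nat.lt_succ_iff.1 (lt_of_mul_lt_mul_left hlt₁ d.zero_le))
        (Nat.lt_succ_iff.1 (lt_of_mul_lt_mul_left hlt₂ d.zero_le))
    rw [hcm, ← hc, Nat.add_sub_cancel_left]
  · exact fun hj => absurd (Finset.mem_range.2 (by omega)) hj

theorem tendsto_add_coeffPeriod_div :
    Tendsto (fun n => (n + (coeffPeriod q - 1)) / coeffPeriod q) atTop atTop :=
  (Nat.tendsto_div_const_atTop h.coeffPeriod_pos.ne').comp (tendsto_add_atTop_nat _)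

theorem eventually_windowSum_pos : ∀ᶠ n in atTop, 0 < windowSum (coeffPeriod q) B n := by
  rw [← map_add_atTop_eq_nat 1, eventually_map]
  filter_upwards [h.tendsto_add_coeffPeriod_div.eventually h.eventually_coeff_pos] with n hn
  rwa [h.windowSum_succ_eq]

theorem isEquivalent_windowSum_succ : (fun n => windowSum (coeffPeriod q) B (n + 1)) ~[atTop]
    windowSum (coeffPeriod q) B := by
  rw [← map_add_atTop_eq_nat 1, IsEquivalent, isLittleO_map]
  have hcomp := isEquivalent_comp_of_eq_or_eq_succ
    (b := fun m => coeff (coeffPeriod q * m + 1) B) h.isEquivalent_coeff_succ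
    h.tendsto_add_coeffPeriod_div fun n => ?_
  · simpa only [IsEquivalent, Function.comp_def, Pi.sub_def, h.windowSum_succ_eq] using hcomp
  · have hd0 := h.coeffPeriod_pos
    generalize coeffPeriod q = d at hd0 ⊢
    have hge : (n + (d - 1)) / d ≤ (n + 1 + (d - 1)) / d := Nat.div_le_div_right (by omega)
    have hle : (n + 1 + (d - 1)) / d ≤ (n + (d - 1) + d) / d := Nat.div_le_div_right (by omega)
    rw [Nat.add_div_right _ hd0] at hle
    omega

end IsCriticalPair

end RatioLimit

section TailWeight

open PowerSeries Asymptotics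

/-- The windows of `f` of length `d` are asymptotically at least `z` times the total mass of `f`
times `β`. Constants below `z * genFun f 1` replace a lower limit of quotients by `β`, so that `β`
may vanish. -/
def HasTailWeight (β : ℕ → ℝ) (d : ℕ) (f : PowerSeries ℝ) (z : ℝ) : Prop :=
  ∀ c < z * genFun f 1, ∀ᶠ n in atTop, c * β n ≤ windowSum d f n

variable {β : ℕ → ℝ} {d : ℕ} {f g : PowerSeries ℝ} {y z : ℝ}

theorem eventually_mul_le_comp_sub (hβ0 : ∀ n, 0 ≤ β n)
    (hβ : (fun n => β (n + 1)) ~[atTop] β) {w : ℕ → ℝ}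
    (hw : ∀ c < z, ∀ᶠ n in atTop, c * β n ≤ w n) (b : ℕ) :
    ∀ c < z, ∀ᶠ n in atTop, c * β n ≤ w (n - b) := by
  induction b with
  | zero => exact hw
  | succ b ih =>
    intro c hcz
    obtain ⟨c', hcc', hc'z⟩ := exists_between hcz
    have hshift : ∀ᶠ n in atTop, |c| * |β (n + 1) - β n| ≤ (c' - c) * β n := by
      have ho : (fun n => c * (β (n + 1) - β n)) =o[atTop] β := hβ.const_mul_left c
      filter_upwards [ho.bound (sub_pos.2 hcc')] with n hn
      rwa [norm_mul, Real.norm_eq_abs, Real.norm_eq_abs, Real.norm_of_nonneg (hβ0 n)] at hn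
    rw [← map_add_atTop_eq_nat 1, eventually_map]
    filter_upwards [hshift, ih c' hc'z] with n hn hwn
    rw [Nat.add_sub_add_right]
    rw [← abs_mul] at hn
    linarith [le_abs_self (c * (β (n + 1) - β n))]

namespace IsMass

theorem le_coeff_mul (hf : IsMass f) (hg : IsMass g) {M N : ℕ} (h : 2 * M ≤ N) :
    ∑ b ∈ Finset.range M, coeff b g * coeff (N - b) f +
      ∑ a ∈ Finset.range M, coeff a f * coeff (N - a) g ≤ coeff N (f * g) := by
  rw [coeff_mul, Finset.Nat.sum_antidiagonal_eq_sum_range_succ (fun i j => coeff i f * coeff j g)]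
  have hinj : Set.InjOn (fun b => N - b) (Finset.range M : Set ℕ) := by
    intro x hx y hy hxy
    simp only [Finset.coe_range, Set.mem_Iio] at hx hy hxy
    omega
  have hdisj : Disjoint ((Finset.range M).image fun b => N - b) (Finset.range M) := by
    simp only [Finset.disjoint_left, Finset.mem_image, Finset.mem_range]
    omega
  have hsub : (Finset.range M).image (fun b => N - b) ∪ Finset.range M ⊆
      Finset.range (N + 1) := by
    intro x
    simp only [Finset.mem_union, Finset.mem_image, Finset.mem_range]
    omega
  refine le_trans (le_of_eq ?_) (Finset.sum_le_sum_of_subset_of_nonneg hsub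
    fun i _ _ => mul_nonneg (hf.1 _) (hg.1 _))
  rw [Finset.sum_union hdisj, Finset.sum_image hinj]
  congr 1
  refine Finset.sum_congr rfl fun b hb => ?_
  have := Finset.mem_range.1 hb
  rw [Nat.sub_sub_self (by omega), mul_comm]

theorem le_windowSum_mul (hf : IsMass f) (hg : IsMass g) (d : ℕ) {M n : ℕ} (h : 2 * M ≤ n) :
    ∑ b ∈ Finset.range M, coeff b g * windowSum d f (n - b) +
      ∑ a ∈ Finset.range M, coeff a f * windowSum d g (n - a) ≤ windowSum d (f * g) n := by
  have hcomm : ∀ u v : PowerSeries ℝ, ∑ b ∈ Finset.range M, coeff b u * windowSum d v (n - b) =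
      ∑ j ∈ Finset.range d, ∑ b ∈ Finset.range M, coeff b u * coeff (n + j - b) v := by
    intro u v
    simp only [windowSum, Finset.mul_sum]
    rw [Finset.sum_comm]
    refine Finset.sum_congr rfl fun j _ => Finset.sum_congr rfl fun b hb => ?_
    have := Finset.mem_range.1 hb
    rw [show n - b + j = n + j - b by omega]
  rw [hcomm, hcomm, ← Finset.sum_add_distrib, windowSum]
  exact Finset.sum_le_sum fun j _ => hf.le_coeff_mul hg (by omega)

theorem tendsto_sum_range_coeff (hf : IsMass f) :
    Tendsto (fun M => ∑ a ∈ Finset.range M, coeff a f) atTop (𝓝 (genFun f 1)) :=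
  genFun_one_right f ▸ hf.2.hasSum.tendsto_sum_nat

end IsMass

namespace HasTailWeight

theorem zero (hβ0 : ∀ n, 0 ≤ β n) (hf : IsMass f) : HasTailWeight β d f 0 := by
  intro c hc
  rw [zero_mul] at hc
  exact .of_forall fun n =>
    (mul_nonpos_of_nonpos_of_nonneg hc.le (hβ0 n)).trans (hf.windowSum_nonneg d n)

/-- A large index of a product is reached by one large index and one bounded index. -/
theorem mul (hβ0 : ∀ n, 0 ≤ β n) (hβ : (fun n => β (n + 1)) ~[atTop] β) (hf : IsMass f)
    (hg : IsMass g) (hfy : HasTailWeight β d f y) (hgz : HasTailWeight β d g z) :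
    HasTailWeight β d (f * g) (y + z) := by
  intro c hc
  rw [hf.genFun_mul hg zero_le_one le_rfl] at hc
  obtain ⟨M, hM⟩ : ∃ M, c < (∑ b ∈ Finset.range M, coeff b g) * (y * genFun f 1) +
      (∑ a ∈ Finset.range M, coeff a f) * (z * genFun g 1) :=
    (((hg.tendsto_sum_range_coeff.mul_const _).add
      (hf.tendsto_sum_range_coeff.mul_const _)).eventually_const_lt (hc.trans_eq (by ring))).exists
  obtain ⟨η, hη, hη0⟩ : ∃ η : ℝ,
      c < (∑ b ∈ Finset.range M, coeff b g) * (y * genFun f 1 - η) +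
        (∑ a ∈ Finset.range M, coeff a f) * (z * genFun g 1 - η) ∧ 0 < η :=
    (((Continuous.tendsto' (by fun_prop) 0 _ rfl).eventually_const_lt
      (by simpa only [sub_zero] using hM)).filter_mono nhdsWithin_le_nhds |>.and
      (self_mem_nhdsWithin : ∀ᶠ η : ℝ in 𝓝[>] 0, 0 < η)).exists
  have hfs : ∀ᶠ n in atTop, ∀ b ∈ Finset.range M,
      (y * genFun f 1 - η) * β n ≤ windowSum d f (n - b) :=
    (Finset.eventually_all _).2 fun b _ =>
      eventually_mul_le_comp_sub hβ0 hβ hfy b _ (sub_lt_self _ hη0)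
  have hgs : ∀ᶠ n in atTop, ∀ a ∈ Finset.range M,
      (z * genFun g 1 - η) * β n ≤ windowSum d g (n - a) :=
    (Finset.eventually_all _).2 fun a _ =>
      eventually_mul_le_comp_sub hβ0 hβ hgz a _ (sub_lt_self _ hη0)
  filter_upwards [hfs, hgs, eventually_ge_atTop (2 * M)] with n hfn hgn hn
  refine (mul_le_mul_of_nonneg_right hη.le (hβ0 n)).trans
    (le_trans ?_ (hf.le_windowSum_mul hg d hn))
  rw [add_mul, mul_assoc, mul_assoc, Finset.sum_mul, Finset.sum_mul]
  exact add_le_add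
    (Finset.sum_le_sum fun b hb => mul_le_mul_of_nonneg_left (hfn b hb) (hg.1 b))
    (Finset.sum_le_sum fun a ha => mul_le_mul_of_nonneg_left (hgn a ha) (hf.1 a))

theorem mul_left (hβ0 : ∀ n, 0 ≤ β n) (hβ : (fun n => β (n + 1)) ~[atTop] β) (hf : IsMass f)
    (hg : IsMass g) (hgz : HasTailWeight β d g z) : HasTailWeight β d (f * g) z := by
  simpa only [zero_add] using mul hβ0 hβ hf hg (zero hβ0 hf) hgz

theorem prod (hβ0 : ∀ n, 0 ≤ β n) (hβ : (fun n => β (n + 1)) ~[atTop] β) {ι : Type*}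
    (t : Finset ι) {f : ι → PowerSeries ℝ} (hf : ∀ i, IsMass (f i)) {z : ι → ℝ}
    (h : ∀ i, HasTailWeight β d (f i) (z i)) :
    HasTailWeight β d (∏ i ∈ t, f i) (∑ i ∈ t, z i) := by
  classical
  induction t using Finset.induction_on with
  | empty => simpa only [Finset.prod_empty, Finset.sum_empty] using zero hβ0 isMass_one
  | insert i t hi ih =>
    rw [Finset.prod_insert hi, Finset.sum_insert hi]
    exact mul hβ0 hβ (hf i) (IsMass.prod t hf) (h i) ih

end HasTailWeight

end TailWeight

namespace PlaneTree

theorem mem_nodes_iff_of_restrict_eq {s t : PlaneTree} {h : ℕ} (e : s.restrict h = t.restrict h)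
    {u : Node} (hu : u.length ≤ h) : u ∈ s.nodes ↔ u ∈ t.nodes := by
  simpa only [restrict, Set.mem_ofPred_eq, hu, and_true] using Set.ext_iff.1 e u

theorem exists_fin_succPNat_eq {n : ℕ} {j : ℕ+} (hj : (j : ℕ) ≤ n) :
    ∃ i : Fin n, i.val.succPNat = j :=
  ⟨⟨j.natPred, by have := j.natPred_add_one; omega⟩, PNat.succPNat_natPred j⟩

theorem succPNat_le {n : ℕ} (i : Fin n) : (i.val.succPNat : ℕ) ≤ n := i.2

theorem append_singleton_mem_iff (t : PlaneTree) (u : Node) (i : ℕ+) :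
    u ++ [i] ∈ t.nodes ↔ (i : ℕ) ≤ t.outDegree u := by
  by_cases hu : u ∈ t.nodes
  · obtain ⟨k, hk⟩ := t.exists_degree u hu
    have hset : {i : ℕ+ | u ++ [i] ∈ t.nodes} =
        (Finset.univ : Finset (Fin k)).image fun i => i.val.succPNat := by
      ext i
      simp only [Set.mem_ofPred_eq, hk, Finset.coe_image, Finset.coe_univ, Set.image_univ,
        Set.mem_range]
      exact ⟨exists_fin_succPNat_eq, by rintro ⟨j, rfl⟩; exact succPNat_le j⟩
    have hinj : Function.Injective fun i : Fin k => i.val.succPNat :=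
      Nat.succPNat_injective.comp Fin.val_injective
    rw [hk, outDegree, hset, Set.ncard_coe_finset, Finset.card_image_of_injective _ hinj,
      Finset.card_univ, Fintype.card_fin]
  · have hchild : ∀ j : ℕ+, u ++ [j] ∉ t.nodes := fun j hj => hu (t.ancestor_mem u [j] hj)
    have hdeg : t.outDegree u = 0 := by
      simp only [outDegree, hchild, Set.ofPred_false, Set.ncard_empty]
    simp only [hchild, hdeg, false_iff]
    exact i.pos.not_ge

theorem singleton_mem_iff (t : PlaneTree) (i : ℕ+) : [i] ∈ t.nodes ↔ (i : ℕ) ≤ t.outDegree [] :=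
  t.append_singleton_mem_iff [] i

theorem mem_childSubtree_iff (t : PlaneTree) (i : ℕ+) (u : Node) :
    u ∈ (t.childSubtree i).nodes ↔
      ([i] ∈ t.nodes ∧ i :: u ∈ t.nodes) ∨ ([i] ∉ t.nodes ∧ u ∈ t.nodes) := by
  unfold childSubtree
  split_ifs with h <;> simp [h, subtreeAt]

theorem cons_mem_iff (t : PlaneTree) (i : ℕ+) (u : Node) :
    i :: u ∈ t.nodes ↔ (i : ℕ) ≤ t.outDegree [] ∧ u ∈ (t.childSubtree i).nodes := by
  rw [mem_childSubtree_iff, ← singleton_mem_iff]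
  have hroot : i :: u ∈ t.nodes → [i] ∈ t.nodes := t.ancestor_mem [i] u
  tauto

theorem cons_mem_iff_exists_fin (t : PlaneTree) (j : ℕ+) (u : Node) :
    j :: u ∈ t.nodes ↔ ∃ i : Fin (t.outDegree []),
      i.val.succPNat = j ∧ u ∈ (t.childSubtree i.val.succPNat).nodes := by
  rw [cons_mem_iff]
  constructor
  · rintro ⟨hj, hu⟩
    obtain ⟨i, rfl⟩ := exists_fin_succPNat_eq hj
    exact ⟨i, rfl, hu⟩
  · rintro ⟨i, rfl, hu⟩
    exact ⟨succPNat_le i, hu⟩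

theorem outDegree_childSubtree (t : PlaneTree) (i : ℕ+) (hi : (i : ℕ) ≤ t.outDegree []) (u : Node) :
    (t.childSubtree i).outDegree u = t.outDegree (i :: u) := by
  unfold outDegree
  congr 1
  ext j
  simp only [Set.mem_ofPred_eq, List.cons_append, t.cons_mem_iff i, hi, true_and]

theorem restrict_zero (t : PlaneTree) : t.restrict 0 = {[]} := by
  ext u
  simp only [restrict, Nat.le_zero, List.length_eq_zero_iff, Set.mem_ofPred_eq,
    Set.mem_singleton_iff]
  exact ⟨fun h => h.2, fun h => ⟨h ▸ t.root_mem, h⟩⟩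

theorem restrict_succ_subset (h : ℕ) (t : PlaneTree) : t.restrict (h + 1) ⊆
    t.restrict h ∪ ⋃ u ∈ t.restrict h,
      Set.range fun i : Fin (t.outDegree u) => u ++ [i.val.succPNat] := by
  rintro v ⟨hv, hl⟩
  rcases List.eq_nil_or_concat' v with rfl | ⟨u, j, rfl⟩
  · exact .inl ⟨hv, Nat.zero_le h⟩
  · rw [List.length_append, List.length_singleton, add_le_add_iff_right] at hl
    obtain ⟨i, rfl⟩ := exists_fin_succPNat_eq ((t.append_singleton_mem_iff u j).1 hv)
    exact .inr (Set.mem_biUnion (x := u) ⟨t.ancestor_mem _ _ hv, hl⟩ ⟨i, rfl⟩)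

theorem finite_restrict (h : ℕ) (t : PlaneTree) : (t.restrict h).Finite := by
  induction h with
  | zero => exact t.restrict_zero ▸ Set.finite_singleton _
  | succ h ih =>
    exact (ih.union (ih.biUnion fun u _ => Set.finite_range _)).subset (t.restrict_succ_subset h)

theorem outDegree_root_eq_of_restrict_eq {s t : PlaneTree} (e : s.restrict 1 = t.restrict 1) :
    s.outDegree [] = t.outDegree [] := by
  unfold outDegree
  congr 1
  ext i
  exact mem_nodes_iff_of_restrict_eq e le_rfl

theorem restrict_succ_eq_iff (h : ℕ) (s t : PlaneTree) :
    s.restrict (h + 1) = t.restrict (h + 1) ↔ s.outDegree [] = t.outDegree [] ∧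
      ∀ i : Fin (t.outDegree []), (s.childSubtree i.val.succPNat).restrict h =
        (t.childSubtree i.val.succPNat).restrict h := by
  constructor
  · intro e
    have hroot := outDegree_root_eq_of_restrict_eq (restrict_mono (by omega) e)
    refine ⟨hroot, fun i => Set.ext fun u => ?_⟩
    simp only [restrict, Set.mem_ofPred_eq, and_congr_left_iff]
    intro hu
    simpa only [cons_mem_iff, succPNat_le i, hroot, true_and] using
      mem_nodes_iff_of_restrict_eq e (u := i.val.succPNat :: u) (Nat.succ_le_succ hu)
  · rintro ⟨hroot, hi⟩
    ext u
    rcases u with _ | ⟨j, u⟩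
    · simp only [restrict, Set.mem_ofPred_eq, root_mem]
    · simp only [restrict, Set.mem_ofPred_eq, cons_mem_iff, hroot, List.length_cons,
        add_le_add_iff_right, and_congr_left_iff, and_congr_right_iff]
      intro hu hj
      obtain ⟨i, rfl⟩ := exists_fin_succPNat_eq hj
      exact mem_nodes_iff_of_restrict_eq (hi i) hu

section NumDegreeIn

variable (A : Set ℕ) (t : PlaneTree)

theorem size_eq_numDegreeIn_univ : t.size = t.numDegreeIn Set.univ := by
  simp only [size, numDegreeIn, Set.mem_univ, and_true, Set.ofPred_mem_eq]

theorem nodes_degreeIn_eq_union : {u ∈ t.nodes | t.outDegree u ∈ A} =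
    {u | u = [] ∧ t.outDegree [] ∈ A} ∪ ⋃ i : Fin (t.outDegree []), List.cons i.val.succPNat ''
      {u ∈ (t.childSubtree i.val.succPNat).nodes |
        (t.childSubtree i.val.succPNat).outDegree u ∈ A} := by
  ext u
  rcases u with _ | ⟨j, u⟩
  · simp [t.root_mem]
  · simp only [Set.mem_ofPred_eq, cons_mem_iff_exists_fin, Set.mem_union, reduceCtorEq, false_and,
      false_or, Set.mem_iUnion, Set.mem_image, List.cons.injEq]
    constructor
    · rintro ⟨⟨i, rfl, hu⟩, hA⟩
      exact ⟨i, u, ⟨hu, by rwa [outDegree_childSubtree t _ (succPNat_le i)]⟩, rfl, rfl⟩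
    · rintro ⟨i, v, ⟨hv, hA⟩, rfl, rfl⟩
      rw [outDegree_childSubtree t _ (succPNat_le i)] at hA
      exact ⟨⟨i, rfl, hv⟩, hA⟩

theorem pairwise_disjoint_image_cons {n : ℕ} (s : Fin n → Set Node) :
    Pairwise (Function.onFun Disjoint fun i => List.cons i.val.succPNat '' s i) := by
  refine fun i j hij => Set.disjoint_left.2 ?_
  rintro _ ⟨u, _, rfl⟩ ⟨v, _, hv⟩
  simp only [List.cons.injEq, Nat.succPNat_inj] at hv
  exact hij (Fin.ext hv.1.symm)

open Classical in
theorem numDegreeIn_eq_add_sum {n : ℕ} (hn : t.outDegree [] = n) :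
    t.numDegreeIn A = ((if n ∈ A then 1 else 0 : ℕ) : ℕ∞) +
      ∑ i : Fin n, (t.childSubtree i.val.succPNat).numDegreeIn A := by
  subst hn
  rw [numDegreeIn, nodes_degreeIn_eq_union, Set.encard_union_eq, Set.encard_iUnion_of_finite
    (pairwise_disjoint_image_cons _), finsum_eq_sum_of_fintype]
  · congr 1
    · split_ifs with h <;> simp [h]
    · exact Finset.sum_congr rfl fun i _ => List.cons_injective.encard_image _
  · refine Set.disjoint_left.2 ?_
    rintro _ ⟨rfl, _⟩ hv
    simp at hv

end NumDegreeIn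

/-- The trees with `n` children at the root whose `i`-th subtree above the root lies in `S i`. The
children are numbered from `1`, hence the `succPNat`. -/
def rootCylinder (n : ℕ) (S : Fin n → Set PlaneTree) : Set PlaneTree :=
  {t | t.outDegree [] = n ∧ ∀ i : Fin n, t.childSubtree i.val.succPNat ∈ S i}

/-- `r_h(t)` as a finite set, so that the truncation map takes only countably many values. -/
noncomputable def truncation (h : ℕ) (t : PlaneTree) : Finset Node := (finite_restrict h t).toFinset

/-- The vertices at height `h`. -/
noncomputable def level (h : ℕ) (t : PlaneTree) : Finset Node := {u ∈ truncation h t | u.length = h}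

/-- The vertices at height less than `h`. -/
noncomputable def below (h : ℕ) (t : PlaneTree) : Finset Node := {u ∈ truncation h t | u.length < h}

/-- The trees that coincide with `t` up to height `h`. -/
def localBall (h : ℕ) (t : PlaneTree) : Set PlaneTree := {s | s.restrict h = t.restrict h}

section Level

variable {h : ℕ} {t : PlaneTree} {u : Node}

theorem mem_truncation : u ∈ truncation h t ↔ u ∈ t.nodes ∧ u.length ≤ h :=
  (finite_restrict h t).mem_toFinset

theorem truncation_eq_iff {s : PlaneTree} : truncation h s = truncation h t ↔ s ∈ localBall h t :=
  Set.Finite.toFinset_inj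

theorem preimage_truncation_singleton :
    truncation h ⁻¹' {truncation h t} = localBall h t :=
  Set.ext fun _ => truncation_eq_iff

theorem mem_level : u ∈ level h t ↔ u ∈ t.nodes ∧ u.length = h := by
  simp only [level, Finset.mem_filter, mem_truncation]
  exact ⟨fun h => ⟨h.1.1, h.2⟩, fun h => ⟨⟨h.1, h.2.le⟩, h.2⟩⟩

theorem mem_below : u ∈ below h t ↔ u ∈ t.nodes ∧ u.length < h := by
  simp only [below, Finset.mem_filter, mem_truncation]
  exact ⟨fun h => ⟨h.1.1, h.2⟩, fun h => ⟨⟨h.1, h.2.le⟩, h.2⟩⟩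

variable (h t)

theorem level_zero : level 0 t = {[]} := by
  ext u
  simp only [mem_level, List.length_eq_zero_iff, Finset.mem_singleton]
  exact ⟨fun h => h.2, fun h => ⟨h ▸ t.root_mem, h⟩⟩

theorem below_zero : below 0 t = ∅ := by
  simp only [Finset.eq_empty_iff_forall_notMem, mem_below, Nat.not_lt_zero, and_false,
    not_false_eq_true, implies_true]

theorem level_succ : level (h + 1) t =
    Finset.univ.biUnion fun i : Fin (t.outDegree []) =>
      (level h (t.childSubtree i.val.succPNat)).image (List.cons i.val.succPNat) := by
  ext u
  rcases u with _ | ⟨j, u⟩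
  · simp [mem_level]
  · simp only [mem_level, cons_mem_iff_exists_fin, List.length_cons, add_left_inj,
      Finset.mem_biUnion, Finset.mem_univ, true_and, Finset.mem_image, List.cons.injEq]
    constructor
    · rintro ⟨⟨i, rfl, hu⟩, hl⟩
      exact ⟨i, u, ⟨hu, hl⟩, rfl, rfl⟩
    · rintro ⟨i, v, ⟨hv, hl⟩, rfl, rfl⟩
      exact ⟨⟨i, rfl, hv⟩, hl⟩

theorem below_succ : below (h + 1) t =
    insert [] (Finset.univ.biUnion fun i : Fin (t.outDegree []) =>
      (below h (t.childSubtree i.val.succPNat)).image (List.cons i.val.succPNat)) := by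
  ext u
  rcases u with _ | ⟨j, u⟩
  · simp [mem_below, root_mem]
  · simp only [mem_below, cons_mem_iff_exists_fin, List.length_cons, add_lt_add_iff_right,
      Finset.mem_insert, reduceCtorEq, false_or,
      Finset.mem_biUnion, Finset.mem_univ, true_and, Finset.mem_image, List.cons.injEq]
    constructor
    · rintro ⟨⟨i, rfl, hu⟩, hl⟩
      exact ⟨i, u, ⟨hu, hl⟩, rfl, rfl⟩
    · rintro ⟨i, v, ⟨hv, hl⟩, rfl, rfl⟩
      exact ⟨⟨i, rfl, hv⟩, hl⟩

theorem pairwiseDisjoint_finset_image_cons {n : ℕ} (s : Fin n → Finset Node) :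
    Set.PairwiseDisjoint (Finset.univ : Finset (Fin n)) fun i =>
      (s i).image (List.cons i.val.succPNat) := fun i _ j _ hij => by
  have hdisj := pairwise_disjoint_image_cons (fun i => (s i : Set Node)) hij
  simp only [Function.onFun, ← Finset.coe_image, Finset.disjoint_coe] at hdisj ⊢
  exact hdisj

theorem card_level_succ : (level (h + 1) t).card =
    ∑ i : Fin (t.outDegree []), (level h (t.childSubtree i.val.succPNat)).card := by
  rw [level_succ, Finset.card_biUnion (pairwiseDisjoint_finset_image_cons _)]
  exact Finset.sum_congr rfl fun i _ => Finset.card_image_of_injective _ List.cons_injective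

theorem prod_below_succ {M : Type*} [CommMonoid M] (w : ℕ → M) :
    ∏ u ∈ below (h + 1) t, w (t.outDegree u) = w (t.outDegree []) *
      ∏ i : Fin (t.outDegree []), ∏ u ∈ below h (t.childSubtree i.val.succPNat),
        w ((t.childSubtree i.val.succPNat).outDegree u) := by
  rw [below_succ, Finset.prod_insert (by simp),
    Finset.prod_biUnion (pairwiseDisjoint_finset_image_cons _)]
  congr 1
  refine Finset.prod_congr rfl fun i _ => ?_
  rw [Finset.prod_image fun _ _ _ _ h => List.cons_injective h]
  exact Finset.prod_congr rfl fun u _ => by rw [outDegree_childSubtree _ _ (succPNat_le i)]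

theorem mem_localBall_self : t ∈ localBall h t := rfl

theorem localBall_anti {g h : ℕ} (hgh : g ≤ h) : localBall h t ⊆ localBall g t :=
  fun _ => restrict_mono hgh

theorem localBall_zero : localBall 0 t = Set.univ := by
  simp only [localBall, restrict_zero, Set.ofPred_true]

theorem localBall_succ : localBall (h + 1) t = rootCylinder (t.outDegree []) fun i =>
    localBall h (t.childSubtree i.val.succPNat) :=
  Set.ext fun s => restrict_succ_eq_iff h s t

end Level

section Measurability

theorem isOpen_localBall (h : ℕ) (t : PlaneTree) : IsOpen (localBall h t) := by
  refine Metric.isOpen_iff.2 fun s hs => ⟨(1 / 2) ^ h, by positivity, fun r hr => ?_⟩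
  exact ((localDist_le_iff r s h).1 (le_of_lt hr)).trans hs

theorem measurableSet_localBall (h : ℕ) (t : PlaneTree) : MeasurableSet (localBall h t) :=
  (isOpen_localBall h t).measurableSet

theorem exists_localBall_subset {U : Set PlaneTree} (hU : IsOpen U) {t : PlaneTree} (ht : t ∈ U) :
    ∃ h, localBall h t ⊆ U := by
  obtain ⟨ε, hε, hb⟩ := Metric.isOpen_iff.1 hU t ht
  obtain ⟨h, hh⟩ := exists_pow_lt_of_lt_one hε (by norm_num : (1 / 2 : ℝ) < 1)
  exact ⟨h, fun s hs => hb (((localDist_le_iff s t h).2 hs).trans_lt hh)⟩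

theorem measurableSet_mem_nodes (u : Node) : MeasurableSet {t : PlaneTree | u ∈ t.nodes} :=
  IsOpen.measurableSet (isOpen_iff_forall_mem_open.2 fun t ht =>
    ⟨_, fun _ hs => (mem_nodes_iff_of_restrict_eq hs le_rfl).2 ht, isOpen_localBall u.length t,
      mem_localBall_self _ t⟩)

theorem eq_iUnion_preimage_truncation {U : Set PlaneTree} (hU : IsOpen U) :
    U = ⋃ h : ℕ, truncation h ⁻¹' {F | ∀ t, truncation h t = F → t ∈ U} := by
  ext t
  simp only [Set.mem_iUnion, Set.mem_preimage, Set.mem_ofPred_eq]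
  refine ⟨fun ht => ?_, fun ⟨h, hh⟩ => hh t rfl⟩
  obtain ⟨h, hh⟩ := exists_localBall_subset hU ht
  exact ⟨h, fun s hs => hh (truncation_eq_iff.1 hs)⟩

theorem measurableSet_truncation_mem {α : Type*} [MeasurableSpace α] {f : α → PlaneTree}
    (hf : ∀ u, MeasurableSet {a | u ∈ (f a).nodes}) (h : ℕ) (V : Set (Finset Node)) :
    MeasurableSet {a | truncation h (f a) ∈ V} := by
  have hfiber : ∀ F : Finset Node, MeasurableSet {a | truncation h (f a) = F} := fun F => by
    simp only [Finset.ext_iff, mem_truncation, Set.ofPred_forall]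
    exact .iInter fun u => ((hf u).inter (.const _)).iff (.const _)
  change MeasurableSet ((fun a => truncation h (f a)) ⁻¹' V)
  rw [← Set.biUnion_preimage_singleton]
  exact .biUnion V.to_countable fun F _ => hfiber F

theorem measurable_of_nodes {α : Type*} [MeasurableSpace α] {f : α → PlaneTree}
    (hf : ∀ u, MeasurableSet {a | u ∈ (f a).nodes}) : Measurable f := by
  refine measurable_of_isOpen fun U hU => ?_
  rw [eq_iUnion_preimage_truncation hU, Set.preimage_iUnion]
  exact .iUnion fun h => measurableSet_truncation_mem hf h _

theorem measurable_childSubtree (i : ℕ+) : Measurable (childSubtree i) := by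
  refine measurable_of_nodes fun u => ?_
  simp only [mem_childSubtree_iff]
  exact ((measurableSet_mem_nodes _).inter (measurableSet_mem_nodes _)).union
    ((measurableSet_mem_nodes _).compl.inter (measurableSet_mem_nodes _))

theorem measurable_outDegree (u : Node) : Measurable fun t : PlaneTree => t.outDegree u := by
  refine measurable_of_Ici fun n => ?_
  rcases n with _ | n
  · simp
  · convert measurableSet_mem_nodes (u ++ [Nat.succPNat n]) using 1
    ext t
    simp [append_singleton_mem_iff]

theorem measurableSet_rootCylinder (n : ℕ) {S : Fin n → Set PlaneTree}
    (hS : ∀ i, MeasurableSet (S i)) : MeasurableSet (rootCylinder n S) := by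
  simp only [rootCylinder, Set.ofPred_and, Set.ofPred_forall]
  exact (measurable_outDegree [] (measurableSet_singleton n)).inter
    (.iInter fun i => measurable_childSubtree _ (hS i))

variable (A : Set ℕ)

theorem setOf_le_numDegreeIn_eq_iUnion (m : ℕ) : {t : PlaneTree | (m : ℕ∞) ≤ t.numDegreeIn A} =
    ⋃ (F : Finset Node) (_ : F.card = m), ⋂ u ∈ F, {t | u ∈ t.nodes ∧ t.outDegree u ∈ A} := by
  ext t
  simp only [Set.mem_ofPred_eq, Set.mem_iUnion, Set.mem_iInter, numDegreeIn]
  constructor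
  · intro h
    obtain ⟨F, hF, hc⟩ := Set.exists_subset_encard_eq h
    have hfin : F.Finite := Set.finite_of_encard_eq_coe hc
    rw [hfin.encard_eq_coe_toFinset_card] at hc
    exact ⟨hfin.toFinset, by exact_mod_cast hc, fun u hu => hF (hfin.mem_toFinset.1 hu)⟩
  · rintro ⟨F, rfl, hF⟩
    rw [← Set.encard_coe_eq_coe_finsetCard]
    exact Set.encard_le_encard fun u hu => hF u hu

theorem measurableSet_le_numDegreeIn (m : ℕ) :
    MeasurableSet {t : PlaneTree | (m : ℕ∞) ≤ t.numDegreeIn A} := by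
  rw [setOf_le_numDegreeIn_eq_iUnion]
  exact .iUnion fun F => .iUnion fun _ => Finset.measurableSet_biInter _ fun u _ =>
    (measurableSet_mem_nodes u).inter (measurable_outDegree u (MeasurableSet.of_discrete (s := A)))

theorem measurable_numDegreeIn : Measurable fun t : PlaneTree => t.numDegreeIn A := by
  refine measurable_to_countable' fun m => ?_
  induction m using ENat.recTopCoe with
  | coe m =>
    convert (measurableSet_le_numDegreeIn A m).diff (measurableSet_le_numDegreeIn A (m + 1)) using 1
    ext t
    simp only [Set.mem_preimage, Set.mem_singleton_iff, Set.mem_sdiff, Set.mem_ofPred_eq, not_le]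
    push_cast
    rw [ENat.lt_add_one_iff (by simp), le_antisymm_iff, and_comm]
  | top =>
    convert MeasurableSet.iInter (measurableSet_le_numDegreeIn A) using 1
    ext t
    simp [ENat.eq_top_iff_forall_ge]

end Measurability

end PlaneTree

section Portmanteau

namespace PlaneTree

theorem measure_preimage_truncation_le_liminf {μ : Measure PlaneTree} {μs : ℕ → Measure PlaneTree}
    {h : ℕ} (hball : ∀ t, μ (localBall h t) ≤ liminf (fun n => μs n (localBall h t)) atTop)
    (V : Set (Finset Node)) :
    μ (truncation h ⁻¹' V) ≤ liminf (fun n => μs n (truncation h ⁻¹' V)) atTop := by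
  let _ : MeasurableSpace V := ⊤
  have hfiber : ∀ F : Finset Node,
      μ (truncation h ⁻¹' {F}) ≤ liminf (fun n => μs n (truncation h ⁻¹' {F})) atTop := by
    intro F
    rcases (truncation h ⁻¹' {F}).eq_empty_or_nonempty with hF | ⟨t, rfl⟩
    · rw [hF, measure_empty]
      exact bot_le
    · rw [preimage_truncation_singleton]
      exact hball t
  have hsum : ∀ ν : Measure PlaneTree,
      ν (truncation h ⁻¹' V) = ∫⁻ F : V, ν (truncation h ⁻¹' {F.1}) ∂Measure.count := fun ν => by
    rw [lintegral_count, ← tsum_measure_preimage_singleton V.to_countable fun F _ =>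
      measurableSet_truncation_mem measurableSet_mem_nodes h {F}]
  calc μ (truncation h ⁻¹' V)
    _ ≤ ∫⁻ F : V, liminf (fun n => μs n (truncation h ⁻¹' {F.1})) atTop ∂Measure.count :=
      (hsum μ).trans_le (lintegral_mono fun F => hfiber F.1)
    _ ≤ liminf (fun n => ∫⁻ F : V, μs n (truncation h ⁻¹' {F.1}) ∂Measure.count) atTop :=
      lintegral_liminf_le fun n => measurable_from_top
    _ = liminf (fun n => μs n (truncation h ⁻¹' V)) atTop := by simp_rw [hsum (μs _)]

theorem monotone_preimage_truncation (U : Set PlaneTree) :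
    Monotone fun h : ℕ => truncation h ⁻¹' {F | ∀ t, truncation h t = F → t ∈ U} :=
  fun _ _ hgh _ ht s hs =>
    ht s (truncation_eq_iff.2 (localBall_anti _ hgh (truncation_eq_iff.1 hs)))

theorem tendsto_of_forall_localBall_le_liminf {μ : ProbabilityMeasure PlaneTree}
    {μs : ℕ → ProbabilityMeasure PlaneTree}
    (hball : ∀ h t, (μ : Measure PlaneTree) (localBall h t) ≤
      liminf (fun n => (μs n : Measure PlaneTree) (localBall h t)) atTop) :
    Tendsto μs atTop (𝓝 μ) := by
  refine tendsto_of_forall_isOpen_le_liminf_nat' fun U hU => ?_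
  rw [eq_iUnion_preimage_truncation hU, (monotone_preimage_truncation U).measure_iUnion]
  exact iSup_le fun h => (measure_preimage_truncation_le_liminf (hball h) _).trans <|
    liminf_le_liminf <| .of_forall fun n => measure_mono <| Set.subset_iUnion_of_subset h le_rfl

end PlaneTree

end Portmanteau

section TreeSeries

open PlaneTree

variable {Ω : Type*} [MeasurableSpace Ω] {P : Measure Ω} {τ : Ω → PlaneTree}

/-- The generating function of the law of `L_A(τ)` restricted to the event `τ ∈ S`. -/
noncomputable def treeSeries (A : Set ℕ) (τ : Ω → PlaneTree) (P : Measure Ω) (S : Set PlaneTree) :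
    PowerSeries ℝ :=
  PowerSeries.mk fun m => P.real {ω | τ ω ∈ S ∧ (τ ω).numDegreeIn A = m}

theorem coeff_treeSeries (A : Set ℕ) (τ : Ω → PlaneTree) (P : Measure Ω) (S : Set PlaneTree)
    (m : ℕ) : (treeSeries A τ P S).coeff m =
      P.real {ω | τ ω ∈ S ∧ (τ ω).numDegreeIn A = m} := PowerSeries.coeff_mk _ _

variable (A : Set ℕ) {S : Set PlaneTree}

theorem measurableSet_mem_numDegreeIn (hτ : Measurable τ) (hS : MeasurableSet S) (B : Set ℕ∞) :
    MeasurableSet {ω | τ ω ∈ S ∧ (τ ω).numDegreeIn A ∈ B} :=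
  (hτ hS).inter (hτ (measurable_numDegreeIn A (MeasurableSet.of_discrete (s := B))))

variable [IsFiniteMeasure P]

theorem hasSum_measureReal_mem_numDegreeIn (hτ : Measurable τ) (hS : MeasurableSet S)
    {ι : Type*} [Countable ι] {J : ι → Set ℕ∞} (hJ : Pairwise (Function.onFun Disjoint J)) :
    HasSum (fun i => P.real {ω | τ ω ∈ S ∧ (τ ω).numDegreeIn A ∈ J i})
      (P.real {ω | τ ω ∈ S ∧ (τ ω).numDegreeIn A ∈ ⋃ i, J i}) := by
  have hunion : {ω | τ ω ∈ S ∧ (τ ω).numDegreeIn A ∈ ⋃ i, J i} =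
      ⋃ i, {ω | τ ω ∈ S ∧ (τ ω).numDegreeIn A ∈ J i} := by
    ext ω
    simp only [Set.mem_ofPred_eq, Set.mem_iUnion, exists_and_left]
  have hdisj : Pairwise (Function.onFun Disjoint
      fun i => {ω | τ ω ∈ S ∧ (τ ω).numDegreeIn A ∈ J i}) := fun i j hij =>
    Set.disjoint_left.2 fun ω hi hj => Set.disjoint_left.1 (hJ hij) hi.2 hj.2
  have hmeasure := measure_iUnion (μ := P) hdisj fun i =>
    measurableSet_mem_numDegreeIn A hτ hS (J i)
  rw [hunion, measureReal_def, hmeasure, ENNReal.tsum_toReal_eq fun _ => measure_ne_top _ _]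
  exact ENNReal.hasSum_toReal (hmeasure ▸ measure_ne_top _ _)

theorem hasSum_coeff_treeSeries (hτ : Measurable τ) (hS : MeasurableSet S) :
    HasSum (fun m => (treeSeries A τ P S).coeff m)
      (P.real {ω | τ ω ∈ S ∧ (τ ω).numDegreeIn A ≠ ⊤}) := by
  have hdisj : Pairwise (Function.onFun Disjoint fun m : ℕ => ({(m : ℕ∞)} : Set ℕ∞)) :=
    fun i j hij => by simpa using hij
  convert hasSum_measureReal_mem_numDegreeIn (P := P) A hτ hS hdisj using 2
  · exact coeff_treeSeries A τ P S _
  · simp only [Set.mem_iUnion, Set.mem_singleton_iff, ENat.ne_top_iff_exists, eq_comm]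

theorem isMass_treeSeries (hτ : Measurable τ) (hS : MeasurableSet S) :
    IsMass (treeSeries A τ P S) :=
  ⟨fun m => coeff_treeSeries A τ P S m ▸ measureReal_nonneg,
    (hasSum_coeff_treeSeries A hτ hS).summable⟩

theorem genFun_treeSeries_one (hτ : Measurable τ) (hS : MeasurableSet S) :
    genFun (treeSeries A τ P S) 1 = P.real {ω | τ ω ∈ S ∧ (τ ω).numDegreeIn A ≠ ⊤} :=
  (genFun_one_right _).trans (hasSum_coeff_treeSeries A hτ hS).tsum_eq

end TreeSeries

section Branching

open PlaneTree PowerSeries Asymptotics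

variable {p : PMF ℕ} {Ω : Type*} [MeasurableSpace Ω] {P : Measure Ω} [IsProbabilityMeasure P]
  {τ : Ω → PlaneTree}

theorem IsGWTree.measure_preimage_rootCylinder (hτ : IsGWTree p τ P) (n : ℕ)
    {S : Fin n → Set PlaneTree} (hS : ∀ i, MeasurableSet (S i)) :
    P (τ ⁻¹' rootCylinder n S) = p n * ∏ i, P (τ ⁻¹' S i) := by
  have hE : MeasurableSet {ω | (τ ω).outDegree [] = n} :=
    hτ.measurable (measurable_outDegree [] (measurableSet_singleton n))
  rcases Nat.eq_zero_or_pos n with rfl | hn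
  · simp [rootCylinder, hτ.root_law]
  by_cases h0 : P {ω | (τ ω).outDegree [] = n} = 0
  · rw [← hτ.root_law n, h0, zero_mul]
    exact measure_mono_null (fun ω hω => hω.1) h0
  obtain ⟨hindep, hident⟩ := hτ.branching n hn h0
  have hprod := hindep.measure_inter_preimage_eq_mul (S := .univ) (sets := S) fun i _ => hS i
  simp only [fun i => (hident i).measure_preimage_eq (hS i)] at hprod
  rw [← hprod, ← hτ.root_law n, cond_apply hE, ← mul_assoc,
    ENNReal.mul_inv_cancel h0 (measure_ne_top _ _), one_mul]
  congr 1
  ext ω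
  simp [rootCylinder]

theorem IsGWTree.measure_preimage_localBall (hτ : IsGWTree p τ P) (h : ℕ) (t : PlaneTree) :
    P (τ ⁻¹' localBall h t) = ∏ u ∈ below h t, p (t.outDegree u) := by
  induction h generalizing t with
  | zero => simp [localBall_zero, below_zero]
  | succ h ih =>
    rw [prod_below_succ h t p, localBall_succ]
    simp only [← ih]
    exact hτ.measure_preimage_rootCylinder _ fun i => measurableSet_localBall _ _

theorem sum_eq_coe_iff_exists_finsuppAntidiag {ι : Type*} [Fintype ι] [DecidableEq ι] {f : ι → ℕ∞}
    {m : ℕ} : ∑ i, f i = m ↔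
      ∃ l ∈ Finset.finsuppAntidiag (Finset.univ : Finset ι) m, ∀ i, f i = l i := by
  constructor
  · intro hm
    have hfinite : ∀ i, f i ≠ ⊤ := fun i =>
      ne_top_of_le_ne_top (hm ▸ ENat.natCast_ne_top m)
        (Finset.single_le_sum (fun _ _ => zero_le) (Finset.mem_univ i))
    choose l hl using fun i => ENat.ne_top_iff_exists.1 (hfinite i)
    refine ⟨Finsupp.equivFunOnFinite.symm l, ?_, fun i => (hl i).symm⟩
    simp only [← hl] at hm
    simpa using (by exact_mod_cast hm : ∑ i, l i = m)
  · rintro ⟨l, hl, hfl⟩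
    rw [Finset.sum_congr rfl fun i _ => hfl i, ← (Finset.mem_finsuppAntidiag.1 hl).1]
    push_cast
    rfl

open Classical in
theorem rootCylinder_numDegreeIn_eq_biUnion (A : Set ℕ) (n m : ℕ) (S : Fin n → Set PlaneTree) :
    {t | t ∈ rootCylinder n S ∧
        t.numDegreeIn A = ((m + if n ∈ A then 1 else 0 : ℕ) : ℕ∞)} =
      ⋃ l ∈ Finset.finsuppAntidiag (Finset.univ : Finset (Fin n)) m,
        rootCylinder n fun i => {t | t ∈ S i ∧ t.numDegreeIn A = l i} := by
  ext t
  simp only [rootCylinder, Set.mem_ofPred_eq, Set.mem_iUnion, exists_prop, forall_and]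
  have hsum (hn : t.outDegree [] = n) :
      t.numDegreeIn A = ((m + if n ∈ A then 1 else 0 : ℕ) : ℕ∞) ↔
        ∑ i : Fin n, (t.childSubtree i.val.succPNat).numDegreeIn A = m := by
    rw [numDegreeIn_eq_add_sum A t hn, add_comm, Nat.cast_add]
    exact (ENat.add_left_injective_of_ne_top (ENat.natCast_ne_top _)).eq_iff
  constructor
  · rintro ⟨⟨hn, hS⟩, hm⟩
    obtain ⟨l, hl, hfl⟩ := sum_eq_coe_iff_exists_finsuppAntidiag.1 ((hsum hn).1 hm)
    exact ⟨l, hl, hn, hS, hfl⟩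
  · rintro ⟨l, hl, hn, hS, hfl⟩
    exact ⟨⟨hn, hS⟩, (hsum hn).2 (sum_eq_coe_iff_exists_finsuppAntidiag.2 ⟨l, hl, hfl⟩)⟩

variable (A : Set ℕ)

open Classical in
theorem IsGWTree.coeff_treeSeries_rootCylinder (hτ : IsGWTree p τ P) (n m : ℕ)
    {S : Fin n → Set PlaneTree} (hS : ∀ i, MeasurableSet (S i)) :
    (treeSeries A τ P (rootCylinder n S)).coeff (m + if n ∈ A then 1 else 0) =
      (p n).toReal * (∏ i, treeSeries A τ P (S i)).coeff m := by
  have hmeas (l : Fin n →₀ ℕ) (i : Fin n) : MeasurableSet {t | t ∈ S i ∧ t.numDegreeIn A = l i} :=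
    measurableSet_mem_numDegreeIn A measurable_id (hS i) {(l i : ℕ∞)}
  have hunion : {ω | τ ω ∈ rootCylinder n S ∧
        (τ ω).numDegreeIn A = ((m + if n ∈ A then 1 else 0 : ℕ) : ℕ∞)} =
      ⋃ l ∈ Finset.finsuppAntidiag (Finset.univ : Finset (Fin n)) m,
        τ ⁻¹' rootCylinder n fun i => {t | t ∈ S i ∧ t.numDegreeIn A = l i} := by
    have := congrArg (τ ⁻¹' ·) (rootCylinder_numDegreeIn_eq_biUnion A n m S)
    simp only [Set.preimage_iUnion] at this
    exact this
  rw [coeff_treeSeries, hunion, measureReal_biUnion_finset, coeff_prod, Finset.mul_sum]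
  · refine Finset.sum_congr rfl fun l _ => ?_
    rw [measureReal_def, hτ.measure_preimage_rootCylinder n (hmeas l), ENNReal.toReal_mul,
      ENNReal.toReal_prod]
    simp only [coeff_treeSeries]
    rfl
  · intro l _ l' _ hne
    refine Set.disjoint_left.2 fun ω h h' => hne (Finsupp.ext fun i => ?_)
    exact_mod_cast (h.2 i).2.symm.trans (h'.2 i).2
  · exact fun l _ => hτ.measurable (measurableSet_rootCylinder n (hmeas l))

open Classical in
theorem IsGWTree.treeSeries_rootCylinder (hτ : IsGWTree p τ P) (n : ℕ)
    {S : Fin n → Set PlaneTree} (hS : ∀ i, MeasurableSet (S i)) :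
    treeSeries A τ P (rootCylinder n S) =
      C (p n).toReal * (X ^ (if n ∈ A then 1 else 0) * ∏ i, treeSeries A τ P (S i)) := by
  ext m
  rw [coeff_C_mul, coeff_X_pow_mul']
  by_cases hm : (if n ∈ A then 1 else 0) ≤ m
  · rw [if_pos hm, ← hτ.coeff_treeSeries_rootCylinder A n _ hS, Nat.sub_add_cancel hm]
  · rw [if_neg hm, coeff_treeSeries, mul_zero, measureReal_eq_zero_iff]
    refine measure_mono_null (fun ω hω => hm ?_) measure_empty
    have hle := self_le_add_right ((if n ∈ A then 1 else 0 : ℕ) : ℕ∞)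
      (∑ i : Fin n, ((τ ω).childSubtree i.val.succPNat).numDegreeIn A)
    rw [← numDegreeIn_eq_add_sum A _ hω.1.1, hω.2] at hle
    exact_mod_cast hle

/-- A tree in `localBall h t` is made of the same vertices below height `h` and of independent
copies of `τ` grafted on the vertices at height `h`; each of these may be the one carrying most of
the vertices with out-degree in `A`. -/
theorem IsGWTree.hasTailWeight_treeSeries_localBall (hτ : IsGWTree p τ P) {β : ℕ → ℝ} {d : ℕ}
    (hβ0 : ∀ n, 0 ≤ β n) (hβ : (fun n => β (n + 1)) ~[atTop] β)
    (huniv : HasTailWeight β d (treeSeries A τ P Set.univ) 1) (h : ℕ) (t : PlaneTree) :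
    HasTailWeight β d (treeSeries A τ P (localBall h t)) (level h t).card := by
  classical
  induction h generalizing t with
  | zero => simpa [localBall_zero, level_zero] using huniv
  | succ h ih =>
    have hmass (i : Fin (t.outDegree [])) :
        IsMass (treeSeries A τ P (localBall h (t.childSubtree i.val.succPNat))) :=
      isMass_treeSeries A hτ.measurable (measurableSet_localBall _ _)
    have hC : IsMass (C (p (t.outDegree [])).toReal) := by
      simpa using isMass_one.C_mul (ENNReal.toReal_nonneg (a := p (t.outDegree [])))
    rw [localBall_succ, hτ.treeSeries_rootCylinder A _ fun i => measurableSet_localBall _ _,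
      card_level_succ, Nat.cast_sum]
    exact .mul_left hβ0 hβ hC ((isMass_X_pow _).mul (.prod _ hmass)) <|
      .mul_left hβ0 hβ (isMass_X_pow _) (.prod _ hmass) (.prod hβ0 hβ _ hmass fun i => ih _)

end Branching

theorem eq_of_forall_pnat_le_iff {a b : ℕ} (h : ∀ i : ℕ+, (i : ℕ) ≤ a ↔ (i : ℕ) ≤ b) : a = b := by
  refine eq_of_forall_le_iff fun c => ?_
  rcases Nat.eq_zero_or_pos c with rfl | hc
  · simp
  · exact h ⟨c, hc⟩

namespace PlaneTree

theorem append_singleton_mem_ofDegrees_iff (k : Node → ℕ) (u : Node) (i : ℕ+) :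
    u ++ [i] ∈ (ofDegrees k).nodes ↔ u ∈ (ofDegrees k).nodes ∧ (i : ℕ) ≤ k u := by
  constructor
  · exact fun h => ⟨(ofDegrees k).ancestor_mem u [i] h, h u i List.prefix_rfl⟩
  · rintro ⟨h, hi⟩ v j hv
    rcases List.prefix_concat_iff.1 hv with e | e
    · obtain ⟨rfl, hj⟩ := List.append_inj' e rfl
      obtain rfl : j = i := by simpa using hj
      exact hi
    · exact h v j e

theorem outDegree_ofDegrees {k : Node → ℕ} {u : Node} (hu : u ∈ (ofDegrees k).nodes) :
    (ofDegrees k).outDegree u = k u := by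
  refine eq_of_forall_pnat_le_iff fun i => ?_
  rw [← append_singleton_mem_iff, append_singleton_mem_ofDegrees_iff, and_iff_right hu]

theorem outDegree_ofDegrees_root (k : Node → ℕ) : (ofDegrees k).outDegree [] = k [] :=
  outDegree_ofDegrees (ofDegrees k).root_mem

theorem cons_mem_ofDegrees_iff (k : Node → ℕ) (i : ℕ+) (u : Node) :
    i :: u ∈ (ofDegrees k).nodes ↔
      (i : ℕ) ≤ k [] ∧ u ∈ (ofDegrees fun v => k (i :: v)).nodes := by
  constructor
  · exact fun h => ⟨h [] i (by simp), fun v j hv => h (i :: v) j (by simpa using hv)⟩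
  · rintro ⟨hi, h⟩ (_ | ⟨i', v⟩) j hv
    · obtain rfl : j = i := by simpa using hv
      exact hi
    · simp only [List.cons_append, List.cons_prefix_cons] at hv
      obtain ⟨rfl, hv⟩ := hv
      exact h v j hv

theorem childSubtree_ofDegrees {k : Node → ℕ} {i : ℕ+} (hi : (i : ℕ) ≤ k []) :
    (ofDegrees k).childSubtree i = ofDegrees fun u => k (i :: u) := by
  ext u
  have h := cons_mem_iff (ofDegrees k) i u
  rw [cons_mem_ofDegrees_iff, outDegree_ofDegrees_root] at h
  simpa only [hi, true_and] using h.symm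

theorem measurable_ofDegrees : Measurable ofDegrees := by
  refine measurable_of_nodes fun u => ?_
  have : {k | u ∈ (ofDegrees k).nodes} =
      ⋂ (v : Node) (i : ℕ+) (_ : v ++ [i] <+: u), {k | (i : ℕ) ≤ k v} := by
    ext k
    simp [ofDegrees]
  rw [this]
  exact .iInter fun v => .iInter fun i => .iInter fun _ => measurable_pi_apply v measurableSet_Ici

end PlaneTree

section Existence

open PlaneTree

section CylinderLaw

variable {p : PMF ℕ} {Ω : Type*} [MeasurableSpace Ω] {P : Measure Ω} {τ : Ω → PlaneTree}

theorem map_fun_eq_pi_of_forall_measure_iInter {ι E : Type*} [Fintype ι] [MeasurableSpace E]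
    {ν : ι → Measure E} [∀ i, SigmaFinite (ν i)] {X : ι → Ω → E} (hX : ∀ i, Measurable (X i))
    (h : ∀ S : ι → Set E, (∀ i, MeasurableSet (S i)) →
      P (⋂ i, X i ⁻¹' S i) = ∏ i, ν i (S i)) :
    P.map (fun ω i => X i ω) = Measure.pi ν := by
  refine (Measure.pi_eq fun S hS => ?_).symm
  rw [Measure.map_apply (measurable_pi_lambda _ hX) (.univ_pi hS), ← h S hS]
  congr 1
  ext ω
  simp

theorem cond_iInter_childSubtree_eq_prod [IsFiniteMeasure P] (hτ : Measurable τ) {n : ℕ}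
    (hroot : P {ω | (τ ω).outDegree [] = n} = p n) (hn : P {ω | (τ ω).outDegree [] = n} ≠ 0)
    {S : Fin n → Set PlaneTree}
    (hcyl : P (τ ⁻¹' rootCylinder n S) = p n * ∏ i, P (τ ⁻¹' S i)) :
    P[|{ω | (τ ω).outDegree [] = n}]
        (⋂ i, (fun ω => (τ ω).childSubtree i.val.succPNat) ⁻¹' S i) = ∏ i, P (τ ⁻¹' S i) := by
  have hE : MeasurableSet {ω | (τ ω).outDegree [] = n} :=
    hτ (measurable_outDegree [] (measurableSet_singleton n))
  have hinter : {ω | (τ ω).outDegree [] = n} ∩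
      ⋂ i, (fun ω => (τ ω).childSubtree i.val.succPNat) ⁻¹' S i = τ ⁻¹' rootCylinder n S := by
    ext ω
    simp [rootCylinder]
  rw [cond_apply hE, hinter, hcyl, ← hroot, ← mul_assoc,
    ENNReal.inv_mul_cancel hn (measure_ne_top _ _), one_mul]

theorem isGWTree_of_measure_preimage_rootCylinder [IsProbabilityMeasure P] (hτ : Measurable τ)
    (hcyl : ∀ (n : ℕ) (S : Fin n → Set PlaneTree), (∀ i, MeasurableSet (S i)) →
      P (τ ⁻¹' rootCylinder n S) = p n * ∏ i, P (τ ⁻¹' S i)) : IsGWTree p τ P := by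
  have hroot : ∀ n, P {ω | (τ ω).outDegree [] = n} = p n := fun n => by
    simpa [rootCylinder, Set.preimage] using hcyl n (fun _ => Set.univ) fun _ => .univ
  refine ⟨hτ, hroot, fun n _ hn => ?_⟩
  have hprob : IsProbabilityMeasure (P.map τ) := Measure.isProbabilityMeasure_map hτ.aemeasurable
  have hcond : IsProbabilityMeasure P[|{ω | (τ ω).outDegree [] = n}] :=
    cond_isProbabilityMeasure hn
  have hchild : ∀ i : Fin n, Measurable fun ω => (τ ω).childSubtree i.val.succPNat := fun i =>
    (measurable_childSubtree _).comp hτ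
  have hjoint := map_fun_eq_pi_of_forall_measure_iInter (ν := fun _ => P.map τ) hchild
    fun S hS => by
      simpa only [Measure.map_apply hτ (hS _)] using
        cond_iInter_childSubtree_eq_prod hτ (hroot n) hn (hcyl n S hS)
  have hlaw : ∀ i : Fin n, (P[|{ω | (τ ω).outDegree [] = n}]).map
      (fun ω => (τ ω).childSubtree i.val.succPNat) = P.map τ := fun i => by
    rw [← (measurePreserving_eval (fun _ => P.map τ) i).map_eq, ← hjoint,
      Measure.map_map (measurable_pi_apply i) (measurable_pi_lambda _ hchild)]
    rfl
  refine ⟨?_, fun i => ⟨(hchild i).aemeasurable, hτ.aemeasurable, hlaw i⟩⟩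
  rw [iIndepFun_iff_map_fun_eq_pi_map fun i => (hchild i).aemeasurable, hjoint]
  simp only [hlaw]

end CylinderLaw

theorem map_infinitePi_sigma_of_inj {ι α E : Type*} {κ : ι → Type*}
    [MeasurableSpace E] (ν : Measure E) [IsProbabilityMeasure ν] {f : (Σ i, κ i) → α}
    (hf : Function.Injective f) :
    (Measure.infinitePi fun _ : α => ν).map (fun k i j => k (f ⟨i, j⟩)) =
      Measure.infinitePi fun i => Measure.infinitePi fun _ : κ i => ν := by
  rw [← Measure.infinitePi_map_piCurry fun (i : ι) (_ : κ i) => ν,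
    ← Measure.map_infinitePi_infinitePi_of_inj (P := fun _ : α => ν) hf,
    Measure.map_map (by fun_prop) (by fun_prop)]
  rfl

/-- The decomposition of the nodes into the root, which is the single node of the block `none`, and
the descendants of its first `n` children. -/
def rootBlockNode (n : ℕ) : (Σ o : Option (Fin n), o.elim Unit fun _ => Node) → Node
  | ⟨none, _⟩ => []
  | ⟨some i, u⟩ => i.val.succPNat :: u

theorem rootBlockNode_injective (n : ℕ) : Function.Injective (rootBlockNode n) := by
  rintro ⟨_ | i, u⟩ ⟨_ | j, v⟩ h
  · rfl
  · cases h
  · cases h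
  · obtain ⟨hij, rfl⟩ := List.cons.inj h
    obtain rfl : i = j := Fin.ext (Nat.succPNat_injective hij)
    rfl

variable (q : PMF ℕ)

theorem infinitePi_setOf_root_eq_and_children_mem (n : ℕ) {S : Fin n → Set (Node → ℕ)}
    (hS : ∀ i, MeasurableSet (S i)) :
    (Measure.infinitePi fun _ : Node => q.toMeasure)
      {k | k [] = n ∧ ∀ i : Fin n, (fun u => k (i.val.succPNat :: u)) ∈ S i} =
      q n * ∏ i, (Measure.infinitePi fun _ : Node => q.toMeasure) (S i) := by
  let T : ∀ o : Option (Fin n), Set ((o.elim Unit fun _ => Node) → ℕ)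
    | none => Function.eval () ⁻¹' {n}
    | some i => S i
  have hT : ∀ o, MeasurableSet (T o)
    | none => measurable_pi_apply () (measurableSet_singleton n)
    | some i => hS i
  have hset : {k : Node → ℕ | k [] = n ∧ ∀ i : Fin n, (fun u => k (i.val.succPNat :: u)) ∈ S i} =
      (fun k o j => k (rootBlockNode n ⟨o, j⟩)) ⁻¹'
        Set.pi (Finset.univ : Finset (Option (Fin n))) T := by
    ext k
    simp only [Set.mem_preimage, Set.mem_pi, SetLike.mem_coe, Finset.mem_univ, true_imp_iff,
      Option.forall, T, rootBlockNode, Set.mem_ofPred_eq]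
    rfl
  rw [hset, ← Measure.map_apply (by fun_prop) (.pi (Finset.countable_toSet _) fun o _ => hT o),
    map_infinitePi_sigma_of_inj _ (rootBlockNode_injective n),
    Measure.infinitePi_pi _ fun o _ => hT o, Fintype.prod_option]
  congr 1
  exact ((measurePreserving_eval_infinitePi (fun _ : Unit => q.toMeasure) ()).measure_preimage
    (measurableSet_singleton n).nullMeasurableSet).trans
      (PMF.toMeasure_apply_singleton _ _ (measurableSet_singleton n))

theorem isGWTree_ofDegrees :
    IsGWTree q ofDegrees (Measure.infinitePi fun _ : Node => q.toMeasure) := by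
  refine isGWTree_of_measure_preimage_rootCylinder measurable_ofDegrees fun n S hS => ?_
  rw [← infinitePi_setOf_root_eq_and_children_mem q n fun i => measurable_ofDegrees (hS i)]
  congr 1
  ext k
  simp only [Set.mem_preimage, rootCylinder, Set.mem_ofPred_eq, outDegree_ofDegrees_root,
    and_congr_right_iff]
  intro hk
  refine forall_congr' fun i => ?_
  rw [childSubtree_ofDegrees (by rw [hk]; simp)]

end Existence

section Kesten

open PlaneTree

theorem isSpecial_append_iff (I : Node → ℕ) (u : Node) (i : ℕ+) :
    IsSpecial I (u ++ [i]) ↔ IsSpecial I u ∧ (i : ℕ) = I u := by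
  constructor
  · intro h
    generalize hv : u ++ [i] = v at h
    cases h with
    | root => simp at hv
    | child w j hw hj =>
      obtain ⟨rfl, e⟩ := List.append_inj' hv rfl
      obtain rfl : i = j := by simpa using e
      exact ⟨hw, hj⟩
  · exact fun h => .child u i h.1 h.2

theorem IsSpecial.of_append {I : Node → ℕ} {u w : Node} (h : IsSpecial I (u ++ w)) :
    IsSpecial I u := by
  induction w using List.reverseRecOn with
  | nil => simpa using h
  | append_singleton w i ih =>
    rw [← List.append_assoc, isSpecial_append_iff] at h
    exact ih h.1

theorem IsSpecial.prefix_of_length_le {I : Node → ℕ} {u v : Node} (hu : IsSpecial I u)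
    (hv : IsSpecial I v) (h : u.length ≤ v.length) : u <+: v := by
  induction u using List.reverseRecOn with
  | nil => exact List.nil_prefix
  | append_singleton u i ih =>
    rw [isSpecial_append_iff] at hu
    rw [List.length_append, List.length_singleton] at h
    obtain ⟨w, rfl⟩ := ih hu.1 (by omega)
    rcases w with _ | ⟨j, w⟩
    · simp at h
    · rw [List.append_cons] at hv
      have := ((isSpecial_append_iff I u j).1 hv.of_append).2
      rw [← hu.2] at this
      exact ⟨w, by rw [PNat.coe_inj.1 this, List.append_assoc, List.singleton_append]⟩

theorem measurableSet_isSpecial (u : Node) :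
    MeasurableSet {x : Node → ℕ × (ℕ × ℕ) | IsSpecial (fun v => (x v).2.2) u} := by
  induction u using List.reverseRecOn with
  | nil =>
    convert MeasurableSet.univ
    exact Set.eq_univ_of_forall fun x => IsSpecial.root
  | append_singleton u i ih =>
    simp only [isSpecial_append_iff, Set.ofPred_and]
    refine ih.inter ?_
    have : Measurable fun x : Node → ℕ × (ℕ × ℕ) => (x u).2.2 := by fun_prop
    convert this (measurableSet_singleton (i : ℕ)) using 1
    ext x
    exact eq_comm

theorem measurable_kestenTree : Measurable kestenTree := by
  refine measurable_ofDegrees.comp (measurable_pi_lambda _ fun u => ?_)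
  refine Measurable.ite (measurableSet_isSpecial u) ?_ ?_ <;> fun_prop

variable {p : PMF ℕ} (h0 : offspringMean p ≠ 0) (h1 : offspringMean p ≠ ∞)

theorem sizeBiased_apply (hm : offspringMean p = 1) (n : ℕ) :
    sizeBiased p h0 h1 n = n * p n := by
  change ∑' n : ℕ, (n : ℝ≥0∞) * p n = 1 at hm
  rw [sizeBiased, PMF.normalize_apply, hm, inv_one, mul_one]

theorem map_uniformOfFinset_mk_apply {n : ℕ} (hn : (Finset.Icc 1 n).Nonempty) (m i : ℕ) :
    (PMF.uniformOfFinset (Finset.Icc 1 n) hn).map (fun j => (n, j)) (m, i) =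
      if m = n ∧ 1 ≤ i ∧ i ≤ n then (n : ℝ≥0∞)⁻¹ else 0 := by
  rw [PMF.map_apply, tsum_eq_single i]
  · simp only [Prod.mk.injEq, and_true, PMF.uniformOfFinset_apply, Finset.mem_Icc, Nat.card_Icc,
      Nat.add_sub_cancel, ite_and]
  · exact fun j hj => if_neg fun h => hj (Prod.ext_iff.1 h).2.symm

theorem specialOffspring_apply (hm : offspringMean p = 1) (n i : ℕ) :
    specialOffspring p h0 h1 (n, i) = if 1 ≤ i ∧ i ≤ n then p n else 0 := by
  have hcancel : 1 ≤ n → n * p n * (n : ℝ≥0∞)⁻¹ = p n := fun hn => by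
    rw [mul_right_comm, ENNReal.mul_inv_cancel, one_mul]
    · exact_mod_cast (by omega : n ≠ 0)
    · exact ENNReal.natCast_ne_top n
  rw [specialOffspring, PMF.bind_apply, tsum_eq_single n]
  · rw [sizeBiased_apply h0 h1 hm]
    split_ifs with hn hi hi
    · rw [map_uniformOfFinset_mk_apply, if_pos ⟨rfl, hi⟩, hcancel hn]
    · rw [map_uniformOfFinset_mk_apply, if_neg fun h => hi h.2, mul_zero]
    · omega
    · obtain rfl : n = 0 := by omega
      simp
  · intro m hmn
    rw [sizeBiased_apply h0 h1 hm]
    split_ifs with hm1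
    · rw [map_uniformOfFinset_mk_apply, if_neg fun h => hmn h.1.symm, mul_zero]
    · obtain rfl : m = 0 := by omega
      simp

/-- The offspring of the vertex `u` of `t` when `u` belongs to the special path to `v`, respectively
when it does not. -/
def spineOffspring (t : PlaneTree) (v u : Node) : Set (ℕ × (ℕ × ℕ)) :=
  {y | (u <+: v → y.2 = (t.outDegree u, ((v.getD u.length 1 : ℕ+) : ℕ))) ∧
    (¬ u <+: v → y.1 = t.outDegree u)}

theorem measure_spineOffspring (hm : offspringMean p = 1) {t : PlaneTree} {h : ℕ} {u v : Node}
    (hv : v ∈ level h t) (hu : u ∈ below h t) :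
    (p.toMeasure.prod (specialOffspring p h0 h1).toMeasure) (spineOffspring t v u) =
      p (t.outDegree u) := by
  rw [mem_level] at hv
  rw [mem_below] at hu
  by_cases huv : u <+: v
  · obtain ⟨w, rfl⟩ := huv
    rcases w with _ | ⟨i, w⟩
    · simp only [List.append_nil] at hv
      omega
    have hi : (i : ℕ) ≤ t.outDegree u := by
      rw [← append_singleton_mem_iff]
      exact t.ancestor_mem (u ++ [i]) w (by simpa using hv.1)
    have : spineOffspring t (u ++ i :: w) u = Set.univ ×ˢ {(t.outDegree u, (i : ℕ))} := by
      ext y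
      simp [spineOffspring]
    rw [this, Measure.prod_prod, measure_univ, one_mul,
      PMF.toMeasure_apply_singleton _ _ (measurableSet_singleton _),
      specialOffspring_apply h0 h1 hm, if_pos ⟨i.pos, hi⟩]
  · have : spineOffspring t v u = {t.outDegree u} ×ˢ Set.univ := by
      ext y
      simp [spineOffspring, huv]
    rw [this, Measure.prod_prod, measure_univ, mul_one,
      PMF.toMeasure_apply_singleton _ _ (measurableSet_singleton _)]

theorem exists_isSpecial_mem_kestenTree {x : Node → ℕ × (ℕ × ℕ)}
    (hx : ∀ u, 1 ≤ (x u).2.2 ∧ (x u).2.2 ≤ (x u).2.1) (h : ℕ) :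
    ∃ v ∈ (kestenTree x).nodes, v.length = h ∧ IsSpecial (fun v => (x v).2.2) v := by
  induction h with
  | zero => exact ⟨[], (kestenTree x).root_mem, rfl, .root⟩
  | succ h ih =>
    obtain ⟨v, hv, hl, hs⟩ := ih
    obtain ⟨i, hi⟩ : ∃ i : ℕ+, (i : ℕ) = (x v).2.2 := ⟨⟨(x v).2.2, (hx v).1⟩, rfl⟩
    refine ⟨v ++ [i], ?_, by simp [hl], .child v _ hs hi⟩
    rw [kestenTree, append_singleton_mem_ofDegrees_iff, hi]
    refine ⟨hv, ?_⟩
    rw [if_pos hs]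
    exact (hx v).2

theorem exists_spineOffspring_of_mem_localBall {x : Node → ℕ × (ℕ × ℕ)}
    (hx : ∀ u, 1 ≤ (x u).2.2 ∧ (x u).2.2 ≤ (x u).2.1) {h : ℕ} {t : PlaneTree}
    (ht : kestenTree x ∈ localBall h t) :
    ∃ v ∈ level h t, ∀ u ∈ below h t, x u ∈ spineOffspring t v u := by
  obtain ⟨v, hv, hl, hs⟩ := exists_isSpecial_mem_kestenTree hx h
  refine ⟨v, mem_level.2 ⟨(mem_nodes_iff_of_restrict_eq ht hl.le).1 hv, hl⟩, fun u hu => ?_⟩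
  rw [mem_below] at hu
  have huk : u ∈ (kestenTree x).nodes := (mem_nodes_iff_of_restrict_eq ht hu.2.le).2 hu.1
  have hdeg : (kestenTree x).outDegree u = t.outDegree u := by
    refine eq_of_forall_pnat_le_iff fun i => ?_
    rw [← append_singleton_mem_iff, ← append_singleton_mem_iff]
    exact mem_nodes_iff_of_restrict_eq ht (by simpa using hu.2)
  rw [kestenTree, outDegree_ofDegrees huk] at hdeg
  constructor
  · rintro ⟨w, rfl⟩
    rw [if_pos hs.of_append] at hdeg
    rcases w with _ | ⟨i, w⟩
    · simp only [List.append_nil] at hl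
      omega
    rw [List.append_cons] at hs
    have := ((isSpecial_append_iff _ u i).1 hs.of_append).2
    ext
    · exact hdeg
    · simpa using this.symm
  · intro huv
    rwa [if_neg fun hsu => huv (hsu.prefix_of_length_le hs (by omega))] at hdeg

theorem prod_specialOffspring_setOf_not_rank_le (hm : offspringMean p = 1) :
    (p.toMeasure.prod (specialOffspring p h0 h1).toMeasure)
      {y | ¬ (1 ≤ y.2.2 ∧ y.2.2 ≤ y.2.1)} = 0 := by
  have hprod : {y : ℕ × (ℕ × ℕ) | ¬ (1 ≤ y.2.2 ∧ y.2.2 ≤ y.2.1)} =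
      Set.univ ×ˢ {z : ℕ × ℕ | ¬ (1 ≤ z.2 ∧ z.2 ≤ z.1)} := by
    ext y
    simp
  rw [hprod, Measure.prod_prod, measure_univ, one_mul,
    PMF.toMeasure_apply_eq_zero_iff _ .of_discrete]
  refine Set.disjoint_left.2 fun z hz hz' => ?_
  rw [PMF.mem_support_iff, ← Prod.mk.eta (p := z), specialOffspring_apply h0 h1 hm,
    if_neg hz'] at hz
  exact hz rfl

theorem preimage_kestenTree_localBall_subset (h : ℕ) (t : PlaneTree) :
    kestenTree ⁻¹' localBall h t ⊆
      (⋃ u : Node, Function.eval u ⁻¹' {y | ¬ (1 ≤ y.2.2 ∧ y.2.2 ≤ y.2.1)}) ∪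
      ⋃ v ∈ level h t, Set.pi (below h t : Set Node) (spineOffspring t v) := by
  intro x hx
  by_cases hgood : ∀ u, 1 ≤ (x u).2.2 ∧ (x u).2.2 ≤ (x u).2.1
  · obtain ⟨v, hv, hu⟩ := exists_spineOffspring_of_mem_localBall hgood hx
    exact Or.inr (Set.mem_biUnion hv hu)
  · obtain ⟨u, hu⟩ := not_forall.1 hgood
    exact Or.inl (Set.mem_iUnion.2 ⟨u, hu⟩)

/-- Union bound over the possible positions of the special individual of height `h`. -/
theorem kestenLaw_localBall_le (hm : offspringMean p = 1) (h : ℕ) (t : PlaneTree) :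
    kestenLaw p h0 h1 (localBall h t) ≤
      (level h t).card * ∏ u ∈ below h t, p (t.outDegree u) := by
  rw [kestenLaw, Measure.map_apply measurable_kestenTree (measurableSet_localBall h t)]
  refine (measure_mono (preimage_kestenTree_localBall_subset h t)).trans
    ((measure_union_le _ _).trans ?_)
  rw [measure_iUnion_null fun u => ?_, zero_add]
  · refine (measure_biUnion_finset_le _ _).trans ?_
    rw [← nsmul_eq_mul]
    refine Finset.sum_le_card_nsmul _ _ _ fun v hv => ?_
    rw [Measure.infinitePi_pi _ fun _ _ => .of_discrete]
    exact (Finset.prod_congr rfl fun u hu => measure_spineOffspring h0 h1 hm hv hu).le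
  · exact ((measurePreserving_eval_infinitePi _ u).measure_preimage
      MeasurableSet.of_discrete.nullMeasurableSet).trans
        (prod_specialOffspring_setOf_not_rank_le h0 h1 hm)

end Kesten

section FixedPoints

open PowerSeries

variable {f : PowerSeries ℝ} {μ s x y : ℝ}

theorem IsMass.abs_genFun_sub_le (hf : IsMass f) (hμ : HasMean f μ) (hx0 : 0 ≤ x) (hx1 : x ≤ 1)
    (hy0 : 0 ≤ y) (hy1 : y ≤ 1) : |genFun f x - genFun f y| ≤ μ * |x - y| := by
  unfold genFun
  rw [← (hf.summable_mul_pow hx0 hx1).tsum_sub (hf.summable_mul_pow hy0 hy1), ← Real.norm_eq_abs]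
  refine tsum_of_norm_bounded (HasSum.mul_right |x - y| hμ) fun n => ?_
  have hpow : |x ^ n - y ^ n| ≤ |x - y| * n := by
    refine (abs_pow_sub_pow_le x y n).trans (mul_le_of_le_one_right (by positivity) ?_)
    exact pow_le_one₀ (by positivity)
      (max_le (abs_le.2 ⟨by linarith, hx1⟩) (abs_le.2 ⟨by linarith, hy1⟩))
  calc ‖coeff n f * x ^ n - coeff n f * y ^ n‖
      = coeff n f * |x ^ n - y ^ n| := by
        rw [← mul_sub, norm_mul, Real.norm_of_nonneg (hf.1 n), Real.norm_eq_abs]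
    _ ≤ coeff n f * (|x - y| * n) := mul_le_mul_of_nonneg_left hpow (hf.1 n)
    _ = n * coeff n f * |x - y| := by ring

theorem IsMass.eq_of_eq_mul_genFun (hf : IsMass f) (hμ : HasMean f μ) (hs0 : 0 ≤ s)
    (hsμ : s * μ < 1) (hx0 : 0 ≤ x) (hx1 : x ≤ 1) (hy0 : 0 ≤ y) (hy1 : y ≤ 1)
    (hx : x = s * genFun f x) (hy : y = s * genFun f y) : x = y := by
  have hcontract : |x - y| ≤ s * μ * |x - y| := by
    conv_lhs => rw [hx, hy, ← mul_sub, abs_mul, abs_of_nonneg hs0]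
    rw [mul_assoc]
    exact mul_le_mul_of_nonneg_left (hf.abs_genFun_sub_le hμ hx0 hx1 hy0 hy1) hs0
  have hzero : |x - y| = 0 := by nlinarith [abs_nonneg (x - y)]
  exact sub_eq_zero.1 (abs_eq_zero.1 hzero)

theorem IsMass.genFun_one_sub_lt_genFun (hf : IsMass f) (hμ : HasMean f μ)
    (hk : ∃ k, 2 ≤ k ∧ coeff k f ≠ 0) (hx0 : 0 ≤ x) (hx1 : x < 1) :
    genFun f 1 - μ * (1 - x) < genFun f x := by
  obtain ⟨k, hk, hfk⟩ := hk
  have htangent : HasSum (fun n => coeff n f * (1 - n * (1 - x))) (genFun f 1 - μ * (1 - x)) := by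
    rw [genFun_one_right]
    exact (hf.2.hasSum.sub (HasSum.mul_right (1 - x) hμ)).congr_fun fun n => by ring
  have hbernoulli : ∀ n : ℕ, 1 - n * (1 - x) ≤ x ^ n := fun n => by
    linarith [one_add_mul_sub_le_pow (show -1 ≤ x by linarith) n]
  have hstrict : 1 - k * (1 - x) < x ^ k := by
    have h := one_add_mul_self_lt_rpow_one_add (show -1 ≤ x - 1 by linarith) (by linarith)
      (show (1 : ℝ) < k by exact_mod_cast hk)
    rw [Real.rpow_natCast, add_sub_cancel] at h
    linarith
  rw [← htangent.tsum_eq]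
  exact Summable.tsum_lt_tsum (i := k) (fun n => mul_le_mul_of_nonneg_left (hbernoulli n) (hf.1 n))
    (mul_lt_mul_of_pos_left hstrict ((hf.1 k).lt_of_ne' hfk)) htangent.summable
    (hf.summable_mul_pow hx0 hx1.le)

theorem IsMass.eq_one_of_eq_genFun (hf : IsMass f) (h1 : genFun f 1 = 1) (hμ : HasMean f μ)
    (hμ1 : μ ≤ 1) (hk : ∃ k, 2 ≤ k ∧ coeff k f ≠ 0) (hx0 : 0 ≤ x) (hx1 : x ≤ 1)
    (hx : x = genFun f x) : x = 1 := by
  by_contra hne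
  have hlt : x < 1 := lt_of_le_of_ne hx1 hne
  have := hf.genFun_one_sub_lt_genFun hμ hk hx0 hlt
  nlinarith

end FixedPoints

section Offspring

open PowerSeries

variable {p : PMF ℕ}

/-- The generating function of a probability distribution on `ℕ`. -/
noncomputable def pmfSeries (p : PMF ℕ) : PowerSeries ℝ := PowerSeries.mk fun n => (p n).toReal

theorem coeff_pmfSeries (p : PMF ℕ) (n : ℕ) : coeff n (pmfSeries p) = (p n).toReal :=
  PowerSeries.coeff_mk _ _

theorem hasSum_toReal_pmf (p : PMF ℕ) : HasSum (fun n => (p n).toReal) 1 := by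
  have h := ENNReal.hasSum_toReal (f := fun n => p n) (by rw [p.tsum_coe]; exact ENNReal.one_ne_top)
  rwa [← ENNReal.tsum_toReal_eq fun n => p.apply_ne_top n, p.tsum_coe, ENNReal.toReal_one] at h

theorem isMass_pmfSeries (p : PMF ℕ) : IsMass (pmfSeries p) :=
  ⟨fun n => coeff_pmfSeries p n ▸ ENNReal.toReal_nonneg, by
    simpa only [coeff_pmfSeries] using (hasSum_toReal_pmf p).summable⟩

theorem genFun_pmfSeries_one (p : PMF ℕ) : genFun (pmfSeries p) 1 = 1 := by
  simpa only [genFun_one_right, coeff_pmfSeries] using (hasSum_toReal_pmf p).tsum_eq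

theorem coeff_pmfSeries_ne_zero_iff {n : ℕ} : coeff n (pmfSeries p) ≠ 0 ↔ p n ≠ 0 := by
  rw [coeff_pmfSeries, Ne, ENNReal.toReal_eq_zero_iff, or_iff_left (p.apply_ne_top n)]

theorem offspringMean_eq_one_iff : offspringMean p = 1 ↔ HasMean (pmfSeries p) 1 := by
  have hterm : ∀ n : ℕ, (n : ℝ≥0∞) * p n = ENNReal.ofReal (n * coeff n (pmfSeries p)) := fun n => by
    rw [coeff_pmfSeries, ENNReal.ofReal_mul n.cast_nonneg, ENNReal.ofReal_natCast,
      ENNReal.ofReal_toReal (p.apply_ne_top n)]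
  have hnonneg : ∀ n : ℕ, 0 ≤ (n : ℝ) * coeff n (pmfSeries p) := fun n =>
    mul_nonneg n.cast_nonneg ((isMass_pmfSeries p).1 n)
  rw [offspringMean, tsum_congr hterm]
  constructor
  · intro h
    have hsum := ENNReal.hasSum_toReal (h ▸ ENNReal.one_ne_top)
    rw [← ENNReal.tsum_toReal_eq fun n => ENNReal.ofReal_ne_top, h, ENNReal.toReal_one] at hsum
    exact hsum.congr_fun fun n => (ENNReal.toReal_ofReal (hnonneg n)).symm
  · intro h
    rw [← ENNReal.ofReal_tsum_of_nonneg hnonneg h.summable, h.tsum_eq, ENNReal.ofReal_one]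

theorem IsNondegenerate.exists_two_le (hp : IsNondegenerate p) :
    ∃ k, 2 ≤ k ∧ coeff k (pmfSeries p) ≠ 0 := by
  simp only [coeff_pmfSeries_ne_zero_iff]
  by_contra! h
  have htotal := p.tsum_coe
  rw [tsum_eq_sum (s := {0, 1}) fun k hk => h k (by simp at hk; omega),
    Finset.sum_pair zero_ne_one] at htotal
  exact hp.2.2.ne htotal

theorem exists_pmfSeries_eq {f : PowerSeries ℝ} (hf : IsMass f) (h1 : genFun f 1 = 1) :
    ∃ q : PMF ℕ, pmfSeries q = f := by
  have htotal : ∑' n, ENNReal.ofReal (coeff n f) = 1 := by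
    rw [← ENNReal.ofReal_tsum_of_nonneg hf.1 hf.2, ← genFun_one_right, h1, ENNReal.ofReal_one]
  refine ⟨⟨fun n => ENNReal.ofReal (coeff n f), htotal ▸ ENNReal.summable.hasSum⟩, ?_⟩
  ext n
  exact (coeff_pmfSeries _ n).trans (ENNReal.toReal_ofReal (hf.1 n))

theorem isNondegenerate_of_offspringMean_eq_one (hm : offspringMean p = 1) (h0 : p 0 ≠ 0) :
    IsNondegenerate p := by
  obtain ⟨k, hk, hpk⟩ : ∃ k, 2 ≤ k ∧ p k ≠ 0 := by
    by_contra! h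
    have hsupport : ∀ k ∉ ({0, 1} : Finset ℕ), p k = 0 := fun k hk => h k (by simp at hk; omega)
    have htotal := p.tsum_coe
    rw [tsum_eq_sum hsupport, Finset.sum_pair zero_ne_one] at htotal
    rw [offspringMean, tsum_eq_sum fun k hk => by rw [hsupport k hk, mul_zero],
      Finset.sum_pair zero_ne_one, Nat.cast_zero, zero_mul, zero_add, Nat.cast_one, one_mul] at hm
    rw [hm] at htotal
    exact h0 (by simpa using htotal)
  have hle : p 0 + p 1 + p k ≤ 1 := by
    rw [← p.tsum_coe, ← Finset.sum_pair (f := p) zero_ne_one, add_comm,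
      ← Finset.sum_insert (by simp; omega)]
    exact ENNReal.sum_le_tsum _
  have hlt : p 0 + p 1 < 1 := (ENNReal.lt_add_right
    (ENNReal.add_ne_top.2 ⟨p.apply_ne_top 0, p.apply_ne_top 1⟩) hpk).trans_le hle
  exact ⟨pos_iff_ne_zero.2 h0, le_self_add.trans_lt hlt, hlt⟩

end Offspring

section RestrictSeries

open PowerSeries

variable {f : PowerSeries ℝ}

/-- The series obtained from `f` by keeping the coefficients whose index belongs to `A`. -/
noncomputable def restrictSeries (f : PowerSeries ℝ) (A : Set ℕ) : PowerSeries ℝ :=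
  PowerSeries.mk (A.indicator fun n => coeff n f)

theorem coeff_restrictSeries (f : PowerSeries ℝ) (A : Set ℕ) (n : ℕ) :
    coeff n (restrictSeries f A) = A.indicator (fun n => coeff n f) n :=
  coeff_mk _ _

theorem restrictSeries_add_compl (f : PowerSeries ℝ) (A : Set ℕ) :
    restrictSeries f A + restrictSeries f Aᶜ = f := by
  ext n
  simp only [map_add, coeff_restrictSeries, Set.indicator_self_add_compl_apply]

theorem restrictSeries_univ (f : PowerSeries ℝ) : restrictSeries f Set.univ = f := by
  ext n
  rw [coeff_restrictSeries, Set.indicator_univ]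

theorem restrictSeries_empty (f : PowerSeries ℝ) : restrictSeries f ∅ = 0 := by
  ext n
  rw [coeff_restrictSeries, Set.indicator_empty, map_zero]

theorem IsMass.restrictSeries (hf : IsMass f) (A : Set ℕ) : IsMass (restrictSeries f A) := by
  refine ⟨fun n => ?_, ?_⟩ <;> simp only [coeff_restrictSeries]
  · exact Set.indicator_nonneg (fun n _ => hf.1 n) n
  · exact hf.2.indicator A

theorem HasMean.exists_restrictSeries {μ : ℝ} (hμ : HasMean f μ) (A : Set ℕ) :
    ∃ ν, HasMean (restrictSeries f A) ν := by
  refine ⟨_, (hμ.summable.indicator A).hasSum.congr_fun fun n => ?_⟩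
  rw [coeff_restrictSeries, Set.indicator_mul_right A (fun n : ℕ => (n : ℝ))]

theorem exists_hasMean_restrictSeries {p : PMF ℕ} (hm : offspringMean p = 1) (A : Set ℕ) :
    ∃ μ ν, HasMean (restrictSeries (pmfSeries p) A) μ ∧
      HasMean (restrictSeries (pmfSeries p) Aᶜ) ν ∧ μ + ν = 1 := by
  have hmean := offspringMean_eq_one_iff.1 hm
  obtain ⟨μ, hμ⟩ := hmean.exists_restrictSeries A
  obtain ⟨ν, hν⟩ := hmean.exists_restrictSeries Aᶜ
  have hadd := hμ.add hν
  rw [restrictSeries_add_compl] at hadd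
  exact ⟨μ, ν, hμ, hν, hadd.unique hmean⟩

end RestrictSeries

section TreeSeriesUniv

open PowerSeries PlaneTree

variable {p : PMF ℕ} {Ω : Type*} [MeasurableSpace Ω] {P : Measure Ω} [IsProbabilityMeasure P]
  {τ : Ω → PlaneTree}

open Classical in
theorem IsGWTree.treeSeries_outDegree_root (hτ : IsGWTree p τ P) (A : Set ℕ) (n : ℕ) :
    treeSeries A τ P {t | t.outDegree [] = n} = C (coeff n (pmfSeries p)) *
      (X ^ (if n ∈ A then 1 else 0) * treeSeries A τ P Set.univ ^ n) := by
  have h := hτ.treeSeries_rootCylinder A n (S := fun _ => Set.univ) fun _ => .univ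
  rw [Finset.prod_const, Finset.card_univ, Fintype.card_fin, ← coeff_pmfSeries] at h
  rw [← h]
  simp [rootCylinder]

theorem hasSum_coeff_treeSeries_outDegree_root (hτ : Measurable τ) (A : Set ℕ) (m : ℕ) :
    HasSum (fun n => coeff m (treeSeries A τ P {t | t.outDegree [] = n}))
      (coeff m (treeSeries A τ P Set.univ)) := by
  have hmeas : ∀ n, MeasurableSet {ω | τ ω ∈ {t : PlaneTree | t.outDegree [] = n} ∧
      (τ ω).numDegreeIn A = m} := fun n =>
    measurableSet_mem_numDegreeIn A hτ
      (measurable_outDegree [] (measurableSet_singleton n)) {(m : ℕ∞)}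
  have hdisj : Pairwise (Function.onFun Disjoint fun n : ℕ =>
      {ω | τ ω ∈ {t : PlaneTree | t.outDegree [] = n} ∧ (τ ω).numDegreeIn A = m}) :=
    fun i j hij => Set.disjoint_left.2 fun ω hi hj => hij (hi.1.symm.trans hj.1)
  have hunion : {ω | τ ω ∈ Set.univ ∧ (τ ω).numDegreeIn A = m} = ⋃ n : ℕ,
      {ω | τ ω ∈ {t : PlaneTree | t.outDegree [] = n} ∧ (τ ω).numDegreeIn A = m} := by
    ext ω
    simp
  have hmeasure := measure_iUnion (μ := P) hdisj hmeas
  simp only [coeff_treeSeries]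
  rw [hunion, measureReal_def, hmeasure, ENNReal.tsum_toReal_eq fun _ => measure_ne_top _ _]
  exact ENNReal.hasSum_toReal (hmeasure ▸ measure_ne_top _ _)

theorem genFun_treeSeries_univ_one_le (hτ : Measurable τ) (A : Set ℕ) :
    genFun (treeSeries A τ P Set.univ) 1 ≤ 1 :=
  (genFun_treeSeries_one A hτ .univ).trans_le measureReal_le_one

theorem summable_coeff_mul_genFun_treeSeries_pow {w : PowerSeries ℝ} (hw : IsMass w)
    (hτ : Measurable τ) (A : Set ℕ) :
    Summable fun n => coeff n w * genFun (treeSeries A τ P Set.univ) 1 ^ n :=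
  hw.summable_mul_pow ((isMass_treeSeries A hτ .univ).genFun_nonneg zero_le_one)
    (genFun_treeSeries_univ_one_le hτ A)

theorem hasSum_coeff_X_mul {f : ℕ → PowerSeries ℝ} {F : PowerSeries ℝ}
    (h : ∀ m, HasSum (fun n => coeff m (f n)) (coeff m F)) (m : ℕ) :
    HasSum (fun n => coeff m (X * f n)) (coeff m (X * F)) := by
  cases m with
  | zero => simp
  | succ m => simpa only [coeff_succ_X_mul] using h m

theorem IsGWTree.treeSeries_univ_eq (hτ : IsGWTree p τ P) (A : Set ℕ) :
    treeSeries A τ P Set.univ =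
      X * compSeries (restrictSeries (pmfSeries p) A) (treeSeries A τ P Set.univ) +
        compSeries (restrictSeries (pmfSeries p) Aᶜ) (treeSeries A τ P Set.univ) := by
  have hcomp (D : Set ℕ) := hasSum_coeff_compSeries ((isMass_pmfSeries p).restrictSeries D).1
    (isMass_treeSeries (P := P) A hτ.measurable .univ) (summable_coeff_mul_genFun_treeSeries_pow
      ((isMass_pmfSeries p).restrictSeries D) hτ.measurable A)
  ext m
  refine (hasSum_coeff_treeSeries_outDegree_root hτ.measurable A m).unique ?_
  rw [map_add]
  refine ((hasSum_coeff_X_mul (hcomp A) m).add (hcomp Aᶜ m)).congr_fun fun n => ?_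
  rw [hτ.treeSeries_outDegree_root, coeff_restrictSeries, coeff_restrictSeries]
  by_cases hn : n ∈ A
  · simp [hn, mul_left_comm]
  · simp [hn]

theorem IsGWTree.genFun_treeSeries_univ_eq (hτ : IsGWTree p τ P) (A : Set ℕ) {s : ℝ} (h0 : 0 ≤ s)
    (h1 : s ≤ 1) : genFun (treeSeries A τ P Set.univ) s =
      s * genFun (restrictSeries (pmfSeries p) A) (genFun (treeSeries A τ P Set.univ) s) +
        genFun (restrictSeries (pmfSeries p) Aᶜ) (genFun (treeSeries A τ P Set.univ) s) := by
  have hL := isMass_treeSeries (P := P) A hτ.measurable .univ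
  have hw (D : Set ℕ) := (isMass_pmfSeries p).restrictSeries D
  have hs (D : Set ℕ) := summable_coeff_mul_genFun_treeSeries_pow (P := P) (hw D) hτ.measurable A
  have hM (D : Set ℕ) := isMass_compSeries (hw D).1 hL (hs D)
  conv_lhs => rw [hτ.treeSeries_univ_eq A]
  rw [(isMass_X.mul (hM A)).genFun_add (hM Aᶜ) h0 h1, isMass_X.genFun_mul (hM A) h0 h1, genFun_X,
    genFun_compSeries (hw A).1 hL (hs A) h0 h1, genFun_compSeries (hw Aᶜ).1 hL (hs Aᶜ) h0 h1]

end TreeSeriesUniv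

section SizeSeries

open PowerSeries PlaneTree

theorem compSeries_eq_subst {w f : PowerSeries ℝ} (hf : constantCoeff f = 0) :
    compSeries w f = w.subst f := by
  ext m
  rw [compSeries, coeff_mk, coeff_subst_eq_sum hf]
  exact tsum_eq_sum fun d hd => by
    rw [coeff_pow_eq_zero_of_lt hf (by simpa using hd), mul_zero]

variable {p : PMF ℕ} {Ω : Type*} [MeasurableSpace Ω] {P : Measure Ω} [IsProbabilityMeasure P]
  {τ : Ω → PlaneTree}

theorem IsGWTree.treeSeries_univ_univ_eq (hτ : IsGWTree p τ P) :
    treeSeries Set.univ τ P Set.univ =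
      X * compSeries (pmfSeries p) (treeSeries Set.univ τ P Set.univ) := by
  have hzero : compSeries 0 (treeSeries Set.univ τ P Set.univ) = 0 := by
    ext m
    simp [compSeries]
  have h := hτ.treeSeries_univ_eq Set.univ
  rwa [restrictSeries_univ, Set.compl_univ, restrictSeries_empty, hzero, add_zero] at h

theorem IsGWTree.genFun_treeSeries_univ_univ_eq (hτ : IsGWTree p τ P) {s : ℝ} (h0 : 0 ≤ s)
    (h1 : s ≤ 1) : genFun (treeSeries Set.univ τ P Set.univ) s =
      s * genFun (pmfSeries p) (genFun (treeSeries Set.univ τ P Set.univ) s) := by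
  have h := hτ.genFun_treeSeries_univ_eq Set.univ h0 h1
  rwa [restrictSeries_univ, Set.compl_univ, restrictSeries_empty,
    show ∀ x, genFun 0 x = 0 by simp [genFun], add_zero] at h

theorem IsGWTree.genFun_treeSeries_univ_univ_one (hτ : IsGWTree p τ P) (hm : offspringMean p = 1)
    (hp : IsNondegenerate p) : genFun (treeSeries Set.univ τ P Set.univ) 1 = 1 := by
  refine (isMass_pmfSeries p).eq_one_of_eq_genFun (genFun_pmfSeries_one p)
    (offspringMean_eq_one_iff.1 hm) le_rfl hp.exists_two_le
    ((isMass_treeSeries _ hτ.measurable .univ).genFun_nonneg zero_le_one)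
    (genFun_treeSeries_univ_one_le hτ.measurable _) ?_
  rw [← one_mul (genFun (pmfSeries p) _)]
  exact hτ.genFun_treeSeries_univ_univ_eq zero_le_one le_rfl

theorem IsGWTree.not_hasMean_treeSeries_univ_univ (hτ : IsGWTree p τ P) (hm : offspringMean p = 1)
    (hp : IsNondegenerate p) (μ : ℝ) : ¬ HasMean (treeSeries Set.univ τ P Set.univ) μ := by
  intro hμ
  have hL := isMass_treeSeries (P := P) Set.univ hτ.measurable .univ
  have hs := summable_coeff_mul_genFun_treeSeries_pow (P := P) (isMass_pmfSeries p)
    hτ.measurable Set.univ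
  have hone := hτ.genFun_treeSeries_univ_univ_one hm hp
  have hcomp := hμ.compSeries (isMass_pmfSeries p).1 hL hs (ν := 1)
    (HasSum.congr_fun (offspringMean_eq_one_iff.1 hm) fun n => by
      rw [hone, one_pow, mul_one, mul_comm])
  have hmean := hasMean_X.mul hcomp isMass_X (isMass_compSeries (isMass_pmfSeries p).1 hL hs)
  rw [← hτ.treeSeries_univ_univ_eq,
    genFun_compSeries (isMass_pmfSeries p).1 hL hs zero_le_one le_rfl, hone,
    genFun_pmfSeries_one, genFun_X] at hmean
  linarith [hmean.unique hμ]

theorem IsGWTree.isCriticalPair (hτ : IsGWTree p τ P) (hm : offspringMean p = 1)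
    (hp : IsNondegenerate p) :
    IsCriticalPair (pmfSeries p) (treeSeries Set.univ τ P Set.univ) where
  mass := isMass_pmfSeries p
  genFun_one := genFun_pmfSeries_one p
  zero_pos := ((isMass_pmfSeries p).1 0).lt_of_ne' (coeff_pmfSeries_ne_zero_iff.2 hp.1.ne')
  exists_two_le := hp.exists_two_le
  eq_subst := by
    rw [← compSeries_eq_subst]
    · exact hτ.treeSeries_univ_univ_eq
    · rw [hτ.treeSeries_univ_univ_eq, map_mul, constantCoeff_X, zero_mul]
  not_summable h := hτ.not_hasMean_treeSeries_univ_univ hm hp _ h.hasSum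

end SizeSeries

section ReducedSeriesEquation

open PowerSeries

variable {f g L B : PowerSeries ℝ} {μ ν : ℝ}

theorem eq_C_add_C_mul_of_genFun_reducedSeries (hf : IsMass f) (hg : IsMass g) (hL : IsMass L)
    (hB : IsMass B) (hμ : HasMean f μ) (hν : HasMean g ν) (hcrit : μ + ν = 1)
    (htotal : genFun f 1 + genFun g 1 = 1) (ha1 : coeff 0 L < 1)
    (hpos : 0 < genFun f (coeff 0 L)) (hL1 : genFun L 1 ≤ 1) (hB1 : genFun B 1 ≤ 1)
    (hLeq : ∀ s, 0 ≤ s → s ≤ 1 →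
      genFun L s = s * genFun f (genFun L s) + genFun g (genFun L s))
    (hBeq : ∀ s, 0 ≤ s → s ≤ 1 →
      genFun B s = s * genFun (reducedSeries (coeff 0 L) f g) (genFun B s)) :
    L = C (coeff 0 L) + C (1 - coeff 0 L) * B := by
  set a := coeff 0 L with ha
  have ha0 : 0 ≤ a := hL.1 0
  have hb : 0 < 1 - a := sub_pos.2 ha1
  have hfix : genFun g a = a := by
    simpa [genFun_zero_right, ← ha] using (hLeq 0 le_rfl zero_le_one).symm
  refine hL.eq_of_genFun_eq (hB.C_add_C_mul ha0 hb.le) fun s h0 h1 => ?_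
  rw [hB.genFun_C_add_C_mul ha0 hb.le h0.le h1.le]
  have hLs0 : a ≤ genFun L s := by
    rw [ha, ← genFun_zero_right]
    exact hL.genFun_mono le_rfl h0.le h1.le
  have hLs1 := (hL.genFun_mono h0.le h1.le le_rfl).trans hL1
  have hBs1 := (hB.genFun_mono h0.le h1.le le_rfl).trans hB1
  -- The normalization `x` of `L(s)` and `B(s)` solve the same contracting equation.
  obtain ⟨x, hx⟩ : ∃ x, a + (1 - a) * x = genFun L s :=
    ⟨(genFun L s - a) / (1 - a), by rw [mul_div_cancel₀ _ hb.ne', add_sub_cancel]⟩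
  have hx0 : 0 ≤ x := nonneg_of_mul_nonneg_right (by linarith) hb
  have hx1 : x ≤ 1 := le_of_mul_le_mul_left (by linarith) hb
  have hxeq := eq_mul_genFun_reducedSeries ha0 ha1 hf hg hfix htotal hpos hx0 hx1
    (hx ▸ hLeq s h0.le h1.le)
  rw [← (isMass_reducedSeries ha0 ha1 hf hg hfix htotal hpos).eq_of_eq_mul_genFun
    (HasMean.reducedSeries ha0 ha1 hf hg hfix htotal hpos hμ hν hcrit) h0.le
    ((mul_one s).trans_lt h1) hx0 hx1 (hB.genFun_nonneg h0.le) hBs1 hxeq (hBeq s h0.le h1.le), hx]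

end ReducedSeriesEquation

section ConditionedSeries

open PowerSeries PlaneTree

variable {Ω : Type*} [MeasurableSpace Ω] {P : Measure Ω} [IsProbabilityMeasure P]
  {τ : Ω → PlaneTree}

theorem measurableSet_numDegreeIn_pos (hτ : Measurable τ) (A : Set ℕ) :
    MeasurableSet {ω | 0 < (τ ω).numDegreeIn A} := by
  simpa using measurableSet_mem_numDegreeIn A hτ .univ {m | 0 < m}

theorem measureReal_numDegreeIn_pos (hτ : Measurable τ) (A : Set ℕ) :
    P.real {ω | 0 < (τ ω).numDegreeIn A} = 1 - coeff 0 (treeSeries A τ P Set.univ) := by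
  have hzero : MeasurableSet {ω | τ ω ∈ Set.univ ∧ (τ ω).numDegreeIn A = ((0 : ℕ) : ℕ∞)} :=
    measurableSet_mem_numDegreeIn A hτ .univ {((0 : ℕ) : ℕ∞)}
  rw [coeff_treeSeries, ← probReal_compl_eq_one_sub hzero]
  congr 1
  ext ω
  simp [pos_iff_ne_zero]

theorem treeSeries_univ_eq_add_cond (hτ : Measurable τ) (A : Set ℕ) :
    treeSeries A τ P Set.univ = C (coeff 0 (treeSeries A τ P Set.univ)) +
      C (1 - coeff 0 (treeSeries A τ P Set.univ)) *
        treeSeries A τ P[|{ω | 0 < (τ ω).numDegreeIn A}] Set.univ := by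
  ext m
  have hcond := congrArg ENNReal.toReal (cond_mul_eq_inter
    (measurableSet_numDegreeIn_pos hτ A) {ω | τ ω ∈ Set.univ ∧ (τ ω).numDegreeIn A = m} P)
  rw [ENNReal.toReal_mul, mul_comm] at hcond
  simp only [← measureReal_def] at hcond
  rw [map_add, coeff_C_mul, ← measureReal_numDegreeIn_pos hτ,
    coeff_treeSeries _ _ P[|{ω | 0 < (τ ω).numDegreeIn A}], hcond]
  rcases m with _ | m
  · have hinter : {ω | 0 < (τ ω).numDegreeIn A} ∩
        {ω | τ ω ∈ Set.univ ∧ (τ ω).numDegreeIn A = ((0 : ℕ) : ℕ∞)} = ∅ := by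
      ext ω
      simpa using fun h : 0 < (τ ω).numDegreeIn A => h.ne'
    rw [hinter, measureReal_empty, add_zero, coeff_C, if_pos rfl]
  · rw [coeff_C, if_neg m.succ_ne_zero, zero_add, coeff_treeSeries, Set.inter_eq_right.2]
    rintro ω ⟨-, hω⟩
    rw [Set.mem_ofPred_eq, hω]
    exact_mod_cast m.succ_pos

theorem measureReal_numDegreeIn_eq_top (hτ : Measurable τ) (A : Set ℕ) :
    P.real {ω | (τ ω).numDegreeIn A = ⊤} = 1 - genFun (treeSeries A τ P Set.univ) 1 := by
  have hfinite := measurableSet_mem_numDegreeIn A hτ .univ {m | m ≠ ⊤}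
  rw [genFun_treeSeries_one A hτ .univ]
  refine Eq.trans ?_ (probReal_compl_eq_one_sub (μ := P) hfinite)
  congr 1
  ext ω
  simp

theorem forall_measure_numDegreeIn_eq_iff (hτ : Measurable τ) {Ω₁ : Type*} [MeasurableSpace Ω₁]
    {P₁ : Measure Ω₁} [IsProbabilityMeasure P₁] {σ : Ω₁ → PlaneTree} (hσ : Measurable σ)
    (A B : Set ℕ) :
    (∀ n : ℕ∞, P {ω | (τ ω).numDegreeIn A = n} = P₁ {ω | (σ ω).numDegreeIn B = n}) ↔
      treeSeries A τ P Set.univ = treeSeries B σ P₁ Set.univ := by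
  constructor
  · intro h
    ext m
    simpa [coeff_treeSeries, measureReal_def] using congrArg ENNReal.toReal (h m)
  · intro h n
    refine (measureReal_eq_measureReal_iff).1 ?_
    induction n using ENat.recTopCoe with
    | top => rw [measureReal_numDegreeIn_eq_top hτ, measureReal_numDegreeIn_eq_top hσ, h]
    | coe m => simpa [coeff_treeSeries] using congrArg (coeff m) h

end ConditionedSeries

section ReducedOffspring

open PowerSeries PlaneTree

variable {p q : PMF ℕ} {Ω : Type*} [MeasurableSpace Ω] {P : Measure Ω} [IsProbabilityMeasure P]
  {τ : Ω → PlaneTree} {A : Set ℕ}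

theorem exists_mem_coeff_pmfSeries_pos (hA : 0 < ∑' n : A, p n) :
    ∃ n ∈ A, 0 < coeff n (pmfSeries p) := by
  obtain ⟨n, hn⟩ : ∃ n : A, p n ≠ 0 := by
    by_contra! h
    exact hA.ne' (ENNReal.tsum_eq_zero.2 h)
  exact ⟨n, n.2, ((isMass_pmfSeries p).1 n).lt_of_ne' (coeff_pmfSeries_ne_zero_iff.2 hn)⟩

theorem genFun_restrictSeries_add_compl_one (p : PMF ℕ) (A : Set ℕ) :
    genFun (restrictSeries (pmfSeries p) A) 1 + genFun (restrictSeries (pmfSeries p) Aᶜ) 1 = 1 := by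
  rw [← ((isMass_pmfSeries p).restrictSeries A).genFun_add ((isMass_pmfSeries p).restrictSeries Aᶜ)
    zero_le_one le_rfl, restrictSeries_add_compl, genFun_pmfSeries_one]

theorem IsGWTree.genFun_restrictSeries_compl_coeff_zero (hτ : IsGWTree p τ P) (A : Set ℕ) :
    genFun (restrictSeries (pmfSeries p) Aᶜ) (coeff 0 (treeSeries A τ P Set.univ)) =
      coeff 0 (treeSeries A τ P Set.univ) := by
  rw [← genFun_zero_right (treeSeries A τ P Set.univ)]
  simpa using (hτ.genFun_treeSeries_univ_eq A le_rfl zero_le_one).symm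

theorem IsGWTree.coeff_zero_treeSeries_lt_one (hτ : IsGWTree p τ P) (hA : 0 < ∑' n : A, p n) :
    coeff 0 (treeSeries A τ P Set.univ) < 1 := by
  have hle := ((isMass_treeSeries (P := P) A hτ.measurable .univ).coeff_le_genFun_one 0).trans
    (genFun_treeSeries_univ_one_le hτ.measurable A)
  refine hle.lt_of_ne fun hone => ?_
  have hfix := hτ.genFun_restrictSeries_compl_coeff_zero A
  obtain ⟨n, hn, hpn⟩ := exists_mem_coeff_pmfSeries_pos hA
  have hcoeff := ((isMass_pmfSeries p).restrictSeries A).coeff_le_genFun_one n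
  rw [coeff_restrictSeries, Set.indicator_of_mem hn] at hcoeff
  rw [hone] at hfix
  linarith [genFun_restrictSeries_add_compl_one p A]

theorem IsGWTree.genFun_restrictSeries_coeff_zero_pos (hτ : IsGWTree p τ P)
    (hp : p 0 ≠ 0) (hA : 0 < ∑' n : A, p n) :
    0 < genFun (restrictSeries (pmfSeries p) A) (coeff 0 (treeSeries A τ P Set.univ)) := by
  have hp0 := coeff_pmfSeries_ne_zero_iff.2 hp
  have hfA := (isMass_pmfSeries p).restrictSeries A
  have hfix := hτ.genFun_restrictSeries_compl_coeff_zero A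
  have ha1 := hτ.coeff_zero_treeSeries_lt_one hA
  rcases ((isMass_treeSeries (P := P) A hτ.measurable .univ).1 0).eq_or_lt with ha | ha
  · rw [← ha, genFun_zero_right, coeff_restrictSeries] at hfix ⊢
    have h0 : 0 ∈ A := by
      by_contra h0
      exact hp0 (by rwa [Set.indicator_of_mem (Set.mem_compl h0)] at hfix)
    rw [Set.indicator_of_mem h0]
    exact ((isMass_pmfSeries p).1 0).lt_of_ne' hp0
  · obtain ⟨n, hn, hpn⟩ := exists_mem_coeff_pmfSeries_pos hA
    refine (hfA.summable_mul_pow ha.le ha1.le).tsum_pos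
      (fun m => mul_nonneg (hfA.1 m) (pow_nonneg ha.le m)) n (mul_pos ?_ (pow_pos ha n))
    rwa [coeff_restrictSeries, Set.indicator_of_mem hn]

theorem IsGWTree.exists_pmfSeries_eq_reducedSeries (hτ : IsGWTree p τ P)
    (hm : offspringMean p = 1) (hp : p 0 ≠ 0) (hA : 0 < ∑' n : A, p n) :
    ∃ q : PMF ℕ, offspringMean q = 1 ∧ q 0 ≠ 0 ∧
      pmfSeries q = reducedSeries (coeff 0 (treeSeries A τ P Set.univ))
        (restrictSeries (pmfSeries p) A) (restrictSeries (pmfSeries p) Aᶜ) := by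
  have ha0 := (isMass_treeSeries (P := P) A hτ.measurable .univ).1 0
  have ha1 := hτ.coeff_zero_treeSeries_lt_one hA
  have hM (D : Set ℕ) := (isMass_pmfSeries p).restrictSeries D
  have hfix := hτ.genFun_restrictSeries_compl_coeff_zero A
  have htotal := genFun_restrictSeries_add_compl_one p A
  have hpos := hτ.genFun_restrictSeries_coeff_zero_pos hp hA
  obtain ⟨μ, ν, hμ, hν, hcrit⟩ := exists_hasMean_restrictSeries hm A
  obtain ⟨q, hq⟩ := exists_pmfSeries_eq
    (isMass_reducedSeries ha0 ha1 (hM A) (hM Aᶜ) hfix htotal hpos)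
    (genFun_reducedSeries_one ha0 ha1 (hM A) (hM Aᶜ) hfix htotal hpos)
  refine ⟨q, offspringMean_eq_one_iff.2 ?_, coeff_pmfSeries_ne_zero_iff.1 ?_, hq⟩ <;> rw [hq]
  · exact HasMean.reducedSeries ha0 ha1 (hM A) (hM Aᶜ) hfix htotal hpos hμ hν hcrit
  · exact (coeff_zero_reducedSeries_pos ha0 ha1 (hM A) (hM Aᶜ) hfix htotal hpos).ne'

theorem IsGWTree.treeSeries_univ_eq_add_size (hτ : IsGWTree p τ P) (hm : offspringMean p = 1)
    (hp : p 0 ≠ 0) (hA : 0 < ∑' n : A, p n)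
    (hq : pmfSeries q = reducedSeries (coeff 0 (treeSeries A τ P Set.univ))
      (restrictSeries (pmfSeries p) A) (restrictSeries (pmfSeries p) Aᶜ))
    {Ω₁ : Type*} [MeasurableSpace Ω₁] {P₁ : Measure Ω₁} [IsProbabilityMeasure P₁]
    {σ : Ω₁ → PlaneTree} (hσ : IsGWTree q σ P₁) :
    treeSeries A τ P Set.univ = C (coeff 0 (treeSeries A τ P Set.univ)) +
      C (1 - coeff 0 (treeSeries A τ P Set.univ)) * treeSeries Set.univ σ P₁ Set.univ := by
  obtain ⟨μ, ν, hμ, hν, hcrit⟩ := exists_hasMean_restrictSeries hm A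
  exact eq_C_add_C_mul_of_genFun_reducedSeries ((isMass_pmfSeries p).restrictSeries A)
    ((isMass_pmfSeries p).restrictSeries Aᶜ) (isMass_treeSeries A hτ.measurable .univ)
    (isMass_treeSeries Set.univ hσ.measurable .univ) hμ hν hcrit
    (genFun_restrictSeries_add_compl_one p A) (hτ.coeff_zero_treeSeries_lt_one hA)
    (hτ.genFun_restrictSeries_coeff_zero_pos hp hA)
    (genFun_treeSeries_univ_one_le hτ.measurable A)
    (genFun_treeSeries_univ_one_le hσ.measurable Set.univ)
    (fun _ h0 h1 => hτ.genFun_treeSeries_univ_eq A h0 h1)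
    fun _ h0 h1 => hq ▸ hσ.genFun_treeSeries_univ_univ_eq h0 h1

theorem IsGWTree.isProbabilityMeasure_cond_numDegreeIn_pos (hτ : IsGWTree p τ P)
    (hA : 0 < ∑' n : A, p n) : IsProbabilityMeasure P[|{ω | 0 < (τ ω).numDegreeIn A}] := by
  refine cond_isProbabilityMeasure fun hzero => ?_
  have hreal := measureReal_numDegreeIn_pos (P := P) hτ.measurable A
  rw [measureReal_def, hzero, ENNReal.toReal_zero] at hreal
  linarith [hτ.coeff_zero_treeSeries_lt_one hA]

theorem IsGWTree.forall_cond_numDegreeIn_eq_iff (hτ : IsGWTree p τ P) (hA : 0 < ∑' n : A, p n)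
    {Ω₁ : Type*} [MeasurableSpace Ω₁] {P₁ : Measure Ω₁} [IsProbabilityMeasure P₁]
    {σ : Ω₁ → PlaneTree} (hσ : Measurable σ) :
    (∀ n : ℕ∞, P[|{ω | 0 < (τ ω).numDegreeIn A}] {ω | (τ ω).numDegreeIn A = n} =
        P₁ {ω | (σ ω).size = n}) ↔
      treeSeries A τ P Set.univ = C (coeff 0 (treeSeries A τ P Set.univ)) +
        C (1 - coeff 0 (treeSeries A τ P Set.univ)) * treeSeries Set.univ σ P₁ Set.univ := by
  have := hτ.isProbabilityMeasure_cond_numDegreeIn_pos hA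
  have hne : (C (1 - coeff 0 (treeSeries A τ P Set.univ)) : PowerSeries ℝ) ≠ 0 :=
    (map_ne_zero_iff _ C_injective).2 (sub_pos.2 (hτ.coeff_zero_treeSeries_lt_one hA)).ne'
  simp only [size_eq_numDegreeIn_univ]
  rw [forall_measure_numDegreeIn_eq_iff hτ.measurable hσ]
  conv_rhs => lhs; rw [treeSeries_univ_eq_add_cond hτ.measurable A]
  rw [add_right_inj, mul_right_inj' hne]

theorem IsGWTree.exists_isReducedOffspring (hτ : IsGWTree p τ P) (hm : offspringMean p = 1)
    (hp : p 0 ≠ 0) (hA : 0 < ∑' n : A, p n) : ∃ q : PMF ℕ, IsReducedOffspring A τ P q := by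
  obtain ⟨q, hq1, hq0, hq⟩ := hτ.exists_pmfSeries_eq_reducedSeries hm hp hA
  have hσ := isGWTree_ofDegrees q
  exact ⟨q, hq1, isNondegenerate_of_offspringMean_eq_one hq1 hq0, Node → ℕ, inferInstance,
    Measure.infinitePi fun _ => q.toMeasure, ofDegrees, inferInstance, hσ,
    (hτ.forall_cond_numDegreeIn_eq_iff hA hσ.measurable).2
      (hτ.treeSeries_univ_eq_add_size hm hp hA hq hσ)⟩

end ReducedOffspring

section Windows

open PlaneTree PowerSeries Asymptotics

variable {p q : PMF ℕ} {A : Set ℕ} {Ω : Type*} [MeasurableSpace Ω] {P : Measure Ω}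
  [IsProbabilityMeasure P] {τ : Ω → PlaneTree}

theorem offspringPeriod_eq_coeffPeriod (hq : 0 < coeffPeriod (pmfSeries q)) :
    offspringPeriod q = coeffPeriod (pmfSeries q) := by
  have hdvd : {k : ℕ | q.toMeasure {n : ℕ | k ∣ n} = 1} = {k | k ∣ coeffPeriod (pmfSeries q)} := by
    ext k
    rw [Set.mem_ofPred_eq, PMF.toMeasure_apply_eq_one_iff q .of_discrete, Set.mem_ofPred_eq,
      coeffPeriod, Nat.dvd_setGcd_iff]
    refine forall_congr' fun n => ?_
    rw [PMF.mem_support_iff, ← coeff_pmfSeries_ne_zero_iff]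
    rfl
  rw [offspringPeriod, hdvd]
  exact IsGreatest.csSup_eq ⟨dvd_rfl, fun k hk => Nat.le_of_dvd hq hk⟩

theorem windowSum_C_add_C_mul_succ (a b : ℝ) (d n : ℕ) (f : PowerSeries ℝ) :
    windowSum d (C a + C b * f) (n + 1) = b * windowSum d f (n + 1) := by
  simp only [windowSum, Finset.mul_sum, map_add, coeff_C_mul, coeff_C]
  exact Finset.sum_congr rfl fun j _ => by rw [if_neg (by omega), zero_add]

theorem iUnion_singleton_add_eq_Ico (d n : ℕ) :
    ⋃ j : Fin d, {((n + j : ℕ) : ℕ∞)} = Set.Ico (n : ℕ∞) ((n + d : ℕ) : ℕ∞) := by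
  ext m
  simp only [Set.mem_iUnion, Set.mem_singleton_iff, Set.mem_Ico]
  constructor
  · rintro ⟨j, rfl⟩
    exact ⟨by exact_mod_cast Nat.le_add_right n j, by exact_mod_cast Nat.add_lt_add_left j.2 n⟩
  · rintro ⟨hn, hd⟩
    lift m to ℕ using hd.ne_top
    norm_cast at hn hd
    exact ⟨⟨m - n, by omega⟩, by simp only [Nat.add_sub_cancel' hn]⟩

theorem windowSum_treeSeries (hτ : Measurable τ) (A : Set ℕ) {S : Set PlaneTree}
    (hS : MeasurableSet S) (d n : ℕ) : windowSum d (treeSeries A τ P S) n =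
      P.real {ω | τ ω ∈ S ∧ (τ ω).numDegreeIn A ∈ Set.Ico (n : ℕ∞) ((n + d : ℕ) : ℕ∞)} := by
  have hdisj : Pairwise (Function.onFun Disjoint
      fun j : Fin d => ({((n + j : ℕ) : ℕ∞)} : Set ℕ∞)) := fun i j hij => by
    simpa [Fin.ext_iff] using hij
  rw [← iUnion_singleton_add_eq_Ico,
    ← (hasSum_measureReal_mem_numDegreeIn A hτ hS hdisj).tsum_eq, tsum_fintype, windowSum,
    Finset.sum_range]
  simp only [coeff_treeSeries, Set.mem_singleton_iff]

theorem iUnion_Ico_add_mul_eq_Ico_top {d : ℕ} (hd : 0 < d) (n : ℕ) :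
    ⋃ i : ℕ, Set.Ico ((n + i * d : ℕ) : ℕ∞) ((n + i * d + d : ℕ) : ℕ∞) =
      Set.Ico (n : ℕ∞) ⊤ := by
  ext m
  simp only [Set.mem_iUnion, Set.mem_Ico]
  constructor
  · rintro ⟨i, hi, hm⟩
    exact ⟨le_trans (by exact_mod_cast Nat.le_add_right n _) hi, hm.ne_top.lt_top⟩
  · rintro ⟨hn, hm⟩
    lift m to ℕ using hm.ne
    norm_cast at hn ⊢
    have hdiv := Nat.div_add_mod' (m - n) d
    have hmod := Nat.mod_lt (m - n) hd
    exact ⟨(m - n) / d, by omega, by omega⟩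

theorem hasSum_windowSum_treeSeries (hτ : Measurable τ) (A : Set ℕ) {S : Set PlaneTree}
    (hS : MeasurableSet S) {d : ℕ} (hd : 0 < d) (n : ℕ) :
    HasSum (fun i => windowSum d (treeSeries A τ P S) (n + i * d))
      (P.real {ω | τ ω ∈ S ∧ (τ ω).numDegreeIn A ∈ Set.Ico (n : ℕ∞) ⊤}) := by
  have hmono : Monotone fun i : ℕ => ((n + i * d : ℕ) : ℕ∞) := fun i j hij =>
    Nat.cast_le.2 (Nat.add_le_add_left (Nat.mul_le_mul_right d hij) n)
  have hdisj := hmono.pairwise_disjoint_on_Ico_succ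
  simp only [Nat.succ_eq_succ, Nat.succ_mul, ← add_assoc] at hdisj
  simp only [windowSum_treeSeries hτ A hS, ← iUnion_Ico_add_mul_eq_Ico_top hd]
  exact hasSum_measureReal_mem_numDegreeIn A hτ hS hdisj

theorem IsReducedOffspring.exists_isCriticalPair (hq : IsReducedOffspring A τ P q)
    (hτ : IsGWTree p τ P) (hA : 0 < ∑' n : A, p n) :
    ∃ B, IsMass B ∧ genFun B 1 = 1 ∧ IsCriticalPair (pmfSeries q) B ∧
      treeSeries A τ P Set.univ = C (coeff 0 (treeSeries A τ P Set.univ)) +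
        C (1 - coeff 0 (treeSeries A τ P Set.univ)) * B := by
  obtain ⟨hmean, hnondeg, Ω₁, _, P₁, σ, _, hσ, hlaw⟩ := hq
  exact ⟨treeSeries Set.univ σ P₁ Set.univ, isMass_treeSeries _ hσ.measurable .univ,
    hσ.genFun_treeSeries_univ_univ_one hmean hnondeg, hσ.isCriticalPair hmean hnondeg,
    (hτ.forall_cond_numDegreeIn_eq_iff hA hσ.measurable).1 hlaw⟩

theorem IsReducedOffspring.offspringPeriod_pos (hq : IsReducedOffspring A τ P q)
    (hτ : IsGWTree p τ P) (hA : 0 < ∑' n : A, p n) : 0 < offspringPeriod q := by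
  obtain ⟨B, -, -, hB, -⟩ := hq.exists_isCriticalPair hτ hA
  rw [offspringPeriod_eq_coeffPeriod hB.coeffPeriod_pos]
  exact hB.coeffPeriod_pos

theorem IsReducedOffspring.genFun_treeSeries_univ_one (hq : IsReducedOffspring A τ P q)
    (hτ : IsGWTree p τ P) (hA : 0 < ∑' n : A, p n) :
    genFun (treeSeries A τ P Set.univ) 1 = 1 := by
  obtain ⟨B, hB, hB1, -, heq⟩ := hq.exists_isCriticalPair hτ hA
  have ha := (isMass_treeSeries (P := P) A hτ.measurable .univ).1 0
  rw [heq, hB.genFun_C_add_C_mul ha (sub_nonneg.2 (hτ.coeff_zero_treeSeries_lt_one hA).le)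
    zero_le_one le_rfl, hB1]
  ring

theorem IsReducedOffspring.eventually_windowSum_pos (hq : IsReducedOffspring A τ P q)
    (hτ : IsGWTree p τ P) (hA : 0 < ∑' n : A, p n) :
    ∀ᶠ n in atTop, 0 < windowSum (offspringPeriod q) (treeSeries A τ P Set.univ) n := by
  obtain ⟨B, -, -, hB, heq⟩ := hq.exists_isCriticalPair hτ hA
  rw [offspringPeriod_eq_coeffPeriod hB.coeffPeriod_pos, heq, ← map_add_atTop_eq_nat 1,
    eventually_map]
  simp only [windowSum_C_add_C_mul_succ]
  filter_upwards [(tendsto_add_atTop_nat 1).eventually hB.eventually_windowSum_pos] with n hn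
  exact mul_pos (sub_pos.2 (hτ.coeff_zero_treeSeries_lt_one hA)) hn

theorem IsReducedOffspring.isEquivalent_windowSum_succ (hq : IsReducedOffspring A τ P q)
    (hτ : IsGWTree p τ P) (hA : 0 < ∑' n : A, p n) :
    (fun n => windowSum (offspringPeriod q) (treeSeries A τ P Set.univ) (n + 1)) ~[atTop]
      windowSum (offspringPeriod q) (treeSeries A τ P Set.univ) := by
  obtain ⟨B, -, -, hB, heq⟩ := hq.exists_isCriticalPair hτ hA
  rw [offspringPeriod_eq_coeffPeriod hB.coeffPeriod_pos, heq]
  generalize coeff 0 (treeSeries A τ P Set.univ) = a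
  have hshift : (fun n => windowSum (coeffPeriod (pmfSeries q)) B (n + 1 + 1)) ~[atTop]
      fun n => windowSum (coeffPeriod (pmfSeries q)) B (n + 1) :=
    hB.isEquivalent_windowSum_succ.comp_tendsto (tendsto_add_atTop_nat 1)
  have hmul := (IsEquivalent.refl (u := fun _ : ℕ => 1 - a)).mul hshift
  rw [← map_add_atTop_eq_nat 1, IsEquivalent, isLittleO_map]
  simpa only [IsEquivalent, Function.comp_def, Pi.sub_def, Pi.mul_def,
    windowSum_C_add_C_mul_succ] using hmul

theorem IsReducedOffspring.ae_numDegreeIn_ne_top (hq : IsReducedOffspring A τ P q)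
    (hτ : IsGWTree p τ P) (hA : 0 < ∑' n : A, p n) : ∀ᵐ ω ∂P, (τ ω).numDegreeIn A ≠ ⊤ := by
  have htop : P.real {ω | (τ ω).numDegreeIn A = ⊤} = 0 := by
    rw [measureReal_numDegreeIn_eq_top hτ.measurable, hq.genFun_treeSeries_univ_one hτ hA,
      sub_self]
  exact measure_eq_zero_iff_ae_notMem.1 ((measureReal_eq_zero_iff).1 htop)

/-- The number of vertices of `t` at height `h` is the weight of `localBall h t` in the tail of
`L_A(τ)`, and it is also the density of Kesten's tree with respect to `τ` on this ball. -/
theorem IsReducedOffspring.eventually_mul_windowSum_le (hq : IsReducedOffspring A τ P q)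
    (hτ : IsGWTree p τ P) (hA : 0 < ∑' n : A, p n) (hm : offspringMean p = 1)
    {h0 : offspringMean p ≠ 0} {h1 : offspringMean p ≠ ∞} {h : ℕ} {t : PlaneTree} {c : ℝ}
    (hc : c < (kestenLaw p h0 h1).real (localBall h t)) :
    ∀ᶠ n in atTop, c * windowSum (offspringPeriod q) (treeSeries A τ P Set.univ) n ≤
      windowSum (offspringPeriod q) (treeSeries A τ P (localBall h t)) n := by
  have huniv : HasTailWeight (windowSum (offspringPeriod q) (treeSeries A τ P Set.univ))
      (offspringPeriod q) (treeSeries A τ P Set.univ) 1 := fun c hc => by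
    rw [hq.genFun_treeSeries_univ_one hτ hA, one_mul] at hc
    exact .of_forall fun n => mul_le_of_le_one_left
      ((isMass_treeSeries A hτ.measurable .univ).windowSum_nonneg _ n) hc.le
  refine hτ.hasTailWeight_treeSeries_localBall A
    ((isMass_treeSeries A hτ.measurable .univ).windowSum_nonneg _)
    (hq.isEquivalent_windowSum_succ hτ hA) huniv h t c (hc.trans_le ?_)
  have hball : P {ω | τ ω ∈ localBall h t ∧ (τ ω).numDegreeIn A ≠ ⊤} =
      P (τ ⁻¹' localBall h t) := measure_congr <| by
    filter_upwards [hq.ae_numDegreeIn_ne_top hτ hA] with ω hω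
    exact propext (and_iff_left hω)
  rw [genFun_treeSeries_one A hτ.measurable (measurableSet_localBall h t), measureReal_def,
    measureReal_def, hball, hτ.measure_preimage_localBall, ← ENNReal.toReal_natCast,
    ← ENNReal.toReal_mul]
  refine ENNReal.toReal_mono ?_ (kestenLaw_localBall_le h0 h1 hm h t)
  exact ENNReal.mul_ne_top (ENNReal.natCast_ne_top _)
    (ENNReal.prod_ne_top fun _ _ => p.apply_ne_top _)

theorem IsReducedOffspring.eventually_mul_measureReal_window_le
    (hq : IsReducedOffspring A τ P q) (hτ : IsGWTree p τ P) (hA : 0 < ∑' n : A, p n)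
    (hm : offspringMean p = 1) {h0 : offspringMean p ≠ 0} {h1 : offspringMean p ≠ ∞} {h : ℕ}
    {t : PlaneTree} {c : ℝ} (hc : c < (kestenLaw p h0 h1).real (localBall h t)) :
    ∀ᶠ n : ℕ in atTop, c * P.real {ω | (n : ℕ∞) ≤ (τ ω).numDegreeIn A ∧
        (τ ω).numDegreeIn A < ((n + offspringPeriod q : ℕ) : ℕ∞)} ≤
      P.real (τ ⁻¹' localBall h t ∩ {ω | (n : ℕ∞) ≤ (τ ω).numDegreeIn A ∧
        (τ ω).numDegreeIn A < ((n + offspringPeriod q : ℕ) : ℕ∞)}) := by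
  have hev := hq.eventually_mul_windowSum_le hτ hA hm hc
  simp only [windowSum_treeSeries hτ.measurable A .univ,
    windowSum_treeSeries hτ.measurable A (measurableSet_localBall h t), Set.mem_univ,
    true_and] at hev
  exact hev

theorem IsReducedOffspring.eventually_mul_measureReal_tail_le
    (hq : IsReducedOffspring A τ P q) (hτ : IsGWTree p τ P) (hA : 0 < ∑' n : A, p n)
    (hm : offspringMean p = 1) {h0 : offspringMean p ≠ 0} {h1 : offspringMean p ≠ ∞} {h : ℕ}
    {t : PlaneTree} {c : ℝ} (hc : c < (kestenLaw p h0 h1).real (localBall h t)) :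
    ∀ᶠ n : ℕ in atTop, c * P.real {ω | (n : ℕ∞) ≤ (τ ω).numDegreeIn A} ≤
      P.real (τ ⁻¹' localBall h t ∩ {ω | (n : ℕ∞) ≤ (τ ω).numDegreeIn A}) := by
  obtain ⟨N, hN⟩ := eventually_atTop.1 (hq.eventually_mul_windowSum_le hτ hA hm hc)
  have htail (S : Set PlaneTree) (n : ℕ) :
      P.real {ω | τ ω ∈ S ∧ (τ ω).numDegreeIn A ∈ Set.Ico (n : ℕ∞) ⊤} =
        P.real (τ ⁻¹' S ∩ {ω | (n : ℕ∞) ≤ (τ ω).numDegreeIn A}) := measureReal_congr <| by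
    filter_upwards [hq.ae_numDegreeIn_ne_top hτ hA] with ω hω
    exact propext (and_congr_right fun _ => and_iff_left hω.lt_top)
  have hsum {S : Set PlaneTree} (hS : MeasurableSet S) (n : ℕ) :=
    htail S n ▸ hasSum_windowSum_treeSeries (P := P) hτ.measurable A hS
      (hq.offspringPeriod_pos hτ hA) n
  filter_upwards [eventually_ge_atTop N] with n hn
  have huniv := hsum .univ n
  rw [Set.preimage_univ, Set.univ_inter] at huniv
  exact hasSum_le (fun i => hN _ (hn.trans (Nat.le_add_right _ _))) (huniv.mul_left c)
    (hsum (measurableSet_localBall h t) n)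

theorem IsReducedOffspring.eventually_measure_window_ne_zero (hq : IsReducedOffspring A τ P q)
    (hτ : IsGWTree p τ P) (hA : 0 < ∑' n : A, p n) :
    ∀ᶠ n : ℕ in atTop, P {ω | (n : ℕ∞) ≤ (τ ω).numDegreeIn A ∧
      (τ ω).numDegreeIn A < ((n + offspringPeriod q : ℕ) : ℕ∞)} ≠ 0 := by
  filter_upwards [hq.eventually_windowSum_pos hτ hA] with n hn hzero
  rw [windowSum_treeSeries hτ.measurable A .univ, measureReal_def] at hn
  exact (ENNReal.toReal_pos_iff.1 hn).1.ne' (measure_mono_null (fun ω hω => hω.2) hzero)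

theorem IsReducedOffspring.measure_le_numDegreeIn_ne_zero (hq : IsReducedOffspring A τ P q)
    (hτ : IsGWTree p τ P) (hA : 0 < ∑' n : A, p n) (n : ℕ) :
    P {ω | (n : ℕ∞) ≤ (τ ω).numDegreeIn A} ≠ 0 := by
  obtain ⟨m, hm, hnm⟩ :=
    ((hq.eventually_measure_window_ne_zero hτ hA).and (eventually_ge_atTop n)).exists
  exact fun hzero => hm <| measure_mono_null (fun ω hω => (Nat.cast_le.2 hnm).trans hω.1) hzero

theorem IsConditionedOn.tendstoInDistribution {E : ℕ → Set Ω} {Ωₙ : ℕ → Type*}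
    [∀ n, MeasurableSpace (Ωₙ n)] {Pₙ : ∀ n, Measure (Ωₙ n)} [∀ n, IsProbabilityMeasure (Pₙ n)]
    {τₙ : ∀ n, Ωₙ n → PlaneTree} (hcond : IsConditionedOn τ P E τₙ Pₙ) (hτ : Measurable τ)
    (hτₙ : ∀ n, AEMeasurable (τₙ n) (Pₙ n)) (hE : ∀ n, MeasurableSet (E n))
    (hpos : ∀ᶠ n in atTop, P (E n) ≠ 0) {Ω' : Type*} [MeasurableSpace Ω'] {P' : Measure Ω'}
    [IsProbabilityMeasure P'] {τ' : Ω' → PlaneTree} (hτ' : AEMeasurable τ' P')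
    (hball : ∀ h t, ∀ c < (P'.map τ').real (localBall h t),
      ∀ᶠ n in atTop, c * P.real (E n) ≤ P.real (τ ⁻¹' localBall h t ∩ E n)) :
    TendstoInDistribution τₙ atTop τ' Pₙ P' := by
  refine ⟨hτₙ, hτ', tendsto_of_forall_localBall_le_liminf fun h t =>
    ENNReal.le_of_forall_nnreal_lt fun c hc => le_liminf_of_le (by isBoundedDefault) ?_⟩
  change (c : ℝ≥0∞) < (P'.map τ') (localBall h t) at hc
  have hc' := (ENNReal.toReal_lt_toReal ENNReal.coe_ne_top (measure_ne_top _ _)).2 hc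
  filter_upwards [hpos, hball h t c hc'] with n hn hle
  change _ ≤ ((Pₙ n).map (τₙ n)) _
  rw [(hcond n hn).map_eq, Measure.map_apply hτ (measurableSet_localBall h t), cond_apply (hE n),
    Set.inter_comm, ← ENNReal.div_eq_inv_mul, ENNReal.le_div_iff_mul_le (.inl hn)
      (.inl (measure_ne_top _ _)),
    ← ENNReal.toReal_le_toReal (by finiteness) (measure_ne_top _ _), ENNReal.toReal_mul]
  exact hle

end Windows

theorem mainTheorem8 (p : PMF ℕ) (hcrit : offspringMean p = 1) (hp : IsNondegenerate p)
    (A : Set ℕ) (hA : 0 < ∑' n : A, p n)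
    {Ω : Type*} [MeasurableSpace Ω] (P : Measure Ω) [IsProbabilityMeasure P]
    (τ : Ω → PlaneTree) (hτ : IsGWTree p τ P)
    {Ω' : Type*} [MeasurableSpace Ω'] (P' : Measure Ω') [IsProbabilityMeasure P']
    (τstar : Ω' → PlaneTree)
    (hτstar : IsKestenTree p (hcrit ▸ one_ne_zero) (hcrit ▸ ENNReal.one_ne_top) τstar P')
    {Ωₙ : ℕ → Type*} [∀ n, MeasurableSpace (Ωₙ n)] (Pₙ : ∀ n, Measure (Ωₙ n))
    [∀ n, IsProbabilityMeasure (Pₙ n)]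
    (τₙ : ∀ n, Ωₙ n → PlaneTree) (hτₙ : ∀ n, Measurable (τₙ n)) :
    (∃ q : PMF ℕ, IsReducedOffspring A τ P q) ∧
    (∀ q : PMF ℕ, IsReducedOffspring A τ P q →
      (∀ᶠ n : ℕ in atTop, P {ω | (n : ℕ∞) ≤ (τ ω).numDegreeIn A ∧
        (τ ω).numDegreeIn A < ((n + offspringPeriod q : ℕ) : ℕ∞)} ≠ 0) ∧
      (IsConditionedOn τ P (fun n => {ω | (n : ℕ∞) ≤ (τ ω).numDegreeIn A ∧
          (τ ω).numDegreeIn A < ((n + offspringPeriod q : ℕ) : ℕ∞)}) τₙ Pₙ →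
        TendstoInDistribution τₙ atTop τstar Pₙ P')) ∧
    ((∀ n : ℕ, P {ω | (n : ℕ∞) ≤ (τ ω).numDegreeIn A} ≠ 0) ∧
      (IsConditionedOn τ P (fun n => {ω | (n : ℕ∞) ≤ (τ ω).numDegreeIn A}) τₙ Pₙ →
        TendstoInDistribution τₙ atTop τstar Pₙ P')) := by
  have hp0 : p 0 ≠ 0 := hp.1.ne'
  have hmeas (J : Set ℕ∞) : MeasurableSet {ω | (τ ω).numDegreeIn A ∈ J} :=
    hτ.measurable (PlaneTree.measurable_numDegreeIn A .of_discrete)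
  have hstar := hτstar.measurable.aemeasurable (μ := P')
  have hτₙ' (n : ℕ) := (hτₙ n).aemeasurable (μ := Pₙ n)
  obtain ⟨q₀, hq₀⟩ := hτ.exists_isReducedOffspring hcrit hp0 hA
  have htail_ne := hq₀.measure_le_numDegreeIn_ne_zero hτ hA
  refine ⟨⟨q₀, hq₀⟩, fun q hq => ?_, htail_ne, fun hcond => ?_⟩
  · have hwindow_ne := hq.eventually_measure_window_ne_zero hτ hA
    refine ⟨hwindow_ne, fun hcond => hcond.tendstoInDistribution hτ.measurable hτₙ'
      (fun n => hmeas (Set.Ico n _)) hwindow_ne hstar fun h t c hc => ?_⟩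
    exact hq.eventually_mul_measureReal_window_le hτ hA hcrit (hτstar.law ▸ hc)
  · refine hcond.tendstoInDistribution hτ.measurable hτₙ' (fun n => hmeas (Set.Ici n))
      (.of_forall htail_ne) hstar fun h t c hc => ?_
    exact hq₀.eventually_mul_measureReal_tail_le hτ hA hcrit (hτstar.law ▸ hc)
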